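/- Let $m\ge 3$. Let $S_n$ and $K_n$ be the space requirement (number of nodes) and the key path length (sum over all keys of the distance from the root to the node holding the key) of the $m$-ary search tree built from a uniformly random permutation of $n$ keys (a sequence of $1\le n<m$ keys is stored in the root; for $n\ge m$ the first $m-1$ keys are sorted and stored in the root, and the remaining keys are directed, in order, to the $m$ subtrees corresponding to the $m$ intervals formed by the root keys). Let $\rho(S_n,K_n)=\mathrm{Cov}(S_n,K_n)/\sqrt{\mathbb V(S_n)\mathbb V(K_n)}$, and put $$H_m=\sum_{j=1}^m\frac1j,\quad H_m^{(2)}=\sum_{j=1}^m\frac1{j^2},\quad \phi=\frac1{2(H_m-1)},\quad C_K=4\phi^2\Bigl(\frac{(m+1)H_m^{(2)}-2}{m-1}-\frac{\pi^2}6\Bigr).$$ Then $\mathbb V(S_n)>0$ and $\mathbb V(K_n)>0$ for all sufficiently large $n$, $C_K>0$, and the following holds. (i) If $3\le m\le 26$, then $\rho(S_n,K_n)\to0$ as $n\to\infty$. (ii) If $m\ge27$, then there is exactly one zero $\lambda=\alpha+i\beta$ of $\Lambda(z)=z(z+1)\cdots(z+m-2)-m!$ with $\beta>0$ whose real part is the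 largest among the zeros of $\Lambda$ other than $2$ (the zero of largest real part). With $\Gamma$ the gamma function, $\psi=\Gamma'/\Gamma$, $\gamma$ Euler's constant, $$A=\frac1{\lambda(\lambda-1)\sum_{0\le j\le m-2}\frac1{j+\lambda}},$$ $$F_1(z)=2\frac{|A|^2}{|\Gamma(\lambda)|^2}\Bigl(-1+\frac{m!(m-1)|\Gamma(\lambda)|^2}{\Gamma(2\alpha+m-2)-m!\,\Gamma(2\alpha-1)}\Bigr)+2\Re\Bigl(\frac{A^2e^{2iz}}{\Gamma(\lambda)^2}\Bigl(-1+\frac{m!(m-1)\Gamma(\lambda)^2}{\Gamma(2\lambda+m-2)-m!\,\Gamma(2\lambda-1)}\Bigr)\Bigr),$$ $$F_2(z)=4\phi\,\Re\Bigl(\frac{(\lambda+m-1)Ae^{iz}}{(m-1)\Gamma(\lambda)}\Bigl(\frac1{2\phi}-\frac1{\lambda+m-1}\bigl\{(\lambda+m-1)\psi(\lambda+m)-\lambda\psi(\lambda+1)-(m-1)(1-\gamma)\bigr\}\Bigr)\Bigr),$$ one has $F_1(z)>0$ for all real $z$, and $\rho(S_n,K_n)$ is asymptotic to the oscillating function $F_2(\beta\log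 n)/\sqrt{C_KF_1(\beta\log n)}$ in the sense that $$\rho(S_n,K_n)-\frac{F_2(\beta\log n)}{\sqrt{C_K\,F_1(\beta\log n)}}\longrightarrow0\qquad(n\to\infty).$$ -/

import Mathlib

open Filter Topology ProbabilityTheory

/-! ### Search trees -/

/-- An `m`-ary tree: empty, or a root node that stores a list of keys and has an ordered
`m`-tuple of subtrees. -/
inductive MTree (m : ℕ) (α : Type) : Type
  | empty : MTree m α
  | node (keys : List α) (children : Fin m → MTree m α) : MTree m α

namespace MTree

variable {m : ℕ} {α : Type}

/-- The number of nodes of the tree. -/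
def nodes : MTree m α → ℕ
  | empty => 0
  | node _ ch => 1 + ∑ i, (ch i).nodes

/-- The sum over all keys of the tree of (depth of the node holding the key), where the root of
the tree is regarded as having depth `d`. -/
def pathLengthFrom : MTree m α → ℕ → ℕ
  | empty, _ => 0
  | node ks ch, d => ks.length * d + ∑ i, (ch i).pathLengthFrom (d + 1)

/-- The key path length: the sum of the distances between the root and each key. -/
def keyPathLength (t : MTree m α) : ℕ := t.pathLengthFrom 0

/-- The `m`-ary search tree built from a sequence of (distinct) keys. The empty sequence gives the
empty tree; if there are fewer than `m` keys, they are all stored in the root; otherwise the first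
`m - 1` keys are sorted and stored in the root, and each remaining key `x` is directed (in the
order of arrival) to the subtree whose index is the number of root keys that are smaller than `x`,
i.e. to the subtree of the interval between consecutive root keys in which `x` lies. (Only `m ≥ 2`
is meaningful; for `m ≤ 1` all the keys are put in the root.) -/
def build (m : ℕ) {α : Type} [LinearOrder α] (l : List α) : MTree m α :=
  if l = [] then empty
  else if h : 2 ≤ m ∧ m ≤ l.length then
    node ((l.take (m - 1)).mergeSort (fun a b => decide (a ≤ b)))
      (fun i => build m
        ((l.drop (m - 1)).filter
          (fun x => decide (((l.take (m - 1)).filter (fun y => decide (y < x))).length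
            = (i : ℕ)))))
  else node (l.mergeSort (fun a b => decide (a ≤ b))) (fun _ => empty)
termination_by l.length
decreasing_by
  refine lt_of_le_of_lt (List.length_filter_le _ _) ?_
  rw [List.length_drop]
  omega

end MTree

/-! ### Random search trees, space requirement and key path length -/

instance permMeasurableSpace (n : ℕ) : MeasurableSpace (Equiv.Perm (Fin n)) := ⊤

instance permDiscreteMeasurableSpace (n : ℕ) : DiscreteMeasurableSpace (Equiv.Perm (Fin n)) :=
  ⟨fun _ => trivial⟩

noncomputable section

/-- The uniform distribution on the permutations of `n` keys. -/
abbrev permMeasure (n : ℕ) : MeasureTheory.Measure (Equiv.Perm (Fin n)) :=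
  (PMF.uniformOfFintype (Equiv.Perm (Fin n))).toMeasure

/-- The `m`-ary search tree built from the sequence `σ 0, σ 1, …, σ (n - 1)`. -/
def searchTree (m n : ℕ) (σ : Equiv.Perm (Fin n)) : MTree m (Fin n) :=
  MTree.build m (List.ofFn σ)

/-- The space requirement `S_n`, as a random variable. -/
def spaceReq (m n : ℕ) (σ : Equiv.Perm (Fin n)) : ℝ := (searchTree m n σ).nodes

/-- The key path length `K_n`, as a random variable. -/
def keyPath (m n : ℕ) (σ : Equiv.Perm (Fin n)) : ℝ := (searchTree m n σ).keyPathLength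

/-- The correlation coefficient of two real random variables. -/
def correlation {Ω : Type} [MeasurableSpace Ω] (μ : MeasureTheory.Measure Ω) (X Y : Ω → ℝ) : ℝ :=
  cov[X, Y; μ] / (√(Var[X; μ]) * √(Var[Y; μ]))

/-- `ρ(S_n, K_n)` for random `m`-ary search trees on `n` keys. -/
def rhoSK (m n : ℕ) : ℝ := correlation (permMeasure n) (spaceReq m n) (keyPath m n)

/-! ### The constants and the periodic functions -/

/-- The indicial polynomial `Λ(z) = z (z + 1) ⋯ (z + m - 2) - m!`. -/
def indicial (m : ℕ) (z : ℂ) : ℂ := (∏ j ∈ Finset.range (m - 1), (z + j)) - (m.factorial : ℂ)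

/-- `lam = α + i β` with `β > 0` is a zero of `Λ` of second largest real part: its real part is
maximal among the zeros other than `2`, which is the zero of largest real part. -/
def IsSecondZero (m : ℕ) (lam : ℂ) : Prop :=
  indicial m lam = 0 ∧ 0 < lam.im ∧ ∀ w : ℂ, indicial m w = 0 → w ≠ 2 → w.re ≤ lam.re

/-- `H_m = ∑_{1 ≤ j ≤ m} 1 / j`. -/
def harm (m : ℕ) : ℝ := ∑ j ∈ Finset.Icc 1 m, 1 / (j : ℝ)

/-- `H_m^{(2)} = ∑_{1 ≤ j ≤ m} 1 / j ^ 2`. -/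
def harm2 (m : ℕ) : ℝ := ∑ j ∈ Finset.Icc 1 m, 1 / (j : ℝ) ^ 2

/-- The occupancy constant `φ = 1 / (2 (H_m - 1))`. -/
def occ (m : ℕ) : ℝ := 1 / (2 * (harm m - 1))

/-- `C_K = 4 φ² (((m + 1) H_m^{(2)} - 2) / (m - 1) - π² / 6)`. -/
def constK (m : ℕ) : ℝ :=
  4 * occ m ^ 2 * ((((m : ℝ) + 1) * harm2 m - 2) / ((m : ℝ) - 1) - Real.pi ^ 2 / 6)

/-- `A = 1 / (λ (λ - 1) ∑_{0 ≤ j ≤ m - 2} 1 / (j + λ))`. -/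
def coeffA (m : ℕ) (lam : ℂ) : ℂ :=
  1 / (lam * (lam - 1) * ∑ j ∈ Finset.range (m - 1), 1 / ((j : ℂ) + lam))

/-- The periodic function `F_1` of the variance of `S_n`; here `lam = α + i β`. -/
def periodicF1 (m : ℕ) (lam : ℂ) (z : ℝ) : ℝ :=
  2 * (‖coeffA m lam‖ ^ 2 / ‖Complex.Gamma lam‖ ^ 2) *
      (-1 + (m.factorial : ℝ) * ((m : ℝ) - 1) * ‖Complex.Gamma lam‖ ^ 2 /
        (Real.Gamma (2 * lam.re + m - 2) - (m.factorial : ℝ) * Real.Gamma (2 * lam.re - 1))) +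
    2 * (coeffA m lam ^ 2 * Complex.exp (2 * Complex.I * z) / Complex.Gamma lam ^ 2 *
      (-1 + (m.factorial : ℂ) * ((m : ℂ) - 1) * Complex.Gamma lam ^ 2 /
        (Complex.Gamma (2 * lam + m - 2) - (m.factorial : ℂ) * Complex.Gamma (2 * lam - 1)))).re

/-- The periodic function `F_2` of the covariance of `S_n` and `K_n`; here `lam = α + i β`. -/
def periodicF2 (m : ℕ) (lam : ℂ) (z : ℝ) : ℝ :=
  4 * occ m *
    ((lam + m - 1) * coeffA m lam * Complex.exp (Complex.I * z) /
        (((m : ℂ) - 1) * Complex.Gamma lam) *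
      (1 / (2 * (occ m : ℂ)) -
        1 / (lam + m - 1) *
          ((lam + m - 1) * Complex.digamma (lam + m) - lam * Complex.digamma (lam + 1) -
            ((m : ℂ) - 1) * (1 - (Real.eulerMascheroniConstant : ℂ))))).re

end

/-! Given the sizes of the subtrees, the `m` subtrees of the root are independent random search
trees. The mean of an additive functional therefore satisfies `a = T a + toll`, where `T = splitSum`
averages over the subtree sizes. Mixed second moments satisfy the same equation with an extra toll
`splitPair` coming from pairs of distinct subtrees.

The operator T is diagonalised by `negBinom w`, the coefficients of (1 - z)^(-w), with eigenvalue m!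
/ (w(w+1)...(w+m-2)). Hence the fixed points of T are the combinations of `negBinom z` over the
zeros z of Λ, which are simple (`exists_eq_sum_negBinom`). Multiplying generating functions adds
parameters, and differentiating in w produces logarithms, so the leading part of every toll has an
explicit particular solution. As T contracts sequences of order n^s with s > 1, errors in the toll
pass to the solution without loss (`isLittleO_of_sub_splitSum`).

After an affine correction the mean of S_n is the sum of A(z) `negBinom z` over the zeros z other
than 2 (a partial fraction identity). The mean of K_n is 2φ times the parameter derivative of
`negBinom` at the resonant zero 2, plus smaller terms. This yields V(K_n) ~ C_K n^2. If α > 3/2,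
then V(S_n) and Cov are n^(2α-2) F_1 and n^α F_2 up to smaller order, and the powers cancel in ρ. If
all zeros other than 2 have real part below 3/2, then Cov = o(n^(3/2)), whereas V(S_n) grows at
least linearly (`IsMomentSystem.exists_le_variance`), so ρ tends to 0.

The threshold between 26 and 27 (`re_lt_of_indicial`, `exists_indicial_zero`) rests on the
monotonicity of modulus and argument of z(z+1)...(z+m-2) in the right half plane, with exact integer
arithmetic at one point on the line Re z = 3/2 in each case. Positivity of F_1 (`periodicF1_pos`)
follows from Cauchy-Schwarz: the variance dominates the squared covariances of the conditional mean
of S_n with two test sums over the subtree sizes, and these cannot vanish in the limit at the same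
phase because λ is not real. -/

noncomputable section

/-! ### Averages over random arrangements of a finite set -/

/-- The average of `f` over all arrangements of the elements of `s`, a set of `n` elements. -/
def arrAvg {α : Type} [DecidableEq α] : ℕ → Finset α → (List α → ℝ) → ℝ
  | 0, _, f => f []
  | n + 1, s, f => (∑ a ∈ s, arrAvg n (s.erase a) (fun l => f (a :: l))) / (n + 1)

section Arrangements

variable {α : Type} [DecidableEq α]

theorem arrAvg_congr {n : ℕ} {s : Finset α} (hs : s.card = n) {f g : List α → ℝ}
    (h : ∀ l : List α, l.Nodup → l.toFinset = s → f l = g l) : arrAvg n s f = arrAvg n s g := by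
  induction n generalizing s f g with
  | zero =>
    rw [Finset.card_eq_zero] at hs
    simpa [arrAvg, hs] using h [] (by simp) (by simp [hs])
  | succ n ih =>
    simp only [arrAvg]
    congr 1
    refine Finset.sum_congr rfl fun a ha => ih (by rw [Finset.card_erase_of_mem ha, hs]; rfl) ?_
    intro l hl hls
    refine h _ (List.nodup_cons.2 ⟨?_, hl⟩) ?_
    · rw [← List.mem_toFinset, hls]; simp
    · rw [List.toFinset_cons, hls, Finset.insert_erase ha]

theorem arrAvg_add (n : ℕ) (s : Finset α) (f g : List α → ℝ) :
    arrAvg n s (fun l => f l + g l) = arrAvg n s f + arrAvg n s g := by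
  induction n generalizing s f g with
  | zero => rfl
  | succ n ih => simp only [arrAvg, ih, Finset.sum_add_distrib, add_div]

theorem arrAvg_const_mul (n : ℕ) (s : Finset α) (c : ℝ) (f : List α → ℝ) :
    arrAvg n s (fun l => c * f l) = c * arrAvg n s f := by
  induction n generalizing s f with
  | zero => rfl
  | succ n ih => simp only [arrAvg, ih, ← Finset.mul_sum, mul_div_assoc]

theorem arrAvg_const {n : ℕ} {s : Finset α} (hs : s.card = n) (c : ℝ) :
    arrAvg n s (fun _ => c) = c := by
  induction n generalizing s with
  | zero => rfl
  | succ n ih =>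
    have h : ∀ a ∈ s, arrAvg n (s.erase a) (fun _ => c) = c := fun a ha =>
      ih (by rw [Finset.card_erase_of_mem ha, hs]; rfl)
    simp only [arrAvg]
    rw [Finset.sum_congr rfl h, Finset.sum_const, hs, nsmul_eq_mul]
    have : ((n : ℝ) + 1) ≠ 0 := by positivity
    push_cast
    field_simp

theorem arrAvg_sum {ι : Type} (t : Finset ι) (n : ℕ) (s : Finset α) (f : ι → List α → ℝ) :
    arrAvg n s (fun l => ∑ i ∈ t, f i l) = ∑ i ∈ t, arrAvg n s (f i) := by
  classical
  induction t using Finset.induction_on with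
  | empty =>
    have := arrAvg_const_mul n s 0 (fun _ => 0)
    simpa using this
  | insert i t hi ih => simp only [Finset.sum_insert hi, arrAvg_add, ih]

theorem arrAvg_nonneg {n : ℕ} {s : Finset α} {f : List α → ℝ} (h : ∀ l, 0 ≤ f l) :
    0 ≤ arrAvg n s f := by
  induction n generalizing s f with
  | zero => exact h _
  | succ n ih =>
    exact div_nonneg (Finset.sum_nonneg fun a _ => ih fun l => h _) (by positivity)

/-- In a random arrangement the arrangements of the cells of a partition are independent. -/
theorem arrAvg_prod_filter (k : ℕ) (c : α → ℕ) {n : ℕ} {s : Finset α} (hs : s.card = n)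
    (hc : ∀ a ∈ s, c a < k) (g : ℕ → List α → ℝ) :
    arrAvg n s (fun l => ∏ i ∈ Finset.range k, g i (l.filter (fun x => decide (c x = i)))) =
      ∏ i ∈ Finset.range k, arrAvg (s.filter (fun x => c x = i)).card
        (s.filter (fun x => c x = i)) (g i) := by
  induction n generalizing s g with
  | zero =>
    rw [Finset.card_eq_zero] at hs
    simp [hs, arrAvg]
  | succ n ih =>
    set A : ℕ → ℝ := fun i => arrAvg (s.filter (fun x => c x = i)).card
        (s.filter (fun x => c x = i)) (g i) with hA
    -- Drawing `a` first affects only the factor of its own cell, where `g` is precomposed with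
    -- consing `a`; the induction hypothesis is applied to this modified `g`.
    have key : ∀ a ∈ s, arrAvg n (s.erase a) (fun l => ∏ i ∈ Finset.range k,
        g i ((a :: l).filter (fun x => decide (c x = i)))) =
        (∏ i ∈ (Finset.range k).erase (c a), A i) *
          arrAvg ((s.filter (fun x => c x = c a)).card - 1)
            ((s.filter (fun x => c x = c a)).erase a) (fun l => g (c a) (a :: l)) := by
      intro a ha
      have h1 : ∀ l : List α, (∏ i ∈ Finset.range k,
          g i ((a :: l).filter (fun x => decide (c x = i)))) = ∏ i ∈ Finset.range k,
          (if c a = i then fun l => g i (a :: l) else g i)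
            (l.filter (fun x => decide (c x = i))) := by
        intro l
        refine Finset.prod_congr rfl fun i _ => ?_
        by_cases h : c a = i <;> simp [h]
      simp only [h1]
      rw [ih (by rw [Finset.card_erase_of_mem ha, hs]; rfl)
        (fun b hb => hc b (Finset.mem_of_mem_erase hb))
        (fun i => if c a = i then fun l => g i (a :: l) else g i)]
      rw [← Finset.prod_erase_mul _ _ (Finset.mem_range.2 (hc a ha))]
      congr 1
      · refine Finset.prod_congr rfl fun i hi => ?_
        have hne : c a ≠ i := (Finset.ne_of_mem_erase hi).symm
        have : (s.erase a).filter (fun x => c x = i) = s.filter (fun x => c x = i) := by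
          ext x; simp only [Finset.mem_filter, Finset.mem_erase]
          constructor
          · rintro ⟨⟨_, h⟩, h'⟩; exact ⟨h, h'⟩
          · rintro ⟨h, h'⟩; refine ⟨⟨?_, h⟩, h'⟩; rintro rfl; exact hne h'
        rw [this, if_neg hne]
      · have : (s.erase a).filter (fun x => c x = c a) = (s.filter (fun x => c x = c a)).erase a := by
          ext x; simp only [Finset.mem_filter, Finset.mem_erase]; tauto
        rw [this, if_pos rfl, Finset.card_erase_of_mem (by simp [ha])]
    have hcell : ∀ i, ∑ a ∈ s.filter (fun x => c x = i),
        arrAvg ((s.filter (fun x => c x = i)).card - 1)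
            ((s.filter (fun x => c x = i)).erase a) (fun l => g i (a :: l)) =
        (s.filter (fun x => c x = i)).card * A i := by
      intro i
      simp only [hA]
      generalize s.filter (fun x => c x = i) = t
      rcases hq : t.card with _ | q
      · rw [Finset.card_eq_zero] at hq; simp [hq]
      · simp only [arrAvg, Nat.add_sub_cancel]
        have : ((q : ℝ) + 1) ≠ 0 := by positivity
        push_cast
        field_simp
    simp only [arrAvg]
    -- Grouped by the cell of the first element, each cell contributes its size times the full
    -- product; the sizes add up to `n + 1`, which cancels the normalisation.
    rw [Finset.sum_congr rfl key, ← Finset.sum_fiberwise_of_maps_to (t := Finset.range k) (g := c)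
      (fun a ha => Finset.mem_range.2 (hc a ha))]
    have h2 : ∀ i ∈ Finset.range k, (∑ a ∈ s.filter (fun x => c x = i),
        (∏ i ∈ (Finset.range k).erase (c a), A i) *
          arrAvg ((s.filter (fun x => c x = c a)).card - 1)
            ((s.filter (fun x => c x = c a)).erase a) (fun l => g (c a) (a :: l))) =
        ((s.filter (fun x => c x = i)).card : ℝ) * ∏ i ∈ Finset.range k, A i := by
      intro i hi
      have : ∀ a ∈ s.filter (fun x => c x = i), (∏ i ∈ (Finset.range k).erase (c a), A i) *
          arrAvg ((s.filter (fun x => c x = c a)).card - 1)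
            ((s.filter (fun x => c x = c a)).erase a) (fun l => g (c a) (a :: l)) =
          (∏ i ∈ (Finset.range k).erase i, A i) *
          arrAvg ((s.filter (fun x => c x = i)).card - 1)
            ((s.filter (fun x => c x = i)).erase a) (fun l => g i (a :: l)) := by
        intro a ha
        rw [(Finset.mem_filter.1 ha).2]
      rw [Finset.sum_congr rfl this, ← Finset.mul_sum, hcell, ← Finset.prod_erase_mul _ _ hi]
      ring
    rw [Finset.sum_congr rfl h2, ← Finset.sum_mul, ← Nat.cast_sum,
      ← Finset.card_eq_sum_card_fiberwise (fun a ha => Finset.mem_range.2 (hc a ha)), hs]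
    have : ((n : ℝ) + 1) ≠ 0 := by positivity
    push_cast
    field_simp

/-- The first `k` elements of a random arrangement form a uniformly random `k`-subset. -/
theorem arrAvg_take_drop {n k : ℕ} (hk : k ≤ n) {s : Finset α} (hs : s.card = n)
    (F : Finset α → List α → ℝ) :
    arrAvg n s (fun l => F (l.take k).toFinset (l.drop k)) =
      (∑ R ∈ s.powersetCard k, arrAvg (n - k) (s \ R) (F R)) / n.choose k := by
  induction k generalizing n s F with
  | zero => simp
  | succ k ih =>
    obtain ⟨n, rfl⟩ : ∃ q, n = q + 1 := ⟨n - 1, by omega⟩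
    simp only [arrAvg, List.take_succ_cons, List.drop_succ_cons, List.toFinset_cons]
    have h1 : ∀ a ∈ s, arrAvg n (s.erase a)
        (fun l => F (insert a (l.take k).toFinset) (l.drop k)) =
        (∑ R ∈ (s.erase a).powersetCard k,
          arrAvg (n - k) (s \ insert a R) (F (insert a R))) / n.choose k := by
      intro a ha
      rw [ih (by omega) (by rw [Finset.card_erase_of_mem ha, hs]; rfl) (fun R => F (insert a R))]
      congr 1
      refine Finset.sum_congr rfl fun R _ => ?_
      rw [Finset.erase_sdiff_comm, ← Finset.sdiff_insert]
    -- Each (k+1)-subset occurs once for every choice of the element that came first, hence k + 1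
    -- times.
    have h2 : ∑ a ∈ s, ∑ R ∈ (s.erase a).powersetCard k,
          arrAvg (n - k) (s \ insert a R) (F (insert a R)) =
        ∑ R ∈ s.powersetCard (k + 1), ∑ _a ∈ R, arrAvg (n - k) (s \ R) (F R) := by
      rw [Finset.sum_sigma', Finset.sum_sigma']
      refine Finset.sum_bij' (fun p _ => ⟨insert p.1 p.2, p.1⟩) (fun p _ => ⟨p.2, p.1.erase p.2⟩)
        ?_ ?_ ?_ ?_ ?_
      · rintro ⟨a, R⟩ h
        simp only [Finset.mem_sigma, Finset.mem_powersetCard] at h ⊢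
        obtain ⟨ha, hR, hc⟩ := h
        have haR : a ∉ R := fun h => by simpa using hR h
        refine ⟨⟨?_, by rw [Finset.card_insert_of_notMem haR, hc]⟩, by simp⟩
        exact Finset.insert_subset ha (hR.trans (Finset.erase_subset _ _))
      · rintro ⟨R, a⟩ h
        simp only [Finset.mem_sigma, Finset.mem_powersetCard] at h ⊢
        obtain ⟨⟨hR, hc⟩, ha⟩ := h
        exact ⟨hR ha, Finset.erase_subset_erase _ hR, by rw [Finset.card_erase_of_mem ha, hc]; rfl⟩
      · rintro ⟨a, R⟩ h
        simp only [Finset.mem_sigma, Finset.mem_powersetCard] at h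
        have haR : a ∉ R := fun h' => by simpa using h.2.1 h'
        simp [Finset.erase_insert haR]
      · rintro ⟨R, a⟩ h
        simp only [Finset.mem_sigma, Finset.mem_powersetCard] at h
        simp [Finset.insert_erase h.2]
      · rintro ⟨a, R⟩ _
        rfl
    rw [Finset.sum_congr rfl h1, ← Finset.sum_div, h2]
    have h3 : ∀ R ∈ s.powersetCard (k + 1), ∑ _a ∈ R, arrAvg (n - k) (s \ R) (F R) =
        ((k : ℝ) + 1) * arrAvg (n - k) (s \ R) (F R) := by
      intro R hR
      rw [Finset.sum_const, (Finset.mem_powersetCard.1 hR).2, nsmul_eq_mul]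
      push_cast; rfl
    rw [Finset.sum_congr rfl h3, ← Finset.mul_sum, Nat.succ_sub_succ]
    have h4 : ((n : ℝ) + 1) * n.choose k = (n + 1).choose (k + 1) * ((k : ℝ) + 1) := by
      exact_mod_cast Nat.add_one_mul_choose_eq n k
    have h5 : (n.choose k : ℝ) ≠ 0 := by
      exact_mod_cast (Nat.choose_pos (by omega : k ≤ n)).ne'
    have h6 : ((n + 1).choose (k + 1) : ℝ) ≠ 0 := by
      exact_mod_cast (Nat.choose_pos (by omega : k + 1 ≤ n + 1)).ne'
    have : ((n : ℝ) + 1) ≠ 0 := by positivity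
    field_simp
    linear_combination (-(∑ R ∈ s.powersetCard (k + 1), arrAvg (n - k) (s \ R) (F R))) * h4

end Arrangements

/-! ### Sizes of the gaps left by a random subset -/

section Gaps

variable {α : Type} [LinearOrder α]

/-- The pairs (elements below, elements above) run once through the pairs with sum |s| - 1. Adding a
new maximum raises every "above" count by one, which is why `F` is generalised in the induction. -/
theorem sum_rank (s : Finset α) (F : ℕ → ℕ → ℝ) :
    ∑ r ∈ s, F (s.filter (· < r)).card (s.filter (r < ·)).card =
      ∑ i ∈ Finset.range s.card, F i (s.card - 1 - i) := by
  induction s using Finset.induction_on_max generalizing F with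
  | empty => simp
  | insert a s hmax ih =>
    have ha : a ∉ s := fun h => lt_irrefl _ (hmax a h)
    rw [Finset.sum_insert ha, Finset.card_insert_of_notMem ha, Finset.sum_range_succ, add_comm]
    congr 1
    · have h1 : ∀ r ∈ s, F ((insert a s).filter (· < r)).card ((insert a s).filter (r < ·)).card =
          F (s.filter (· < r)).card ((s.filter (r < ·)).card + 1) := by
        intro r hr
        rw [Finset.filter_insert, if_neg (not_lt.2 (hmax r hr).le), Finset.filter_insert,
          if_pos (hmax r hr), Finset.card_insert_of_notMem (by simp [ha])]
      rw [Finset.sum_congr rfl h1, ih fun x y => F x (y + 1)]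
      refine Finset.sum_congr rfl fun i hi => ?_
      rw [Finset.mem_range] at hi
      congr 1; omega
    · rw [Finset.filter_insert, if_neg (lt_irrefl _), Finset.filter_insert, if_neg (lt_irrefl _),
        Finset.filter_true_of_mem hmax, Finset.filter_false_of_mem fun x hx => (hmax x hx).not_gt]
      simp

/-- The number of elements of `R` below `x`. -/
def rankIn (R : Finset α) (x : α) : ℕ := (R.filter (· < x)).card

/-- The generating function of the gap sizes left by `k`-subsets. -/
theorem sum_prod_gaps (k : ℕ) (s : Finset α) (φ : ℕ → ℕ → ℝ) :
    ∑ R ∈ s.powersetCard k, ∏ i ∈ Finset.range (k + 1),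
        φ i ((s \ R).filter (fun x => rankIn R x = i)).card =
      PowerSeries.coeff s.card
        (PowerSeries.X ^ k * ∏ i ∈ Finset.range (k + 1), PowerSeries.mk (φ i)) := by
  induction k generalizing s φ with
  | zero => simp [rankIn]
  | succ k ih =>
    -- A subset is cut at its minimum `r`: gap 0 consists of the elements below `r`, and the other
    -- gaps are those of a k-subset of the elements above `r`.
    have h1 : ∑ R ∈ s.powersetCard (k + 1), ∏ i ∈ Finset.range (k + 1 + 1),
        φ i ((s \ R).filter (fun x => rankIn R x = i)).card =
        ∑ r ∈ s, ∑ R ∈ (s.filter (r < ·)).powersetCard k, φ 0 (s.filter (· < r)).card *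
          ∏ i ∈ Finset.range (k + 1),
            φ (i + 1) (((s.filter (r < ·)) \ R).filter (fun x => rankIn R x = i)).card := by
      rw [Finset.sum_sigma']
      symm
      refine Finset.sum_bij (fun p _ => insert p.1 p.2) ?_ ?_ ?_ ?_
      · rintro ⟨r, R⟩ h
        simp only [Finset.mem_sigma, Finset.mem_powersetCard] at h ⊢
        obtain ⟨hr, hR, hc⟩ := h
        have hrR : r ∉ R := fun h => by simpa using hR h
        exact ⟨Finset.insert_subset hr (hR.trans (Finset.filter_subset _ _)),
          by rw [Finset.card_insert_of_notMem hrR, hc]⟩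
      · rintro ⟨r, R⟩ h ⟨r', R'⟩ h' heq
        simp only [Finset.mem_sigma, Finset.mem_powersetCard] at h h' heq
        have hR : ∀ x ∈ R, r < x := fun x hx => (Finset.mem_filter.1 (h.2.1 hx)).2
        have hR' : ∀ x ∈ R', r' < x := fun x hx => (Finset.mem_filter.1 (h'.2.1 hx)).2
        have e1 : r = r' := by
          have a1 : r ∈ insert r' R' := heq ▸ Finset.mem_insert_self _ _
          have a2 : r' ∈ insert r R := heq ▸ Finset.mem_insert_self _ _
          rw [Finset.mem_insert] at a1 a2
          rcases a1 with a1 | a1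
          · exact a1
          · rcases a2 with a2 | a2
            · exact a2.symm
            · exact absurd (hR _ a2) (hR' _ a1).not_gt
        subst e1
        have n1 : r ∉ R := fun h => lt_irrefl _ (hR _ h)
        have n2 : r ∉ R' := fun h => lt_irrefl _ (hR' _ h)
        have : R = R' := by rw [← Finset.erase_insert n1, heq, Finset.erase_insert n2]
        rw [this]
      · intro Q hQ
        rw [Finset.mem_powersetCard] at hQ
        have hne : Q.Nonempty := by rw [← Finset.card_pos]; omega
        refine ⟨⟨Q.min' hne, Q.erase (Q.min' hne)⟩, ?_, ?_⟩
        · simp only [Finset.mem_sigma, Finset.mem_powersetCard]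
          refine ⟨hQ.1 (Finset.min'_mem _ _), fun x hx => ?_, ?_⟩
          · rw [Finset.mem_filter]
            exact ⟨hQ.1 (Finset.mem_of_mem_erase hx), Finset.min'_lt_of_mem_erase_min' _ hne hx⟩
          · rw [Finset.card_erase_of_mem (Finset.min'_mem _ _), hQ.2]; rfl
        · exact Finset.insert_erase (Finset.min'_mem _ hne)
      · rintro ⟨r, R⟩ h
        simp only [Finset.mem_sigma, Finset.mem_powersetCard] at h
        have hR : ∀ x ∈ R, r < x := fun x hx => (Finset.mem_filter.1 (h.2.1 hx)).2
        have hrR : r ∉ R := fun h => lt_irrefl _ (hR _ h)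
        have rk1 : ∀ x, x ≤ r → rankIn (insert r R) x = 0 := by
          intro x hx
          rw [rankIn, Finset.card_eq_zero, Finset.filter_eq_empty_iff]
          intro y hy
          rw [Finset.mem_insert] at hy
          rcases hy with rfl | hy
          · exact not_lt.2 hx
          · exact not_lt.2 (hx.trans (hR y hy).le)
        have rk2 : ∀ x, r < x → rankIn (insert r R) x = rankIn R x + 1 := by
          intro x hx
          rw [rankIn, Finset.filter_insert, if_pos hx,
            Finset.card_insert_of_notMem (by simp [hrR]), rankIn]
        rw [Finset.prod_range_succ' _ (k + 1), mul_comm]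
        congr 1
        · refine Finset.prod_congr rfl fun i _ => ?_
          congr 2
          ext x
          simp only [Finset.mem_filter, Finset.mem_sdiff, Finset.mem_insert, not_or]
          constructor
          · rintro ⟨⟨⟨h1, h2⟩, h3⟩, h4⟩
            exact ⟨⟨h1, h2.ne', h3⟩, by rw [rk2 x h2, h4]⟩
          · rintro ⟨⟨h1, h2, h3⟩, h4⟩
            have : r < x := by
              by_contra hlt
              rw [rk1 x (not_lt.1 hlt)] at h4
              omega
            rw [rk2 x this] at h4
            exact ⟨⟨⟨h1, this⟩, h3⟩, by omega⟩
        · congr 2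
          ext x
          simp only [Finset.mem_filter, Finset.mem_sdiff, Finset.mem_insert, not_or]
          constructor
          · rintro ⟨h1, h2⟩
            exact ⟨⟨h1, h2.ne, fun hx => (hR x hx).not_gt h2⟩, rk1 x h2.le⟩
          · rintro ⟨⟨h1, h2, h3⟩, h4⟩
            refine ⟨h1, lt_of_le_of_ne ?_ h2⟩
            by_contra hlt
            rw [rk2 x (not_le.1 hlt)] at h4
            omega
    rw [h1]
    simp only [← Finset.mul_sum]
    simp only [ih _ fun i => φ (i + 1)]
    rw [sum_rank s (fun a b => φ 0 a * PowerSeries.coeff b (PowerSeries.X ^ k *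
      ∏ i ∈ Finset.range (k + 1), PowerSeries.mk (φ (i + 1))))]
    rw [Finset.prod_range_succ' _ (k + 1), pow_succ']
    have h2 : (PowerSeries.X : PowerSeries ℝ) * PowerSeries.X ^ k *
        ((∏ i ∈ Finset.range (k + 1), PowerSeries.mk (φ (i + 1))) * PowerSeries.mk (φ 0)) =
        PowerSeries.X * (PowerSeries.mk (φ 0) *
          (PowerSeries.X ^ k * ∏ i ∈ Finset.range (k + 1), PowerSeries.mk (φ (i + 1)))) := by ring
    rw [h2]
    rcases s.card with _ | n
    · simp
    · rw [PowerSeries.coeff_succ_X_mul, PowerSeries.coeff_mul,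
        Finset.Nat.sum_antidiagonal_eq_sum_range_succ_mk]
      simp

end Gaps

end

/-! ### The splitting operators and the moment recurrences of additive functionals -/

noncomputable section

/-- The operator `a ↦ E ∑ᵢ a (Iᵢ)`, where `(I₁, …, I_m)` are the sizes of the subtrees. -/
def splitSum {𝕜 : Type*} [Field 𝕜] (m : ℕ) (a : ℕ → 𝕜) (n : ℕ) : 𝕜 :=
  (m : 𝕜) / (n.choose (m - 1) : 𝕜) * PowerSeries.coeff n
    (PowerSeries.X ^ (m - 1) * (PowerSeries.mk a * PowerSeries.mk 1 ^ (m - 1)))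

/-- The operator `a, b ↦ E ∑_{i ≠ k} a (Iᵢ) b (I_k)`, where `(I₁, …, I_m)` are the sizes of the
subtrees. -/
def splitPair {𝕜 : Type*} [Field 𝕜] (m : ℕ) (a b : ℕ → 𝕜) (n : ℕ) : 𝕜 :=
  (m : 𝕜) * ((m : 𝕜) - 1) / (n.choose (m - 1) : 𝕜) * PowerSeries.coeff n
    (PowerSeries.X ^ (m - 1) * (PowerSeries.mk a * PowerSeries.mk b * PowerSeries.mk 1 ^ (m - 2)))

section Cells

variable {α : Type} [LinearOrder α]

/-- The sequence of the keys that are directed to the `i`-th subtree. -/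
def cell (m : ℕ) (l : List α) (i : ℕ) : List α :=
  (l.drop (m - 1)).filter (fun x => decide
    (((l.take (m - 1)).filter (fun y => decide (y < x))).length = i))

/-- Root keys form a uniform subset, the cells are then independent, and the gap sizes have a
product generating function. Means are assumed only for fewer than `n` keys, so the result can be
used inside an induction on the number of keys. -/
theorem arrAvg_prod_cell {m n : ℕ} (hm : 2 ≤ m) (hn : m - 1 ≤ n) {s : Finset α}
    (hs : s.card = n) (g : ℕ → List α → ℝ) (φ : ℕ → ℕ → ℝ)
    (h : ∀ i, ∀ C : Finset α, C.card < n → arrAvg C.card C (g i) = φ i C.card) :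
    arrAvg n s (fun l => ∏ i ∈ Finset.range m, g i (cell m l i)) =
      PowerSeries.coeff n (PowerSeries.X ^ (m - 1) *
        ∏ i ∈ Finset.range m, PowerSeries.mk (φ i)) / n.choose (m - 1) := by
  have h1 : arrAvg n s (fun l => ∏ i ∈ Finset.range m, g i (cell m l i)) =
      arrAvg n s (fun l => (fun (R : Finset α) (r : List α) => ∏ i ∈ Finset.range m,
        g i (r.filter (fun x => decide (rankIn R x = i)))) (l.take (m - 1)).toFinset
          (l.drop (m - 1))) := by
    refine arrAvg_congr hs fun l hl _ => ?_
    refine Finset.prod_congr rfl fun i _ => ?_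
    congr 1
    refine List.filter_congr fun x _ => ?_
    congr 2
    rw [rankIn, ← List.toFinset_card_of_nodup ((hl.sublist (List.take_sublist _ _)).filter _),
      List.toFinset_filter]
    congr 2
    ext y
    simp
  refine h1.trans ((arrAvg_take_drop hn hs (fun R r => ∏ i ∈ Finset.range m,
    g i (r.filter (fun x => decide (rankIn R x = i))))).trans ?_)
  congr 1
  have hmm : m - 1 + 1 = m := by omega
  have h2 := sum_prod_gaps (m - 1) s φ
  rw [hmm, hs] at h2
  rw [← h2]
  refine Finset.sum_congr rfl fun R hR => ?_
  rw [Finset.mem_powersetCard] at hR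
  have hsR : (s \ R).card = n - (m - 1) := by
    rw [Finset.card_sdiff_of_subset hR.1, hs, hR.2]
  rw [arrAvg_prod_filter m (rankIn R) hsR]
  · refine Finset.prod_congr rfl fun i _ => h i _ ?_
    refine (Finset.card_filter_le _ _).trans_lt ?_
    omega
  · intro a _
    refine (Finset.card_filter_le _ _).trans_lt ?_
    omega

theorem arrAvg_sum_cell {m n : ℕ} (hm : 2 ≤ m) (hn : m - 1 ≤ n) {s : Finset α}
    (hs : s.card = n) (g : List α → ℝ) (φ : ℕ → ℝ)
    (h : ∀ C : Finset α, C.card < n → arrAvg C.card C g = φ C.card) :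
    arrAvg n s (fun l => ∑ i ∈ Finset.range m, g (cell m l i)) = splitSum m φ n := by
  rw [arrAvg_sum]
  have h1 : ∀ i ∈ Finset.range m, arrAvg n s (fun l => g (cell m l i)) =
      PowerSeries.coeff n (PowerSeries.X ^ (m - 1) *
        (PowerSeries.mk φ * PowerSeries.mk 1 ^ (m - 1))) / n.choose (m - 1) := by
    intro i hi
    -- With 1 in all other cells, each of those contributes the series 1/(1-z). The value does not
    -- depend on the position `i`, hence the factor `m` in `splitSum`.
    have h2 := arrAvg_prod_cell hm hn hs (fun j => if j = i then g else fun _ => 1)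
      (fun j => if j = i then φ else 1) (by
        intro j C hC
        by_cases hj : j = i
        · simpa [hj] using h C hC
        · simpa [hj] using arrAvg_const rfl 1)
    have h3 : ∀ l : List α, ∏ j ∈ Finset.range m,
        (if j = i then g else fun _ => 1) (cell m l j) = g (cell m l i) := by
      intro l
      rw [← Finset.mul_prod_erase _ _ hi, if_pos rfl, Finset.prod_eq_one, mul_one]
      intro j hj
      rw [if_neg (Finset.ne_of_mem_erase hj)]
    have h4 : ∏ j ∈ Finset.range m, PowerSeries.mk (if j = i then φ else 1) =
        PowerSeries.mk φ * PowerSeries.mk 1 ^ (m - 1) := by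
      rw [← Finset.mul_prod_erase _ _ hi, if_pos rfl, Finset.prod_congr rfl
        (g := fun _ => PowerSeries.mk 1), Finset.prod_const, Finset.card_erase_of_mem hi,
        Finset.card_range]
      intro j hj
      rw [if_neg (Finset.ne_of_mem_erase hj)]
    simp only [h3] at h2
    rw [h2, h4]
  rw [Finset.sum_congr rfl h1, Finset.sum_const, Finset.card_range, nsmul_eq_mul, splitSum]
  ring

theorem arrAvg_pair_cell {m n : ℕ} (hm : 2 ≤ m) (hn : m - 1 ≤ n) {s : Finset α}
    (hs : s.card = n) (g g' : List α → ℝ) (φ φ' : ℕ → ℝ)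
    (h : ∀ C : Finset α, C.card < n → arrAvg C.card C g = φ C.card)
    (h' : ∀ C : Finset α, C.card < n → arrAvg C.card C g' = φ' C.card) :
    arrAvg n s (fun l => ∑ i ∈ Finset.range m, ∑ k ∈ (Finset.range m).erase i,
      g (cell m l i) * g' (cell m l k)) = splitPair m φ φ' n := by
  simp only [arrAvg_sum]
  have h1 : ∀ i ∈ Finset.range m, ∀ k ∈ (Finset.range m).erase i,
      arrAvg n s (fun l => g (cell m l i) * g' (cell m l k)) =
      PowerSeries.coeff n (PowerSeries.X ^ (m - 1) *
        (PowerSeries.mk φ * PowerSeries.mk φ' * PowerSeries.mk 1 ^ (m - 2))) /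
          n.choose (m - 1) := by
    intro i hi k hk
    have hki := Finset.ne_of_mem_erase hk
    have h2 := arrAvg_prod_cell hm hn hs
      (fun j => if j = i then g else if j = k then g' else fun _ => 1)
      (fun j => if j = i then φ else if j = k then φ' else 1) (by
        intro j C hC
        by_cases hj : j = i
        · simpa [hj] using h C hC
        · by_cases hj' : j = k
          · simpa [hj', hki] using h' C hC
          · simpa [hj, hj'] using arrAvg_const rfl 1)
    have h3 : ∀ l : List α, ∏ j ∈ Finset.range m,
        (if j = i then g else if j = k then g' else fun _ => 1) (cell m l j) =
          g (cell m l i) * g' (cell m l k) := by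
      intro l
      rw [← Finset.mul_prod_erase _ _ hi, if_pos rfl, ← Finset.mul_prod_erase _ _ hk,
        if_neg hki, if_pos rfl, Finset.prod_eq_one, mul_one]
      intro j hj
      rw [if_neg (Finset.ne_of_mem_erase (Finset.mem_of_mem_erase hj)),
        if_neg (Finset.ne_of_mem_erase hj)]
    have h4 : ∏ j ∈ Finset.range m, PowerSeries.mk (if j = i then φ else if j = k then φ' else 1) =
        PowerSeries.mk φ * PowerSeries.mk φ' * PowerSeries.mk 1 ^ (m - 2) := by
      rw [← Finset.mul_prod_erase _ _ hi, if_pos rfl, ← Finset.mul_prod_erase _ _ hk,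
        if_neg hki, if_pos rfl, Finset.prod_congr rfl
        (g := fun _ => PowerSeries.mk 1), Finset.prod_const, Finset.card_erase_of_mem hk,
        Finset.card_erase_of_mem hi, Finset.card_range, mul_assoc]
      · rfl
      intro j hj
      rw [if_neg (Finset.ne_of_mem_erase (Finset.mem_of_mem_erase hj)),
        if_neg (Finset.ne_of_mem_erase hj)]
    simp only [h3] at h2
    rw [h2, h4]
  rw [Finset.sum_congr rfl fun i hi => Finset.sum_congr rfl (h1 i hi)]
  have h5 : ∀ i ∈ Finset.range m, ((Finset.range m).erase i).card = m - 1 := by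
    intro i hi
    rw [Finset.card_erase_of_mem hi, Finset.card_range]
  simp only [Finset.sum_const]
  rw [Finset.sum_congr rfl fun i hi => by rw [h5 i hi], Finset.sum_const, Finset.card_range,
    nsmul_eq_mul, nsmul_eq_mul, Nat.cast_sub (by omega), splitPair]
  push_cast
  ring

theorem sum_length_cell {m : ℕ} (hm : 1 ≤ m) (l : List α) :
    ∑ i ∈ Finset.range m, (cell m l i).length = l.length - (m - 1) := by
  rw [← List.length_drop]
  have key : ∀ (r : List α) (c : α → ℕ), (∀ x, c x < m) →
      ∑ i ∈ Finset.range m, (r.filter (fun x => decide (c x = i))).length = r.length := by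
    intro r c hc
    induction r with
    | nil => simp
    | cons a r ih =>
      have : ∀ i, ((a :: r).filter (fun x => decide (c x = i))).length =
          (r.filter (fun x => decide (c x = i))).length + if c a = i then 1 else 0 := by
        intro i; by_cases h : c a = i <;> simp [h]
      simp only [this, Finset.sum_add_distrib, ih, List.length_cons]
      simp [hc a]
  refine key _ (fun x => ((l.take (m - 1)).filter (fun y => decide (y < x))).length) fun x => ?_
  refine (List.length_filter_le _ _).trans_lt ?_
  rw [List.length_take]
  omega

end Cells

/-- A functional of sequences of keys, defined for every type of keys. -/
abbrev KeyFunctional : Type 1 := ∀ (α : Type) [LinearOrder α], List α → ℝ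

/-- `x n` is the mean of `X` over the arrangements of any set of `n` keys. -/
def IsMean (X : KeyFunctional) (x : ℕ → ℝ) : Prop :=
  ∀ (α : Type) [LinearOrder α] (s : Finset α), arrAvg s.card s (X α) = x s.card

/-- `X` is the sum of its values at the `m` subtrees and of a toll that depends on the number of
keys, and is a function of the number of keys for small sequences. -/
def IsSplitAdditive (m : ℕ) (X : KeyFunctional) (i c : ℕ → ℝ) : Prop :=
  (∀ (α : Type) [LinearOrder α] (l : List α), l.length < m - 1 → X α l = i l.length) ∧
  ∀ (α : Type) [LinearOrder α] (l : List α), m - 1 ≤ l.length →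
    X α l = ∑ j ∈ Finset.range m, X α (cell m l j) + c l.length

theorem length_of_toFinset {α : Type} [DecidableEq α] {l : List α} {s : Finset α} (hl : l.Nodup)
    (h : l.toFinset = s) : l.length = s.card := by
  rw [← h, List.toFinset_card_of_nodup hl]

/-- Strong induction shows that the mean depends only on the number of keys, not on the type or the
set. As the mean sequence does not exist yet, `h1` is stated for any `x` that is correct on smaller
sets; in the induction `x` is filled with 0 beyond the range where it matters. -/
theorem exists_isMean {X : KeyFunctional} (v : ℕ → ℝ) (r : ∀ _n : ℕ, (ℕ → ℝ) → ℝ) (N : ℕ)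
    (h0 : ∀ (α : Type) [LinearOrder α] (s : Finset α), s.card < N →
      arrAvg s.card s (X α) = v s.card)
    (h1 : ∀ (x : ℕ → ℝ) (α : Type) [LinearOrder α] (s : Finset α), N ≤ s.card →
      (∀ C : Finset α, C.card < s.card → arrAvg C.card C (X α) = x C.card) →
      arrAvg s.card s (X α) = r s.card x) :
    ∃ x, IsMean X x ∧ (∀ n < N, x n = v n) ∧ ∀ n, N ≤ n → x n = r n x := by
  have key : ∀ n, ∃ y : ℝ, ∀ (α : Type) [LinearOrder α] (s : Finset α), s.card = n →
      arrAvg s.card s (X α) = y := by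
    intro n
    induction n using Nat.strong_induction_on with
    | _ n ih =>
      by_cases hn : n < N
      · exact ⟨v n, fun α _ s hs => by rw [← hs]; exact h0 α s (hs ▸ hn)⟩
      · have : ∀ k, ∃ y : ℝ, k < n → ∀ (α : Type) [LinearOrder α] (s : Finset α), s.card = k →
            arrAvg s.card s (X α) = y := by
          intro k
          by_cases hk : k < n
          · obtain ⟨y, hy⟩ := ih k hk
            exact ⟨y, fun _ => hy⟩
          · exact ⟨0, fun h => absurd h hk⟩
        choose x hx using this
        refine ⟨r n x, fun α _ s hs => ?_⟩
        subst hs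
        exact h1 x α s (not_lt.1 hn) fun C hC => hx _ hC α C rfl
  choose x hx using key
  have hmean : IsMean X x := fun α _ s => hx _ α s rfl
  refine ⟨x, hmean, fun n hn => ?_, fun n hn => ?_⟩
  · have := h0 ℕ (Finset.range n) (by simpa using hn)
    rw [hmean] at this
    simpa using this
  · have := h1 x ℕ (Finset.range n) (by simpa using hn) (fun C _ => hmean _ C)
    rw [hmean] at this
    simpa using this

theorem IsSplitAdditive.exists_mean {m : ℕ} (hm : 2 ≤ m) {X : KeyFunctional} {i c : ℕ → ℝ}
    (hX : IsSplitAdditive m X i c) :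
    ∃ x, IsMean X x ∧ (∀ n < m - 1, x n = i n) ∧ ∀ n, m - 1 ≤ n → x n = splitSum m x n + c n := by
  refine exists_isMean i (fun n x => splitSum m x n + c n) (m - 1) ?_ ?_
  · intro α _ s hs
    rw [arrAvg_congr rfl (g := fun _ => i s.card), arrAvg_const rfl]
    intro l hl hls
    rw [hX.1 α l (by rwa [length_of_toFinset hl hls]), length_of_toFinset hl hls]
  · intro x α _ s hs hC
    rw [arrAvg_congr rfl
      (g := fun l => ∑ j ∈ Finset.range m, X α (cell m l j) + c s.card), arrAvg_add,
      arrAvg_const rfl, arrAvg_sum_cell hm hs rfl _ x hC]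
    intro l hl hls
    rw [← length_of_toFinset hl hls] at hs ⊢
    exact hX.2 α l hs

/-- In the expansion of (∑X + c)(∑Y + d) the diagonal terms give the recursive part, and the
off-diagonal ones involve different, hence independent, subtrees and only see the means `x` and `y`.
-/
theorem IsSplitAdditive.exists_mean_mul {m : ℕ} (hm : 2 ≤ m) {X Y : KeyFunctional}
    {i c j d : ℕ → ℝ} (hX : IsSplitAdditive m X i c) (hY : IsSplitAdditive m Y j d)
    {x y : ℕ → ℝ} (hx : IsMean X x) (hy : IsMean Y y) :
    ∃ z, IsMean (fun α _ l => X α l * Y α l) z ∧ (∀ n < m - 1, z n = i n * j n) ∧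
      ∀ n, m - 1 ≤ n → z n = splitSum m z n +
        (splitPair m x y n + d n * splitSum m x n + c n * splitSum m y n + c n * d n) := by
  refine exists_isMean (fun n => i n * j n) (fun n z => splitSum m z n +
        (splitPair m x y n + d n * splitSum m x n + c n * splitSum m y n + c n * d n))
        (m - 1) ?_ ?_
  · intro α _ s hs
    rw [arrAvg_congr rfl (g := fun _ => i s.card * j s.card), arrAvg_const rfl]
    intro l hl hls
    rw [hX.1 α l (by rwa [length_of_toFinset hl hls]), hY.1 α l (by rwa [length_of_toFinset hl hls]),
      length_of_toFinset hl hls]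
  · intro z α _ s hs hC
    rw [arrAvg_congr rfl (g := fun l =>
      ∑ k ∈ Finset.range m, X α (cell m l k) * Y α (cell m l k) +
      (∑ k ∈ Finset.range m, ∑ p ∈ (Finset.range m).erase k, X α (cell m l k) * Y α (cell m l p) +
      (d s.card * ∑ k ∈ Finset.range m, X α (cell m l k) +
       (c s.card * ∑ k ∈ Finset.range m, Y α (cell m l k) + c s.card * d s.card))))]
    · rw [arrAvg_add, arrAvg_add, arrAvg_add, arrAvg_add, arrAvg_const_mul, arrAvg_const_mul,
        arrAvg_const rfl,
        arrAvg_sum_cell hm hs rfl (fun l => X α l * Y α l) z hC,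
        arrAvg_pair_cell hm hs rfl (X α) (Y α) x y (fun C _ => hx α C) (fun C _ => hy α C),
        arrAvg_sum_cell hm hs rfl (X α) x (fun C _ => hx α C),
        arrAvg_sum_cell hm hs rfl (Y α) y (fun C _ => hy α C)]
      ring
    · intro l hl hls
      have hlen := length_of_toFinset hl hls
      have hs' : m - 1 ≤ l.length := by omega
      rw [hX.2 α l hs', hY.2 α l hs', hlen]
      have : (∑ k ∈ Finset.range m, X α (cell m l k)) * ∑ k ∈ Finset.range m, Y α (cell m l k) =
          ∑ k ∈ Finset.range m, X α (cell m l k) * Y α (cell m l k) +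
          ∑ k ∈ Finset.range m, ∑ p ∈ (Finset.range m).erase k,
            X α (cell m l k) * Y α (cell m l p) := by
        rw [← Finset.sum_add_distrib, Finset.sum_mul]
        refine Finset.sum_congr rfl fun k hk => ?_
        rw [← Finset.mul_sum, ← mul_add, Finset.add_sum_erase _ (fun p => Y α (cell m l p)) hk]
      linear_combination this

end

/-! ### From uniform permutations and search trees to arrangements -/

noncomputable section

theorem sum_injective_ofFn {α : Type} [Fintype α] [DecidableEq α] (n : ℕ) (s : Finset α)
    (hs : s.card = n) (f : List α → ℝ) :
    ∑ g : Fin n → α with Function.Injective g ∧ ∀ i, g i ∈ s, f (List.ofFn g) =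
      n.factorial * arrAvg n s f := by
  induction n generalizing s f with
  | zero =>
    rw [Finset.sum_filter, Fintype.sum_eq_single (fun i => i.elim0)
      (fun g hg => absurd (Subsingleton.elim _ _) hg)]
    simp [arrAvg, Function.injective_of_subsingleton]
  | succ n ih =>
    rw [Finset.sum_filter, ← (Fin.consEquiv fun _ => α).sum_comp, Fintype.sum_prod_type]
    have h1 : ∀ a : α, ∑ g : Fin n → α,
        (if Function.Injective (Fin.consEquiv (fun _ => α) (a, g)) ∧
            ∀ i, Fin.consEquiv (fun _ => α) (a, g) i ∈ s then
          f (List.ofFn (Fin.consEquiv (fun _ => α) (a, g))) else 0) =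
        if a ∈ s then (n.factorial : ℝ) * arrAvg n (s.erase a) (fun l => f (a :: l)) else 0 := by
      intro a
      by_cases ha : a ∈ s
      · rw [if_pos ha, ← ih (s.erase a) (by rw [Finset.card_erase_of_mem ha, hs]; rfl),
          Finset.sum_filter]
        refine Finset.sum_congr rfl fun g _ => ?_
        have e : Fin.consEquiv (fun _ => α) (a, g) = Fin.cons a g := rfl
        rw [e, List.ofFn_succ]
        simp only [Fin.cons_zero, Fin.cons_succ]
        refine if_congr ?_ rfl rfl
        simp only [Fin.cons_injective_iff, Fin.forall_fin_succ, Finset.mem_erase, Fin.cons_zero,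
          Fin.cons_succ]
        constructor
        · rintro ⟨⟨h1, h2⟩, _, h3⟩
          exact ⟨h2, fun i => ⟨fun h => h1 ⟨i, h⟩, h3 i⟩⟩
        · rintro ⟨h1, h2⟩
          exact ⟨⟨fun ⟨i, hi⟩ => (h2 i).1 hi, h1⟩, ha, fun i => (h2 i).2⟩
      · rw [if_neg ha]
        refine Finset.sum_eq_zero fun g _ => if_neg fun h => ha (h.2 0)
    rw [Finset.sum_congr rfl fun a _ => h1 a, ← Finset.sum_filter]
    simp only [Finset.filter_mem_eq_inter, Finset.univ_inter, ← Finset.mul_sum, arrAvg]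
    have : ((n : ℝ) + 1) ≠ 0 := by positivity
    rw [Nat.factorial_succ]
    push_cast
    field_simp

theorem sum_perm_ofFn (n : ℕ) (f : List (Fin n) → ℝ) :
    ∑ σ : Equiv.Perm (Fin n), f (List.ofFn σ) = n.factorial * arrAvg n Finset.univ f := by
  rw [← sum_injective_ofFn n Finset.univ (by simp) f]
  refine Finset.sum_bij (fun σ _ => ⇑σ) ?_ ?_ ?_ ?_
  · intro σ _; simpa using σ.injective
  · intro σ _ τ _ h; exact DFunLike.coe_injective h
  · intro g hg
    simp only [Finset.mem_filter, Finset.mem_univ, true_and, implies_true, and_true] at hg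
    exact ⟨Equiv.ofBijective g (Finite.injective_iff_bijective.1 hg), Finset.mem_univ _, rfl⟩
  · intro σ _; rfl

theorem integral_perm (n : ℕ) (f : List (Fin n) → ℝ) :
    ∫ σ, f (List.ofFn σ) ∂permMeasure n = arrAvg n Finset.univ f := by
  rw [PMF.integral_eq_sum]
  simp only [PMF.uniformOfFintype_apply, smul_eq_mul]
  rw [← Finset.mul_sum, sum_perm_ofFn, Fintype.card_perm, Fintype.card_fin]
  have : (n.factorial : ℝ) ≠ 0 := by positivity
  simp [this]

/-- For fixed `n` the corrections in `centredSpace` and `shiftedPath` are constants; `a` and `b`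
undo them without changing the covariance. -/
theorem covariance_perm (n : ℕ) (F G : List (Fin n) → ℝ) (a b : ℝ) :
    cov[fun σ : Equiv.Perm (Fin n) => F (List.ofFn σ) + a, fun σ => G (List.ofFn σ) + b;
        permMeasure n] =
      arrAvg n Finset.univ (fun l => F l * G l) -
        arrAvg n Finset.univ F * arrAvg n Finset.univ G := by
  rw [covariance_eq_sub MeasureTheory.MemLp.of_discrete MeasureTheory.MemLp.of_discrete]
  have h1 := integral_perm n (fun l => (F l + a) * (G l + b))
  have h2 := integral_perm n (fun l => F l + a)
  have h3 := integral_perm n (fun l => G l + b)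
  have hc : (Finset.univ : Finset (Fin n)).card = n := by simp
  simp only [Pi.mul_apply]
  rw [h1, h2, h3]
  have h4 : (fun l => (F l + a) * (G l + b)) =
      fun l : List (Fin n) => F l * G l + (b * F l + (a * G l + a * b)) := by
    funext l; ring
  rw [h4, arrAvg_add, arrAvg_add, arrAvg_add, arrAvg_add, arrAvg_add, arrAvg_const_mul,
    arrAvg_const_mul, arrAvg_const hc, arrAvg_const hc, arrAvg_const hc]
  ring

namespace MTree

variable {m : ℕ} {α : Type}

/-- The number of keys stored in the tree. -/
def numKeys : MTree m α → ℕ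
  | empty => 0
  | node ks ch => ks.length + ∑ i, (ch i).numKeys

theorem pathLengthFrom_succ (t : MTree m α) (d : ℕ) :
    t.pathLengthFrom (d + 1) = t.pathLengthFrom d + t.numKeys := by
  induction t generalizing d with
  | empty => rfl
  | node ks ch ih =>
    simp only [pathLengthFrom, numKeys, ih, Finset.sum_add_distrib]
    ring

variable [LinearOrder α]

theorem build_nil : build m ([] : List α) = empty := by
  rw [build, if_pos rfl]

theorem build_of_length_lt {l : List α} (hl : l ≠ []) (h : l.length < m) :
    build m l = node (l.mergeSort (fun a b => decide (a ≤ b))) (fun _ => empty) := by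
  rw [build, if_neg hl, dif_neg (by omega)]

theorem build_of_le_length {l : List α} (hm : 2 ≤ m) (h : m ≤ l.length) :
    build m l = node ((l.take (m - 1)).mergeSort (fun a b => decide (a ≤ b)))
      (fun i => build m (cell m l i)) := by
  rw [build, if_neg (by rintro rfl; simp at h; omega), dif_pos ⟨hm, h⟩]
  rfl

theorem cell_eq_nil {l : List α} (h : l.length = m - 1) (i : ℕ) : cell m l i = [] := by
  rw [cell, ← h, List.drop_length, List.filter_nil]

theorem length_cell_lt {l : List α} (hm : 2 ≤ m) (h : m ≤ l.length) (i : ℕ) :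
    (cell m l i).length < l.length := by
  refine lt_of_le_of_lt (List.length_filter_le _ _) ?_
  rw [List.length_drop]
  omega

theorem numKeys_build (hm : 2 ≤ m) (l : List α) : (build m l).numKeys = l.length := by
  induction hn : l.length using Nat.strong_induction_on generalizing l with
  | _ n ih =>
    by_cases h0 : l = []
    · subst h0; rw [build_nil]; simpa [numKeys] using hn
    by_cases h : m ≤ l.length
    · rw [build_of_le_length hm h, numKeys, List.length_mergeSort, List.length_take,
        Finset.sum_congr rfl fun i _ => ih _ (hn ▸ length_cell_lt hm h i) _ rfl,
        Finset.sum_range (fun i => (cell m l i).length) |>.symm, sum_length_cell (by omega)]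
      omega
    · rw [build_of_length_lt h0 (not_le.1 h)]
      simp [numKeys, hn]

/-- The recursion is valid from `m - 1` keys on, one earlier than in `build`: with exactly `m - 1`
keys the root is full and all cells are empty. This matches the threshold of `splitSum`. -/
theorem nodes_build (hm : 2 ≤ m) {l : List α} (h : m - 1 ≤ l.length) :
    (build m l).nodes = 1 + ∑ i ∈ Finset.range m, (build m (cell m l i)).nodes := by
  by_cases h' : m ≤ l.length
  · rw [build_of_le_length hm h', nodes, Finset.sum_range]
  · rw [build_of_length_lt (by rintro rfl; simp at h; omega) (not_le.1 h')]
    simp [nodes, cell_eq_nil (show l.length = m - 1 by omega), build_nil]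

theorem keyPathLength_build (hm : 2 ≤ m) {l : List α} (h : m - 1 ≤ l.length) :
    (build m l).keyPathLength = (l.length - (m - 1)) +
      ∑ i ∈ Finset.range m, (build m (cell m l i)).keyPathLength := by
  by_cases h' : m ≤ l.length
  · rw [build_of_le_length hm h', keyPathLength, pathLengthFrom, ← sum_length_cell (by omega) l,
      ← Finset.sum_add_distrib, Finset.sum_range, mul_zero, zero_add]
    refine Finset.sum_congr rfl fun i _ => ?_
    rw [pathLengthFrom_succ, numKeys_build hm, keyPathLength, add_comm]
  · rw [build_of_length_lt (by rintro rfl; simp at h; omega) (not_le.1 h')]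
    simp [keyPathLength, pathLengthFrom, cell_eq_nil (show l.length = m - 1 by omega), build_nil]
    omega

end MTree

/-- The space requirement, centred by an affine function of the number of keys so that it becomes
additive. -/
def centredSpace (m : ℕ) : KeyFunctional := fun _ _ l =>
  ((MTree.build m l).nodes : ℝ) + (1 / ((m : ℝ) - 1) - occ m * (l.length + 1))

/-- The key path length, shifted by an affine function of the number of keys. -/
def shiftedPath (m : ℕ) (d : ℝ) : KeyFunctional := fun _ _ l =>
  ((MTree.build m l).keyPathLength : ℝ) + (-((m : ℝ) / ((m : ℝ) - 1)) - d * (l.length + 1))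

theorem sum_length_cell_add_one {α : Type} [LinearOrder α] {m : ℕ} (hm : 2 ≤ m) {l : List α}
    (h : m - 1 ≤ l.length) :
    ∑ i ∈ Finset.range m, (((cell m l i).length : ℝ) + 1) = l.length + 1 := by
  rw [Finset.sum_add_distrib, ← Nat.cast_sum, sum_length_cell (by omega)]
  rw [Nat.cast_sub h, Nat.cast_sub (by omega)]
  simp
  ring

/-- The `m` subtrees carry the constant 1/(m-1) in total m/(m-1) = 1 + 1/(m-1), which absorbs the
toll 1 of the root; number of keys plus one is additive over the subtrees. The toll is therefore 0.
-/
theorem isSplitAdditive_centredSpace {m : ℕ} (hm : 2 ≤ m) :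
    IsSplitAdditive m (centredSpace m)
      (fun n => (if n = 0 then 0 else 1) + (1 / ((m : ℝ) - 1) - occ m * (n + 1))) 0 := by
  constructor
  · intro α _ l hl
    rw [centredSpace]
    congr 1
    by_cases h0 : l = []
    · subst h0; simp [MTree.build_nil, MTree.nodes]
    · rw [MTree.build_of_length_lt h0 (by omega)]
      simp [MTree.nodes, h0]
  · intro α _ l hl
    simp only [centredSpace]
    rw [MTree.nodes_build hm hl, Finset.sum_add_distrib, Finset.sum_sub_distrib, ← Finset.mul_sum,
      sum_length_cell_add_one hm hl]
    have : (m : ℝ) - 1 ≠ 0 := by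
      have : (2 : ℝ) ≤ m := by exact_mod_cast hm
      linarith
    simp
    field_simp
    ring

/-- The constant -m/(m-1) turns the toll n - (m-1) into n + 1, a fixed point of the splitting
operator. The parameter `d` is free and later removes the component at the zero 2. -/
theorem isSplitAdditive_shiftedPath {m : ℕ} (hm : 2 ≤ m) (d : ℝ) :
    IsSplitAdditive m (shiftedPath m d)
      (fun n => -((m : ℝ) / ((m : ℝ) - 1)) - d * (n + 1)) (fun n => n + 1) := by
  constructor
  · intro α _ l hl
    rw [shiftedPath]
    by_cases h0 : l = []
    · subst h0; simp [MTree.build_nil, MTree.keyPathLength, MTree.pathLengthFrom]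
    · rw [MTree.build_of_length_lt h0 (by omega)]
      simp [MTree.keyPathLength, MTree.pathLengthFrom]
  · intro α _ l hl
    simp only [shiftedPath]
    rw [MTree.keyPathLength_build hm hl, Finset.sum_add_distrib, Finset.sum_sub_distrib,
      ← Finset.mul_sum, sum_length_cell_add_one hm hl]
    have : (m : ℝ) - 1 ≠ 0 := by
      have : (2 : ℝ) ≤ m := by exact_mod_cast hm
      linarith
    push_cast [Nat.cast_sub hl, Nat.cast_sub (show 1 ≤ m by omega)]
    simp
    field_simp
    ring

theorem IsMean.univ {X : KeyFunctional} {x : ℕ → ℝ} (h : IsMean X x) (n : ℕ) :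
    arrAvg n Finset.univ (X (Fin n)) = x n := by
  have := h (Fin n) Finset.univ
  rw [Finset.card_univ, Fintype.card_fin] at this
  convert this

theorem covariance_spaceReq_keyPath {m : ℕ} {d : ℝ} {u k c : ℕ → ℝ} (hu : IsMean (centredSpace m) u)
    (hk : IsMean (shiftedPath m d) k)
    (hc : IsMean (fun α _ l => centredSpace m α l * shiftedPath m d α l) c) (n : ℕ) :
    cov[spaceReq m n, keyPath m n; permMeasure n] = c n - u n * k n := by
  rw [← hu.univ, ← hk.univ, ← hc.univ, ← covariance_perm n _ _
    (-(1 / ((m : ℝ) - 1) - occ m * (n + 1))) (-(-((m : ℝ) / ((m : ℝ) - 1)) - d * (n + 1)))]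
  congr 1 <;> funext σ
  · simp [spaceReq, centredSpace, searchTree]; ring
  · simp [keyPath, shiftedPath, searchTree]; ring

theorem variance_spaceReq {m : ℕ} {u q : ℕ → ℝ} (hu : IsMean (centredSpace m) u)
    (hq : IsMean (fun α _ l => centredSpace m α l * centredSpace m α l) q) (n : ℕ) :
    Var[spaceReq m n; permMeasure n] = q n - u n * u n := by
  rw [← covariance_self Measurable.of_discrete.aemeasurable, ← hu.univ, ← hq.univ,
    ← covariance_perm n _ _
    (-(1 / ((m : ℝ) - 1) - occ m * (n + 1))) (-(1 / ((m : ℝ) - 1) - occ m * (n + 1)))]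
  congr 1 <;> funext σ <;> (simp [spaceReq, centredSpace, searchTree]; ring)

theorem variance_keyPath {m : ℕ} {d : ℝ} {k q : ℕ → ℝ} (hk : IsMean (shiftedPath m d) k)
    (hq : IsMean (fun α _ l => shiftedPath m d α l * shiftedPath m d α l) q) (n : ℕ) :
    Var[keyPath m n; permMeasure n] = q n - k n * k n := by
  rw [← covariance_self Measurable.of_discrete.aemeasurable, ← hk.univ, ← hq.univ,
    ← covariance_perm n _ _ (-(-((m : ℝ) / ((m : ℝ) - 1)) - d * (n + 1)))
      (-(-((m : ℝ) / ((m : ℝ) - 1)) - d * (n + 1)))]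
  congr 1 <;> funext σ <;> (simp [keyPath, shiftedPath, searchTree]; ring)

end

/-! ### Binomial series as eigenvectors of the splitting operator -/

noncomputable section

/-- The coefficient of `z ^ n` in `(1 - z) ^ (-μ)`. -/
def negBinom {𝕜 : Type*} [Field 𝕜] (μ : 𝕜) (n : ℕ) : 𝕜 :=
  (∏ k ∈ Finset.range n, (μ + k)) / (n.factorial : 𝕜)

/-- The rising product `μ (μ + 1) ⋯ (μ + m - 2)`. -/
def risingProd {𝕜 : Type*} [Field 𝕜] (m : ℕ) (μ : 𝕜) : 𝕜 := ∏ j ∈ Finset.range (m - 1), (μ + j)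

section Algebra

variable {𝕜 : Type*} [Field 𝕜]

@[simp] theorem negBinom_zero (μ : 𝕜) : negBinom μ 0 = 1 := by simp [negBinom]

variable [CharZero 𝕜]

theorem negBinom_succ (μ : 𝕜) (n : ℕ) :
    ((n : 𝕜) + 1) * negBinom μ (n + 1) = (μ + n) * negBinom μ n := by
  have h1 : ((n : 𝕜) + 1) ≠ 0 := by exact_mod_cast Nat.succ_ne_zero n
  have h2 : (n.factorial : 𝕜) ≠ 0 := by exact_mod_cast n.factorial_ne_zero
  rw [negBinom, negBinom, Finset.prod_range_succ, Nat.factorial_succ]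
  push_cast
  field_simp

theorem negBinom_unique {μ : 𝕜} {c : ℕ → 𝕜} (h0 : c 0 = 1)
    (h : ∀ n : ℕ, ((n : 𝕜) + 1) * c (n + 1) = (μ + n) * c n) : c = negBinom μ := by
  funext n
  induction n with
  | zero => simp [h0]
  | succ n ih =>
    have h1 : ((n : 𝕜) + 1) ≠ 0 := by exact_mod_cast Nat.succ_ne_zero n
    exact mul_left_cancel₀ h1 (by rw [h, ih, negBinom_succ])

theorem negBinom_one (n : ℕ) : negBinom (1 : 𝕜) n = 1 := by
  have := negBinom_unique (μ := (1 : 𝕜)) (c := 1) rfl fun n => by simp [add_comm]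
  rw [← this]; rfl

theorem negBinom_two (n : ℕ) : negBinom (2 : 𝕜) n = n + 1 := by
  have := negBinom_unique (μ := (2 : 𝕜)) (c := fun n => (n : 𝕜) + 1) (by simp)
    fun n => by push_cast; ring
  rw [← this]

theorem negBinom_three (n : ℕ) : negBinom (3 : 𝕜) n = (n + 1) * (n + 2) / 2 := by
  have := negBinom_unique (μ := (3 : 𝕜)) (c := fun n => ((n : 𝕜) + 1) * (n + 2) / 2) (by simp)
    fun n => by push_cast; ring
  rw [← this]

theorem negBinom_add_one (μ : 𝕜) (n : ℕ) :
    μ * negBinom (μ + 1) n = (μ + n) * negBinom μ n := by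
  have h2 : (n.factorial : 𝕜) ≠ 0 := by exact_mod_cast n.factorial_ne_zero
  have h : (∏ k ∈ Finset.range n, (μ + 1 + k)) * μ = (∏ k ∈ Finset.range n, (μ + k)) * (μ + n) := by
    rw [← Finset.prod_range_succ, Finset.prod_range_succ']
    congr 1
    · exact Finset.prod_congr rfl fun k _ => by push_cast; ring
    · simp
  rw [negBinom, negBinom]
  field_simp
  linear_combination h

/-- This is (1-z)^(-μ) (1-z)^(-ν) = (1-z)^(-μ-ν). Each series solves (1-X) F' = μ F, the product
solves the equation with μ + ν, and that equation determines the coefficients. -/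
theorem mk_negBinom_mul (μ ν : 𝕜) :
    PowerSeries.mk (negBinom μ) * PowerSeries.mk (negBinom ν) =
      PowerSeries.mk (negBinom (μ + ν)) := by
  have ode : ∀ μ : 𝕜, (1 - PowerSeries.X) * PowerSeries.derivative 𝕜 (PowerSeries.mk (negBinom μ)) =
      PowerSeries.C μ * PowerSeries.mk (negBinom μ) := by
    intro μ
    ext n
    rw [sub_mul, one_mul, map_sub, PowerSeries.coeff_derivative, PowerSeries.coeff_C_mul,
      PowerSeries.coeff_mk, PowerSeries.coeff_mk]
    have := negBinom_succ μ n
    rcases n with _ | n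
    · simp at this ⊢
      linear_combination this
    · rw [PowerSeries.coeff_succ_X_mul, PowerSeries.coeff_derivative, PowerSeries.coeff_mk]
      push_cast at this ⊢
      linear_combination this
  set F := PowerSeries.mk (negBinom μ)
  set G := PowerSeries.mk (negBinom ν)
  have h1 : (1 - PowerSeries.X) * PowerSeries.derivative 𝕜 (F * G) = PowerSeries.C (μ + ν) * (F * G) := by
    rw [Derivation.leibniz, smul_eq_mul, smul_eq_mul, map_add]
    linear_combination G * ode μ + F * ode ν
  have h2 : (fun n => PowerSeries.coeff n (F * G)) = negBinom (μ + ν) := by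
    refine negBinom_unique ?_ fun n => ?_
    · simp [F, G, PowerSeries.coeff_zero_eq_constantCoeff]
    · have := congrArg (PowerSeries.coeff n) h1
      rw [sub_mul, one_mul, map_sub, PowerSeries.coeff_derivative, PowerSeries.coeff_C_mul] at this
      rcases n with _ | n
      · simp at this ⊢
        linear_combination this
      · rw [PowerSeries.coeff_succ_X_mul, PowerSeries.coeff_derivative] at this
        push_cast at this ⊢
        linear_combination this
  ext n
  rw [← h2, PowerSeries.coeff_mk]

theorem mk_one_pow (k : ℕ) :
    (PowerSeries.mk 1 : PowerSeries 𝕜) ^ k = PowerSeries.mk (negBinom (k : 𝕜)) := by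
  induction k with
  | zero =>
    ext n
    rw [PowerSeries.coeff_mk, pow_zero, PowerSeries.coeff_one]
    rcases n with _ | n
    · simp
    · simp [negBinom, Finset.prod_range_succ']
  | succ k ih =>
    have : (PowerSeries.mk 1 : PowerSeries 𝕜) = PowerSeries.mk (negBinom 1) := by
      congr 1; funext n; rw [negBinom_one]; rfl
    rw [pow_succ, ih, this, mk_negBinom_mul]
    push_cast; rfl

theorem splitSum_eq {m n : ℕ} (hn : m - 1 ≤ n) (a : ℕ → 𝕜) :
    splitSum m a n = (m : 𝕜) / (n.choose (m - 1) : 𝕜) *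
      ∑ p ∈ Finset.HasAntidiagonal.antidiagonal (n - (m - 1)), a p.1 * negBinom ((m - 1 : ℕ) : 𝕜) p.2 := by
  rw [splitSum, PowerSeries.coeff_X_pow_mul', if_pos hn, mk_one_pow, PowerSeries.coeff_mul]
  simp

theorem splitPair_eq {m n : ℕ} (hn : m - 1 ≤ n) (a b : ℕ → 𝕜) :
    splitPair m a b n = (m : 𝕜) * ((m : 𝕜) - 1) / (n.choose (m - 1) : 𝕜) *
      ∑ p ∈ Finset.HasAntidiagonal.antidiagonal (n - (m - 1)),
        (∑ q ∈ Finset.HasAntidiagonal.antidiagonal p.1, a q.1 * b q.2) * negBinom ((m - 2 : ℕ) : 𝕜) p.2 := by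
  rw [splitPair, PowerSeries.coeff_X_pow_mul', if_pos hn, mk_one_pow, PowerSeries.coeff_mul]
  simp [PowerSeries.coeff_mul]

/-- Moving one factor 1/(1-z) out of the product writes the pair toll as (m-1) T c. Tolls in the
range of T are the ones solved in closed form, since T c is known when c is an eigenvector. -/
theorem splitPair_eq_splitSum {m n : ℕ} (hm : 2 ≤ m) {a b c : ℕ → 𝕜}
    (h : PowerSeries.mk a * PowerSeries.mk b = PowerSeries.mk c * PowerSeries.mk 1) :
    splitPair m a b n = ((m : 𝕜) - 1) * splitSum m c n := by
  rw [splitPair, splitSum, h, mul_assoc (PowerSeries.mk c), ← pow_succ',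
    show m - 2 + 1 = m - 1 by omega]
  ring

theorem splitPair_negBinom {m : ℕ} (hm : 2 ≤ m) (μ ν : 𝕜) (n : ℕ) :
    splitPair m (negBinom μ) (negBinom ν) n =
      ((m : 𝕜) - 1) * splitSum m (negBinom (μ + ν - 1)) n := by
  refine splitPair_eq_splitSum hm ?_
  have := mk_one_pow (𝕜 := 𝕜) 1
  rw [pow_one] at this
  rw [this, mk_negBinom_mul, mk_negBinom_mul]
  push_cast
  rw [sub_add_cancel]

/-- The factor (1-z)^(-(m-1)) raises the parameter by m - 1; the index shift and the binomial
coefficient then restore the original sequence up to a scalar. The form without division holds for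
every μ and can be differentiated in μ. -/
theorem risingProd_mul_splitSum_negBinom {m n : ℕ} (hm : 1 ≤ m) (hn : m - 1 ≤ n) (μ : 𝕜) :
    risingProd m μ * splitSum m (negBinom μ) n = m.factorial * negBinom μ n := by
  rw [splitSum, PowerSeries.coeff_X_pow_mul', if_pos hn, mk_one_pow, mk_negBinom_mul,
    PowerSeries.coeff_mk, negBinom, negBinom, risingProd]
  obtain ⟨N, rfl⟩ : ∃ N, n = (m - 1) + N := ⟨n - (m - 1), by omega⟩
  rw [Nat.add_sub_cancel_left, Finset.prod_range_add]
  have h1 : ∀ x ∈ Finset.range N, μ + ((m - 1 : ℕ) : 𝕜) + (x : 𝕜) = μ + ((m - 1 + x : ℕ) : 𝕜) := by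
    intro x _; push_cast; ring
  rw [Finset.prod_congr rfl h1]
  have h2 : ((m - 1 + N).choose (m - 1) : 𝕜) * ((m - 1).factorial * N.factorial) =
      (m - 1 + N).factorial := by
    rw [← mul_assoc]
    exact_mod_cast Nat.choose_symm_add (a := m - 1) (b := N) ▸
      Nat.add_choose_mul_factorial_mul_factorial (m - 1) N
  have h3 : (m.factorial : 𝕜) = m * (m - 1).factorial := by
    exact_mod_cast (Nat.mul_factorial_pred (by omega)).symm
  have h4 : ((m - 1 + N).choose (m - 1) : 𝕜) ≠ 0 := by
    exact_mod_cast (Nat.choose_pos (by omega)).ne'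
  have h5 : (N.factorial : 𝕜) ≠ 0 := by exact_mod_cast N.factorial_ne_zero
  have h6 : ((m - 1 + N).factorial : 𝕜) ≠ 0 := by exact_mod_cast (m - 1 + N).factorial_ne_zero
  rw [h3]
  field_simp
  linear_combination (-(m : 𝕜) * (∏ j ∈ Finset.range (m - 1), (μ + (j : 𝕜))) *
    ∏ x ∈ Finset.range N, (μ + ((m - 1 + x : ℕ) : 𝕜))) * h2

theorem splitSum_negBinom {m n : ℕ} (hm : 1 ≤ m) (hn : m - 1 ≤ n) {μ : 𝕜}
    (h : risingProd m μ ≠ 0) :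
    splitSum m (negBinom μ) n = m.factorial / risingProd m μ * negBinom μ n := by
  have := risingProd_mul_splitSum_negBinom hm hn μ
  field_simp
  linear_combination this

end Algebra

section Linear

variable {𝕜 : Type*} [Field 𝕜]

theorem mk_add (a b : ℕ → 𝕜) :
    PowerSeries.mk (a + b) = PowerSeries.mk a + PowerSeries.mk b := by ext; simp

theorem mk_smul (c : 𝕜) (a : ℕ → 𝕜) :
    PowerSeries.mk (c • a) = PowerSeries.C c * PowerSeries.mk a := by ext; simp

theorem splitSum_add (m : ℕ) (a b : ℕ → 𝕜) : splitSum m (a + b) = splitSum m a + splitSum m b := by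
  funext n
  simp only [splitSum, mk_add, Pi.add_apply, add_mul, mul_add, map_add]

theorem splitSum_smul (m : ℕ) (c : 𝕜) (a : ℕ → 𝕜) : splitSum m (c • a) = c • splitSum m a := by
  funext n
  simp only [splitSum, mk_smul, Pi.smul_apply, smul_eq_mul]
  rw [show (PowerSeries.X : PowerSeries 𝕜) ^ (m - 1) * (PowerSeries.C c * PowerSeries.mk a *
    PowerSeries.mk 1 ^ (m - 1)) = PowerSeries.C c * (PowerSeries.X ^ (m - 1) * (PowerSeries.mk a *
    PowerSeries.mk 1 ^ (m - 1))) by ring, PowerSeries.coeff_C_mul]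
  ring

theorem splitSum_sub (m : ℕ) (a b : ℕ → 𝕜) : splitSum m (a - b) = splitSum m a - splitSum m b := by
  have := splitSum_smul m (-1) b
  rw [neg_one_smul, neg_one_smul] at this
  rw [sub_eq_add_neg, splitSum_add, this, sub_eq_add_neg]

theorem splitPair_comm (m : ℕ) (a b : ℕ → 𝕜) : splitPair m a b = splitPair m b a := by
  funext n
  simp only [splitPair]
  rw [mul_comm (PowerSeries.mk a)]

theorem splitPair_add_left (m : ℕ) (a b c : ℕ → 𝕜) :
    splitPair m (a + b) c = splitPair m a c + splitPair m b c := by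
  funext n
  simp only [splitPair, mk_add, Pi.add_apply, add_mul, mul_add, map_add]

theorem splitPair_smul_left (m : ℕ) (c : 𝕜) (a b : ℕ → 𝕜) :
    splitPair m (c • a) b = c • splitPair m a b := by
  funext n
  simp only [splitPair, mk_smul, Pi.smul_apply, smul_eq_mul]
  rw [show (PowerSeries.X : PowerSeries 𝕜) ^ (m - 1) * (PowerSeries.C c * PowerSeries.mk a *
    PowerSeries.mk b * PowerSeries.mk 1 ^ (m - 2)) = PowerSeries.C c * (PowerSeries.X ^ (m - 1) *
    (PowerSeries.mk a * PowerSeries.mk b * PowerSeries.mk 1 ^ (m - 2))) by ring,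
    PowerSeries.coeff_C_mul]
  ring

theorem splitPair_add_right (m : ℕ) (a b c : ℕ → 𝕜) :
    splitPair m a (b + c) = splitPair m a b + splitPair m a c := by
  rw [splitPair_comm, splitPair_add_left, splitPair_comm m b, splitPair_comm m c]

theorem splitPair_smul_right (m : ℕ) (c : 𝕜) (a b : ℕ → 𝕜) :
    splitPair m a (c • b) = c • splitPair m a b := by
  rw [splitPair_comm, splitPair_smul_left, splitPair_comm]

end Linear

section Order

theorem ofReal_negBinom (μ : ℝ) (n : ℕ) : ((negBinom μ n : ℝ) : ℂ) = negBinom (μ : ℂ) n := by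
  simp [negBinom]

theorem ofReal_splitSum {m n : ℕ} (hn : m - 1 ≤ n) (a : ℕ → ℝ) :
    ((splitSum m a n : ℝ) : ℂ) = splitSum m (fun k => (a k : ℂ)) n := by
  rw [splitSum_eq hn, splitSum_eq hn]
  push_cast [ofReal_negBinom]
  rfl

theorem ofReal_splitPair {m n : ℕ} (hn : m - 1 ≤ n) (a b : ℕ → ℝ) :
    ((splitPair m a b n : ℝ) : ℂ) = splitPair m (fun k => (a k : ℂ)) (fun k => (b k : ℂ)) n := by
  rw [splitPair_eq hn, splitPair_eq hn]
  push_cast [ofReal_negBinom]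
  rfl

theorem negBinom_nonneg {μ : ℝ} (h : 0 ≤ μ) (n : ℕ) : 0 ≤ negBinom μ n :=
  div_nonneg (Finset.prod_nonneg fun _ _ => by positivity) (by positivity)

theorem negBinom_pos {μ : ℝ} (h : 0 < μ) (n : ℕ) : 0 < negBinom μ n :=
  div_pos (Finset.prod_pos fun _ _ => by positivity) (by positivity)

theorem splitSum_mono {m n : ℕ} (hn : m - 1 ≤ n) {a b : ℕ → ℝ}
    (h : ∀ k ≤ n - (m - 1), a k ≤ b k) : splitSum m a n ≤ splitSum m b n := by
  rw [splitSum_eq hn, splitSum_eq hn]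
  refine mul_le_mul_of_nonneg_left (Finset.sum_le_sum fun p hp => ?_) (by positivity)
  exact mul_le_mul_of_nonneg_right (h _ (Finset.HasAntidiagonal.antidiagonal.fst_le hp))
    (negBinom_nonneg (by positivity) _)

theorem norm_splitSum_le {m n : ℕ} (hn : m - 1 ≤ n) (a : ℕ → ℂ) :
    ‖splitSum m a n‖ ≤ splitSum m (fun k => ‖a k‖) n := by
  rw [splitSum_eq hn, splitSum_eq hn, norm_mul, norm_div, Complex.norm_natCast,
    Complex.norm_natCast]
  refine mul_le_mul_of_nonneg_left ((norm_sum_le _ _).trans (Finset.sum_le_sum fun p _ => ?_))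
    (by positivity)
  rw [norm_mul, ← Complex.ofReal_natCast, ← ofReal_negBinom, Complex.norm_real,
    Real.norm_of_nonneg (negBinom_nonneg (by positivity) _)]

theorem norm_splitPair_le {m n : ℕ} (hm : 1 ≤ m) (hn : m - 1 ≤ n) {a b : ℕ → ℂ} {a' b' : ℕ → ℝ}
    (ha : ∀ k, ‖a k‖ ≤ a' k) (hb : ∀ k, ‖b k‖ ≤ b' k) :
    ‖splitPair m a b n‖ ≤ splitPair m a' b' n := by
  have hm' : (0 : ℝ) ≤ (m : ℝ) - 1 := by
    have : (1 : ℝ) ≤ m := by exact_mod_cast hm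
    linarith
  rw [splitPair_eq hn, splitPair_eq hn, norm_mul, norm_div, norm_mul, Complex.norm_natCast,
    Complex.norm_natCast, show (m : ℂ) - 1 = ((m : ℝ) - 1 : ℝ) by push_cast; rfl,
    Complex.norm_real, Real.norm_of_nonneg hm']
  refine mul_le_mul_of_nonneg_left ((norm_sum_le _ _).trans (Finset.sum_le_sum fun p _ => ?_))
    (by positivity)
  rw [norm_mul, ← Complex.ofReal_natCast, ← ofReal_negBinom, Complex.norm_real,
    Real.norm_of_nonneg (negBinom_nonneg (by positivity) _)]
  refine mul_le_mul_of_nonneg_right ((norm_sum_le _ _).trans (Finset.sum_le_sum fun q _ => ?_))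
    (negBinom_nonneg (by positivity) _)
  rw [norm_mul]
  exact mul_le_mul (ha _) (hb _) (norm_nonneg _) ((norm_nonneg _).trans (ha _))

end Order

end

/-! ### Parameter derivatives, growth of binomial coefficients, and the transfer theorem -/

noncomputable section

/-- `∑_{k < n} 1 / (w + k)`. -/
def harmSum (w : ℂ) (n : ℕ) : ℂ := ∑ k ∈ Finset.range n, 1 / (w + k)

/-- `∑_{k < n} 1 / (w + k) ^ 2`. -/
def sqSum (w : ℂ) (n : ℕ) : ℂ := ∑ k ∈ Finset.range n, 1 / (w + k) ^ 2

/-- The derivative of `negBinom` with respect to the parameter. -/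
def negBinomD (w : ℂ) (n : ℕ) : ℂ := negBinom w n * harmSum w n

/-- The second derivative of `negBinom` with respect to the parameter. -/
def negBinomD2 (w : ℂ) (n : ℕ) : ℂ := negBinom w n * (harmSum w n ^ 2 - sqSum w n)

section Derivatives

theorem add_natCast_ne_zero {w : ℂ} (hw : 0 < w.re) (k : ℕ) : w + k ≠ 0 := by
  intro h
  have := congrArg Complex.re h
  simp at this
  have h2 : (0 : ℝ) ≤ k := by positivity
  linarith

theorem hasDerivAt_negBinom_of_ne_zero {w : ℂ} {n : ℕ} (hw : ∀ k < n, w + (k : ℂ) ≠ 0) :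
    HasDerivAt (fun z => negBinom z n) (negBinomD w n) w := by
  have hs : ∀ (z : ℂ) (n : ℕ), negBinom z (n + 1) = negBinom z n * (z + n) / (n + 1) := by
    intro z n
    have h1 : ((n : ℂ) + 1) ≠ 0 := by exact_mod_cast Nat.succ_ne_zero n
    rw [eq_div_iff h1]
    linear_combination negBinom_succ z n
  induction n with
  | zero => simpa [negBinomD, harmSum] using hasDerivAt_const w (1 : ℂ)
  | succ n ih =>
    have h1 := ((ih fun k hk => hw k (by omega)).mul
      ((hasDerivAt_id w).add_const (n : ℂ))).div_const ((n : ℂ) + 1)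
    have h2 : (fun z : ℂ => negBinom z (n + 1)) =
        fun z => ((fun z : ℂ => negBinom z n) * fun z : ℂ => id z + (n : ℂ)) z / ((n : ℂ) + 1) := by
      funext z; rw [hs]; rfl
    rw [h2]
    refine h1.congr_deriv ?_
    have := hw n (by omega)
    rw [negBinomD, negBinomD, hs, harmSum, harmSum, Finset.sum_range_succ]
    simp only [id]
    field_simp

theorem hasDerivAt_negBinom {w : ℂ} (hw : 0 < w.re) (n : ℕ) :
    HasDerivAt (fun z => negBinom z n) (negBinomD w n) w :=
  hasDerivAt_negBinom_of_ne_zero fun k _ => add_natCast_ne_zero hw k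

theorem hasDerivAt_harmSum {w : ℂ} (hw : 0 < w.re) (n : ℕ) :
    HasDerivAt (fun z => harmSum z n) (-sqSum w n) w := by
  simp only [harmSum, sqSum, ← Finset.sum_neg_distrib]
  refine HasDerivAt.fun_sum fun k _ => ?_
  have := ((hasDerivAt_id w).add_const (k : ℂ)).inv (add_natCast_ne_zero hw k)
  simp only [one_div]
  refine this.congr_deriv ?_
  simp [neg_div]

theorem hasDerivAt_negBinomD {w : ℂ} (hw : 0 < w.re) (n : ℕ) :
    HasDerivAt (fun z => negBinomD z n) (negBinomD2 w n) w := by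
  refine ((hasDerivAt_negBinom hw n).mul (hasDerivAt_harmSum hw n)).congr_deriv ?_
  rw [negBinomD2, negBinomD]
  ring

theorem hasDerivAt_coeff_mul {f : ℂ → ℕ → ℂ} {f' : ℕ → ℂ} {w : ℂ} (a : ℕ → ℂ)
    (h : ∀ n, HasDerivAt (fun z => f z n) (f' n) w) (n : ℕ) :
    HasDerivAt (fun z => PowerSeries.coeff n (PowerSeries.mk a * PowerSeries.mk (f z)))
      (PowerSeries.coeff n (PowerSeries.mk a * PowerSeries.mk f')) w := by
  simp only [PowerSeries.coeff_mul, PowerSeries.coeff_mk]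
  exact HasDerivAt.fun_sum fun p _ => (h p.2).const_mul _

/-- Derivative in ν of the product rule for `negBinom`. The two variants below come from
differentiating once more, in either parameter. -/
theorem mk_negBinom_mul_mk_negBinomD {μ ν : ℂ} (hμ : 0 < μ.re) (hν : 0 < ν.re) :
    PowerSeries.mk (negBinom μ) * PowerSeries.mk (negBinomD ν) =
      PowerSeries.mk (negBinomD (μ + ν)) := by
  ext n
  have h1 := hasDerivAt_coeff_mul (negBinom μ) (fun n => hasDerivAt_negBinom hν n) n
  simp only [mk_negBinom_mul, PowerSeries.coeff_mk] at h1
  have h2 := (hasDerivAt_negBinom (w := μ + ν) (by rw [Complex.add_re]; linarith) n).comp_const_add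
    μ ν
  rw [PowerSeries.coeff_mk]
  exact h1.unique h2

theorem mk_negBinom_mul_mk_negBinomD2 {μ ν : ℂ} (hμ : 0 < μ.re) (hν : 0 < ν.re) :
    PowerSeries.mk (negBinom μ) * PowerSeries.mk (negBinomD2 ν) =
      PowerSeries.mk (negBinomD2 (μ + ν)) := by
  ext n
  have h1 := hasDerivAt_coeff_mul (negBinom μ) (fun n => hasDerivAt_negBinomD hν n) n
  have h2 := (hasDerivAt_negBinomD (w := μ + ν) (by rw [Complex.add_re]; linarith) n).comp_const_add
    μ ν
  rw [PowerSeries.coeff_mk]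
  refine h1.unique (h2.congr_of_eventuallyEq ?_)
  filter_upwards [(Complex.continuous_re.isOpen_preimage _ isOpen_Ioi).mem_nhds
    (show ν ∈ Complex.re ⁻¹' Set.Ioi 0 from hν)] with z hz
  rw [mk_negBinom_mul_mk_negBinomD hμ hz, PowerSeries.coeff_mk]

theorem mk_negBinomD_mul_mk_negBinomD {μ ν : ℂ} (hμ : 0 < μ.re) (hν : 0 < ν.re) :
    PowerSeries.mk (negBinomD μ) * PowerSeries.mk (negBinomD ν) =
      PowerSeries.mk (negBinomD2 (μ + ν)) := by
  ext n
  have h1 := hasDerivAt_coeff_mul (negBinomD μ) (fun n => hasDerivAt_negBinom hν n) n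
  have h2 := (hasDerivAt_negBinomD (w := μ + ν) (by rw [Complex.add_re]; linarith) n).comp_const_add
    μ ν
  rw [PowerSeries.coeff_mk]
  refine h1.unique (h2.congr_of_eventuallyEq ?_)
  filter_upwards [(Complex.continuous_re.isOpen_preimage _ isOpen_Ioi).mem_nhds
    (show ν ∈ Complex.re ⁻¹' Set.Ioi 0 from hν)] with z hz
  rw [mul_comm, mk_negBinom_mul_mk_negBinomD hz hμ, PowerSeries.coeff_mk, add_comm]

theorem mk_one_eq_mk_negBinom : (PowerSeries.mk 1 : PowerSeries ℂ) =
    PowerSeries.mk (negBinom (1 : ℂ)) := by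
  congr 1; funext n; rw [negBinom_one]; rfl

theorem splitPair_negBinom_negBinomD {m : ℕ} (hm : 2 ≤ m) {μ ν : ℂ} (hμ : 0 < μ.re) (hν : 0 < ν.re)
    (h : 0 < (μ + ν - 1).re) (n : ℕ) :
    splitPair m (negBinom μ) (negBinomD ν) n =
      ((m : ℂ) - 1) * splitSum m (negBinomD (μ + ν - 1)) n := by
  refine splitPair_eq_splitSum hm ?_
  rw [mk_one_eq_mk_negBinom, mk_negBinom_mul_mk_negBinomD hμ hν, mul_comm,
    mk_negBinom_mul_mk_negBinomD (by simp) h, add_sub_cancel]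

theorem splitPair_negBinomD_negBinomD {m : ℕ} (hm : 2 ≤ m) {μ ν : ℂ} (hμ : 0 < μ.re)
    (hν : 0 < ν.re) (h : 0 < (μ + ν - 1).re) (n : ℕ) :
    splitPair m (negBinomD μ) (negBinomD ν) n =
      ((m : ℂ) - 1) * splitSum m (negBinomD2 (μ + ν - 1)) n := by
  refine splitPair_eq_splitSum hm ?_
  rw [mk_one_eq_mk_negBinom, mk_negBinomD_mul_mk_negBinomD hμ hν, mul_comm,
    mk_negBinom_mul_mk_negBinomD2 (by simp) h, add_sub_cancel]

theorem risingProd_eq (m : ℕ) (w : ℂ) :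
    risingProd m w = (m - 1).factorial * negBinom w (m - 1) := by
  have : ((m - 1).factorial : ℂ) ≠ 0 := by exact_mod_cast (m - 1).factorial_ne_zero
  rw [risingProd, negBinom]
  field_simp

theorem risingProd_ne_zero {w : ℂ} (hw : 0 < w.re) (m : ℕ) : risingProd m w ≠ 0 :=
  Finset.prod_ne_zero_iff.2 fun k _ => add_natCast_ne_zero hw k

theorem hasDerivAt_risingProd_of_ne_zero {w : ℂ} {m : ℕ} (hw : risingProd m w ≠ 0) :
    HasDerivAt (fun z => risingProd m z) (risingProd m w * harmSum w (m - 1)) w := by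
  have h := hw
  simp only [risingProd_eq]
  rw [risingProd, Finset.prod_ne_zero_iff] at h
  refine ((hasDerivAt_negBinom_of_ne_zero fun k hk => h k (Finset.mem_range.2 hk)).const_mul
    _).congr_deriv ?_
  rw [negBinomD, mul_assoc]

theorem hasDerivAt_risingProd {w : ℂ} (hw : 0 < w.re) (m : ℕ) :
    HasDerivAt (fun z => risingProd m z) (risingProd m w * harmSum w (m - 1)) w :=
  hasDerivAt_risingProd_of_ne_zero (risingProd_ne_zero hw m)

theorem hasDerivAt_splitSum {m n : ℕ} (hn : m - 1 ≤ n) {f : ℂ → ℕ → ℂ} {f' : ℕ → ℂ} {w : ℂ}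
    (h : ∀ n, HasDerivAt (fun z => f z n) (f' n) w) :
    HasDerivAt (fun z => splitSum m (f z) n) (splitSum m f' n) w := by
  simp only [splitSum_eq hn]
  exact (HasDerivAt.fun_sum fun p _ => (h p.1).mul_const _).const_mul _

/-- Derivative in `w` of the eigenvalue identity; one more derivative gives `splitSum_negBinomD2`.
So T acts triangularly on `negBinom w` and its parameter derivatives. -/
theorem risingProd_mul_splitSum_negBinomD {m n : ℕ} (hm : 1 ≤ m) (hn : m - 1 ≤ n) {w : ℂ}
    (hw : 0 < w.re) :
    risingProd m w * harmSum w (m - 1) * splitSum m (negBinom w) n +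
      risingProd m w * splitSum m (negBinomD w) n = m.factorial * negBinomD w n := by
  have h1 := (hasDerivAt_risingProd hw m).mul
    (hasDerivAt_splitSum hn (fun n => hasDerivAt_negBinom hw n))
  have h2 := (hasDerivAt_negBinom hw n).const_mul (m.factorial : ℂ)
  refine h1.unique (h2.congr_of_eventuallyEq (Eventually.of_forall fun z => ?_))
  exact risingProd_mul_splitSum_negBinom hm hn z

theorem splitSum_negBinomD {m n : ℕ} (hm : 1 ≤ m) (hn : m - 1 ≤ n) {w : ℂ} (hw : 0 < w.re) :
    splitSum m (negBinomD w) n = m.factorial / risingProd m w *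
      (negBinomD w n - harmSum w (m - 1) * negBinom w n) := by
  have h := risingProd_mul_splitSum_negBinomD hm hn hw
  have h' := risingProd_mul_splitSum_negBinom hm hn w
  have := risingProd_ne_zero hw m
  field_simp
  linear_combination h - harmSum w (m - 1) * h'

theorem splitSum_negBinomD2 {m n : ℕ} (hm : 1 ≤ m) (hn : m - 1 ≤ n) {w : ℂ} (hw : 0 < w.re) :
    splitSum m (negBinomD2 w) n = m.factorial / risingProd m w *
      (negBinomD2 w n - 2 * harmSum w (m - 1) * negBinomD w n +
        (harmSum w (m - 1) ^ 2 + sqSum w (m - 1)) * negBinom w n) := by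
  have h0 := risingProd_mul_splitSum_negBinom hm hn w
  have h1 := risingProd_mul_splitSum_negBinomD hm hn hw
  have e1 := (((hasDerivAt_risingProd hw m).mul (hasDerivAt_harmSum hw (m - 1))).mul
    (hasDerivAt_splitSum hn (fun n => hasDerivAt_negBinom hw n))).add
    ((hasDerivAt_risingProd hw m).mul
      (hasDerivAt_splitSum hn (fun n => hasDerivAt_negBinomD hw n)))
  have e2 := (hasDerivAt_negBinomD hw n).const_mul (m.factorial : ℂ)
  have h2 := e1.unique (e2.congr_of_eventuallyEq (by
    filter_upwards [(Complex.continuous_re.isOpen_preimage _ isOpen_Ioi).mem_nhds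
      (show w ∈ Complex.re ⁻¹' Set.Ioi 0 from hw)] with z hz
    exact risingProd_mul_splitSum_negBinomD hm hn hz))
  simp only [Pi.mul_apply] at h2
  have := risingProd_ne_zero hw m
  field_simp
  linear_combination h2 - 2 * harmSum w (m - 1) * h1 +
    (harmSum w (m - 1) ^ 2 + sqSum w (m - 1)) * h0

end Derivatives

section Asymptotics

theorem tendsto_negBinom_div_cpow (μ : ℂ) :
    Tendsto (fun n : ℕ => negBinom μ n / (n : ℂ) ^ (μ - 1)) atTop (𝓝 (Complex.Gamma μ)⁻¹) := by
  by_cases h : ∃ k : ℕ, μ = -k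
  -- At a pole `Complex.Gamma` takes the value 0, and the product vanishes once n > k, so both sides
  -- are 0. Elsewhere this is Euler's limit for the gamma function.
  · obtain ⟨k, rfl⟩ := h
    rw [Complex.Gamma_neg_nat_eq_zero, inv_zero]
    refine tendsto_const_nhds.congr' ?_
    filter_upwards [eventually_gt_atTop k] with n hn
    rw [negBinom, Finset.prod_eq_zero (Finset.mem_range.2 hn) (by simp)]
    simp
  · push Not at h
    have hG := (Complex.GammaSeq_tendsto_Gamma μ).inv₀ (Complex.Gamma_ne_zero h)
    have hL : Tendsto (fun n : ℕ => (n : ℂ) / (n + μ)) atTop (𝓝 1) := by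
      have := tendsto_natCast_div_add_atTop (𝕜 := ℂ) μ
      exact this
    have := hG.mul hL
    rw [mul_one] at this
    refine this.congr' ?_
    filter_upwards [eventually_gt_atTop 0] with n hn
    have hn' : (n : ℂ) ≠ 0 := by exact_mod_cast hn.ne'
    have h2 : (n.factorial : ℂ) ≠ 0 := by exact_mod_cast n.factorial_ne_zero
    have h3 : (n : ℂ) + μ ≠ 0 := fun h' => h n (by linear_combination h')
    have h4 : μ + (n : ℂ) ≠ 0 := by rwa [add_comm]
    rw [Complex.GammaSeq, Finset.prod_range_succ, negBinom, Complex.cpow_sub _ _ hn',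
      Complex.cpow_one]
    have h5 : (n : ℂ) ^ μ ≠ 0 := by simp [Complex.cpow_eq_zero_iff, hn']
    field_simp
    ring

theorem tendsto_negBinom_div_rpow {σ : ℝ} :
    Tendsto (fun n : ℕ => negBinom σ n / (n : ℝ) ^ (σ - 1)) atTop (𝓝 (Real.Gamma σ)⁻¹) := by
  have h := (Complex.continuous_re.tendsto _).comp (tendsto_negBinom_div_cpow (σ : ℂ))
  rw [Complex.Gamma_ofReal, ← Complex.ofReal_inv, Complex.ofReal_re] at h
  refine h.congr fun n => ?_
  simp only [Function.comp]
  rw [← ofReal_negBinom, ← Complex.ofReal_natCast, ← Complex.ofReal_one, ← Complex.ofReal_sub,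
    ← Complex.ofReal_cpow (by positivity), ← Complex.ofReal_div, Complex.ofReal_re]

theorem isLittleO_natCast_rpow {r s : ℝ} (h : r < s) :
    (fun n : ℕ => (n : ℝ) ^ r) =o[atTop] fun n : ℕ => (n : ℝ) ^ s := by
  have h1 := (tendsto_rpow_neg_atTop (sub_pos.2 h)).comp tendsto_natCast_atTop_atTop
  rw [Asymptotics.isLittleO_iff_tendsto']
  · refine h1.congr' ?_
    filter_upwards [eventually_gt_atTop 0] with n hn
    have : (0 : ℝ) < n := by exact_mod_cast hn
    rw [Function.comp, ← Real.rpow_sub this, neg_sub]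
  · filter_upwards [eventually_gt_atTop 0] with n hn h0
    have : (0 : ℝ) < n := by exact_mod_cast hn
    exact absurd h0 (Real.rpow_pos_of_pos this s).ne'

theorem isBigO_negBinom_rpow (μ : ℂ) :
    negBinom μ =O[atTop] fun n : ℕ => (n : ℝ) ^ (μ.re - 1) := by
  have h := (tendsto_negBinom_div_cpow μ).isBigO_one ℝ
  have h2 : (fun n : ℕ => negBinom μ n / (n : ℂ) ^ (μ - 1) * (n : ℂ) ^ (μ - 1)) =O[atTop]
      fun n : ℕ => (1 : ℝ) * ‖(n : ℂ) ^ (μ - 1)‖ :=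
    h.mul (Asymptotics.isBigO_refl (fun n : ℕ => (n : ℂ) ^ (μ - 1)) atTop).norm_right
  refine (h2.congr' ?_ (EventuallyEq.refl _ _)).trans ?_
  · filter_upwards [eventually_gt_atTop 0] with n hn
    have hn' : (n : ℂ) ≠ 0 := by exact_mod_cast hn.ne'
    rw [div_mul_cancel₀]
    simp [Complex.cpow_eq_zero_iff, hn']
  · refine Asymptotics.IsBigO.of_bound 1 ?_
    filter_upwards [eventually_gt_atTop 0] with n hn
    rw [one_mul, one_mul, norm_norm, Complex.norm_natCast_cpow_of_pos hn]
    simp only [Complex.sub_re, Complex.one_re]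
    exact le_abs_self _

theorem isBigO_rpow_negBinom {σ : ℝ} (hσ : 0 < σ) :
    (fun n : ℕ => (n : ℝ) ^ (σ - 1)) =O[atTop] negBinom σ := by
  have h := ((tendsto_negBinom_div_rpow (σ := σ)).inv₀
    (inv_ne_zero (Real.Gamma_pos_of_pos hσ).ne')).isBigO_one ℝ
  have h2 := h.mul (Asymptotics.isBigO_refl (negBinom σ) atTop)
  refine (h2.congr ?_ fun n => one_mul _)
  intro n
  have := (negBinom_pos hσ n).ne'
  field_simp

theorem summable_inv_sq_succ : Summable fun k : ℕ => 1 / ((k : ℝ) + 1) ^ 2 := by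
  have := (summable_nat_add_iff 1).2 (Real.summable_one_div_nat_pow.2 (one_lt_two))
  simpa using this

theorem abs_inv_sub_log_le (k : ℕ) :
    |1 / ((k : ℝ) + 1) - (Real.log (k + 1) - Real.log k)| ≤ 2 / ((k : ℝ) + 1) ^ 2 := by
  rcases Nat.eq_zero_or_pos k with rfl | hk
  · norm_num
  · have hk' : (1 : ℝ) ≤ k := by exact_mod_cast hk
    have h1 := Real.log_le_sub_one_of_pos (show 0 < ((k : ℝ) + 1) / k by positivity)
    have h2 := Real.log_le_sub_one_of_pos (show 0 < (k : ℝ) / (k + 1) by positivity)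
    rw [Real.log_div (by positivity) (by positivity)] at h1 h2
    have e1 : ((k : ℝ) + 1) / k - 1 = 1 / k := by field_simp; ring
    have e2 : (k : ℝ) / (k + 1) - 1 = - (1 / (k + 1)) := by field_simp; ring
    have h3 : 1 / (k : ℝ) - 1 / (k + 1) ≤ 2 / ((k : ℝ) + 1) ^ 2 := by
      rw [div_sub_div _ _ (by positivity) (by positivity), div_le_div_iff₀ (by positivity)
        (by positivity)]
      nlinarith
    rw [abs_le]
    have h4 : 0 ≤ 2 / ((k : ℝ) + 1) ^ 2 := by positivity
    constructor <;> linarith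

/-- The logarithm of Euler's product for 1/Γ is written as a series ∑ g_k whose derivatives g'_k are
summably bounded, locally uniformly. The exponential of its sum is 1/Γ by
`tendsto_negBinom_div_cpow`, so the termwise derivative is -ψ; its partial sums are `harmSum w n` -
log n. -/
theorem tendsto_harmSum_sub_log {w : ℂ} (hw : 0 < w.re) :
    Tendsto (fun n : ℕ => harmSum w n - Complex.log n) atTop (𝓝 (-Complex.digamma w)) := by
  set δ := min w.re 1 / 2 with hδ
  have hδ0 : 0 < δ := by
    have : 0 < min w.re 1 := lt_min hw one_pos
    positivity
  have hδw : δ < w.re := by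
    have := min_le_left w.re 1
    linarith
  have hδ1 : δ < 1 := by
    have := min_le_right w.re 1
    linarith
  set R := ‖w‖ + 2 with hR
  have hR0 : 0 < R := by positivity
  -- A convex region containing `w` and the base point 1, where every g_k vanishes; real parts
  -- bounded below and moduli bounded above make the derivative bounds uniform.
  set t : Set ℂ := {z | δ < z.re} ∩ Metric.ball 0 R with ht
  have hto : IsOpen t := (isOpen_lt continuous_const Complex.continuous_re).inter Metric.isOpen_ball
  have htc : IsPreconnected t :=
    ((convex_halfSpace_re_gt δ).inter (convex_ball _ _)).isPreconnected
  have hwt : w ∈ t := ⟨hδw, by simp [hR]⟩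
  have h1t : (1 : ℂ) ∈ t := ⟨by simpa using hδ1, by simp [hR]; linarith [norm_nonneg w]⟩
  -- Since `Real.log 0 = 0`, the term k = 0 is 0 and the sum over k < n telescopes to log n.
  set c : ℕ → ℝ := fun k => Real.log (k + 1) - Real.log k with hc
  have hcsum : ∀ n, ∑ k ∈ Finset.range n, c k = Real.log n := by
    intro n
    have := Finset.sum_range_sub (fun k : ℕ => Real.log k) n
    simpa [hc] using this
  set g : ℕ → ℂ → ℂ := fun k z => Complex.log (z + k) - Complex.log (1 + k) - (z - 1) * c k with hg
  set g' : ℕ → ℂ → ℂ := fun k z => 1 / (z + k) - c k with hg'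
  set u : ℕ → ℝ := fun k => ((R + 1) / δ + 2) * (1 / ((k : ℝ) + 1) ^ 2) with hu
  have hus : Summable u := summable_inv_sq_succ.mul_left _
  have hre : ∀ z ∈ t, 0 < z.re := fun z hz => hδ0.trans hz.1
  have hgd : ∀ k z, z ∈ t → HasDerivAt (g k) (g' k z) z := by
    intro k z hz
    have h1 : HasDerivAt (fun z : ℂ => Complex.log (z + k)) (1 / (z + k)) z :=
      ((hasDerivAt_id z).add_const (k : ℂ)).clog (Or.inl (by
        simp; have := hre z hz; positivity))
    have h2 := (h1.sub_const (Complex.log (1 + k))).sub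
      (((hasDerivAt_id z).sub_const 1).mul_const (c k : ℂ))
    refine HasDerivAt.congr_deriv (f := g k) h2 ?_
    simp [hg']
  have hgb : ∀ k z, z ∈ t → ‖g' k z‖ ≤ u k := by
    intro k z hz
    have hk : (0 : ℝ) < (k : ℝ) + 1 := by positivity
    have h1 : ‖(1 : ℂ) / (z + k) - 1 / (k + 1)‖ ≤ (R + 1) / δ * (1 / ((k : ℝ) + 1) ^ 2) := by
      have n1 := add_natCast_ne_zero (hre z hz) k
      have n2 : (k : ℂ) + 1 ≠ 0 := by exact_mod_cast Nat.succ_ne_zero k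
      have e : (1 : ℂ) / (z + k) - 1 / (k + 1) = (1 - z) / ((z + k) * (k + 1)) := by
        field_simp; ring
      rw [e, norm_div, norm_mul]
      have b1 : ‖(1 : ℂ) - z‖ ≤ R + 1 := by
        refine (norm_sub_le _ _).trans ?_
        have := hz.2
        rw [mem_ball_zero_iff] at this
        rw [norm_one]; linarith
      have b2 : δ * ((k : ℝ) + 1) ≤ ‖z + k‖ := by
        refine le_trans ?_ (Complex.re_le_norm _)
        have := hz.1
        simp only [Complex.add_re, Complex.natCast_re]
        have : δ * k ≤ k := mul_le_of_le_one_left (by positivity) hδ1.le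
        have h3 : δ < z.re := hz.1
        linarith
      have b3 : ‖(k : ℂ) + 1‖ = (k : ℝ) + 1 := by
        rw [show (k : ℂ) + 1 = ((k + 1 : ℕ) : ℂ) by push_cast; rfl, Complex.norm_natCast]
        push_cast; rfl
      rw [b3]
      calc ‖(1 : ℂ) - z‖ / (‖z + k‖ * ((k : ℝ) + 1))
          ≤ (R + 1) / (δ * ((k : ℝ) + 1) * ((k : ℝ) + 1)) := by gcongr
        _ = _ := by field_simp
    have h2 : ‖(1 : ℂ) / (k + 1) - c k‖ ≤ 2 / ((k : ℝ) + 1) ^ 2 := by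
      rw [show (1 : ℂ) / (k + 1) - c k = ((1 / ((k : ℝ) + 1) - c k : ℝ) : ℂ) by push_cast; rfl,
        Complex.norm_real]
      exact abs_inv_sub_log_le k
    calc ‖g' k z‖ = ‖((1 : ℂ) / (z + k) - 1 / (k + 1)) + (1 / (k + 1) - c k)‖ := by
          simp only [hg']; congr 1; ring
      _ ≤ _ := norm_add_le _ _
      _ ≤ u k := by
          simp only [hu]
          have : 2 / ((k : ℝ) + 1) ^ 2 = 2 * (1 / ((k : ℝ) + 1) ^ 2) := by ring
          rw [add_mul]
          linarith
  have hg1 : Summable fun k => g k 1 := by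
    have : ∀ k, g k 1 = 0 := by intro k; simp [hg]
    simp only [this]; exact summable_zero
  have hF := hasDerivAt_tsum_of_isPreconnected hus hto htc hgd hgb h1t hg1 hwt
  set F : ℂ → ℂ := fun z => ∑' k, g k z with hFdef
  have hexp : ∀ z ∈ t, Complex.exp (F z) = (Complex.Gamma z)⁻¹ := by
    intro z hz
    have hs := (summable_of_summable_hasDerivAt_of_isPreconnected hus hto htc hgd hgb h1t hg1
      hz).hasSum.tendsto_sum_nat
    have h1 := (Complex.continuous_exp.tendsto _).comp hs
    refine tendsto_nhds_unique h1 ((tendsto_negBinom_div_cpow z).congr' ?_)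
    filter_upwards [eventually_gt_atTop 0] with n hn
    have hn' : (n : ℂ) ≠ 0 := by exact_mod_cast hn.ne'
    simp only [Function.comp, hg]
    rw [Finset.sum_sub_distrib, ← Finset.mul_sum, Complex.exp_sub, Complex.exp_sum, ← Complex.ofReal_sum,
      hcsum, Complex.ofReal_log (by positivity), Complex.cpow_def_of_ne_zero hn',
      Complex.ofReal_natCast, mul_comm (Complex.log _)]
    congr 1
    rw [negBinom, ← Finset.prod_range_add_one_eq_factorial, Nat.cast_prod, ← Finset.prod_div_distrib]
    refine Finset.prod_congr rfl fun k _ => ?_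
    have e1 : (1 : ℂ) + k ≠ 0 := by rw [add_comm]; exact_mod_cast Nat.succ_ne_zero k
    rw [Complex.exp_sub, Complex.exp_log (add_natCast_ne_zero (hre z hz) k), Complex.exp_log e1]
    push_cast
    rw [add_comm (1 : ℂ)]
  have hG : HasDerivAt Complex.Gamma (-(∑' k, g' k w) * Complex.Gamma w) w := by
    have h1 := hF.neg.cexp
    have h2 : ∀ z ∈ t, Complex.Gamma z = Complex.exp (-F z) := fun z hz => by
      rw [Complex.exp_neg, hexp z hz, inv_inv]
    have h3 : Complex.Gamma =ᶠ[𝓝 w] fun z => Complex.exp ((-F) z) := by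
      filter_upwards [hto.mem_nhds hwt] with z hz
      exact h2 z hz
    refine (h1.congr_of_eventuallyEq h3).congr_deriv ?_
    rw [Pi.neg_apply, ← h2 w hwt]
    ring
  have hdig : -Complex.digamma w = ∑' k, g' k w := by
    have hne := Complex.Gamma_ne_zero_of_re_pos hw
    rw [Complex.digamma_def, logDeriv_apply, hG.deriv]
    field_simp
  rw [hdig]
  have hs : Summable fun k => g' k w := Summable.of_norm_bounded hus fun k => hgb k w hwt
  refine hs.hasSum.tendsto_sum_nat.congr fun n => ?_
  simp only [hg', Finset.sum_sub_distrib]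
  rw [← Complex.ofReal_sum, hcsum, Complex.ofReal_log (by positivity), Complex.ofReal_natCast,
    harmSum]

/-- For s > 1 the eigenvalue ρ of T at `negBinom (s + 1)` is below 1, because s + 1 > 2. A majorant
is propagated by induction through the positivity of T. -/
theorem isLittleO_of_sub_splitSum {m : ℕ} (hm : 3 ≤ m) {a : ℕ → ℂ} {s : ℝ} (hs : 1 < s)
    (h : (fun n => a n - splitSum m a n) =o[atTop] fun n : ℕ => (n : ℝ) ^ s) :
    a =o[atTop] fun n : ℕ => (n : ℝ) ^ s := by
  have hσ : (0 : ℝ) < s + 1 := by linarith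
  have hP : (m.factorial : ℝ) < risingProd m (s + 1) := by
    have : (m.factorial : ℝ) = ∏ j ∈ Finset.range (m - 1), ((2 : ℝ) + j) := by
      obtain ⟨k, rfl⟩ : ∃ k, m = k + 1 := ⟨m - 1, by omega⟩
      rw [← Finset.prod_range_add_one_eq_factorial, Finset.prod_range_succ', Nat.add_sub_cancel]
      push_cast
      simp only [mul_one]
      exact Finset.prod_congr rfl fun j _ => by ring
    rw [this, risingProd]
    refine Finset.prod_lt_prod_of_nonempty (fun j _ => by positivity) (fun j _ => by linarith) ?_
    simp; omega
  have hP0 : 0 < risingProd m (s + 1) := lt_of_le_of_lt (by positivity) hP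
  set ρ := (m.factorial : ℝ) / risingProd m (s + 1) with hρ
  have hρ1 : ρ < 1 := by rwa [hρ, div_lt_one hP0]
  have h' := h.trans_isBigO ((isBigO_rpow_negBinom hσ).congr_left fun n => by
    rw [add_sub_cancel_right])
  have hlin : (fun n : ℕ => ((n : ℝ) + 1)) =o[atTop] fun n : ℕ => (n : ℝ) ^ s := by
    have h2 := isLittleO_natCast_rpow hs
    refine Asymptotics.IsBigO.trans_isLittleO ?_ h2
    refine Asymptotics.IsBigO.of_bound 2 ?_
    filter_upwards [eventually_ge_atTop 1] with n hn
    have : (1 : ℝ) ≤ n := by exact_mod_cast hn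
    rw [Real.rpow_one, Real.norm_of_nonneg (by positivity), Real.norm_of_nonneg (by positivity)]
    linarith
  obtain ⟨C, hC, hCb⟩ : ∃ C > 0, ∀ᶠ n : ℕ in atTop, negBinom (s + 1) n ≤ C * (n : ℝ) ^ s := by
    have h1 := isBigO_negBinom_rpow ((s + 1 : ℝ) : ℂ)
    rw [Complex.ofReal_re, add_sub_cancel_right] at h1
    obtain ⟨C, hC, h2⟩ := h1.exists_pos
    refine ⟨C, hC, ?_⟩
    filter_upwards [h2.bound] with n hn
    rwa [← ofReal_negBinom, Complex.norm_real, Real.norm_of_nonneg (negBinom_nonneg hσ.le _),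
      Real.norm_of_nonneg (by positivity)] at hn
  rw [Asymptotics.isLittleO_iff]
  intro ε hε
  set δ := ε / 2 / C * (1 - ρ) with hδ
  have hδ0 : 0 < δ := by
    have : 0 < 1 - ρ := by linarith
    positivity
  have h1 := h'.bound hδ0
  rw [eventually_atTop] at h1
  obtain ⟨N, hN⟩ := h1
  set M := max N m
  set L := ∑ n ∈ Finset.range M, ‖a n‖ with hL
  have hL0 : 0 ≤ L := Finset.sum_nonneg fun _ _ => norm_nonneg _
  -- The majorant solves f = T f + δ `negBinom (s + 1)` exactly: δ is the part of the first term
  -- lost under T, while `negBinom 2`, that is n + 1, is a fixed point. The multiple `L` covers the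
  -- finitely many initial values and is o(n^s).
  set f : ℕ → ℝ := (ε / 2 / C) • negBinom (s + 1) + L • negBinom 2 with hf
  have hTf : ∀ n, m - 1 ≤ n → splitSum m f n + δ * negBinom (s + 1) n = f n := by
    intro n hn
    have hP2 : risingProd m (2 : ℝ) = m.factorial := by
      obtain ⟨k, rfl⟩ : ∃ k, m = k + 1 := ⟨m - 1, by omega⟩
      rw [← Finset.prod_range_add_one_eq_factorial, Finset.prod_range_succ', risingProd,
        Nat.add_sub_cancel]
      push_cast
      simp only [mul_one]
      exact Finset.prod_congr rfl fun j _ => by ring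
    have hm0 : (m.factorial : ℝ) ≠ 0 := by positivity
    rw [hf, splitSum_add, splitSum_smul, splitSum_smul]
    simp only [Pi.add_apply, Pi.smul_apply, smul_eq_mul]
    rw [splitSum_negBinom (by omega) hn hP0.ne', splitSum_negBinom (by omega) hn (hP2 ▸ hm0), hP2,
      div_self hm0, hδ, ← hρ]
    ring
  have hbound : ∀ n, ‖a n‖ ≤ f n := by
    intro n
    induction n using Nat.strong_induction_on with
    | _ n ih =>
      by_cases hn : n < M
      · have h2 : ‖a n‖ ≤ L :=
          Finset.single_le_sum (f := fun n => ‖a n‖) (fun _ _ => norm_nonneg _)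
            (Finset.mem_range.2 hn)
        have h3 := negBinom_nonneg hσ.le n
        simp only [hf, Pi.add_apply, Pi.smul_apply, smul_eq_mul, negBinom_two]
        have h4 : 0 ≤ ε / 2 / C * negBinom (s + 1) n := by positivity
        have h5 : L ≤ L * (n + 1) := le_mul_of_one_le_right hL0 (by
          have : (0 : ℝ) ≤ n := by positivity
          linarith)
        linarith
      · have hnM : M ≤ n := not_lt.1 hn
        have hnm : m ≤ n := (le_max_right _ _).trans hnM
        have h2 := hN n ((le_max_left _ _).trans hnM)
        rw [Real.norm_of_nonneg (negBinom_nonneg hσ.le n)] at h2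
        have h3 := norm_splitSum_le (show m - 1 ≤ n by omega) a
        have h4 : splitSum m (fun k => ‖a k‖) n ≤ splitSum m f n :=
          splitSum_mono (by omega) fun k hk => ih k (by omega)
        have h5 : ‖a n‖ ≤ ‖a n - splitSum m a n‖ + ‖splitSum m a n‖ := by
          simpa using norm_add_le (a n - splitSum m a n) (splitSum m a n)
        have := hTf n (by omega)
        linarith
  by_cases hL1 : L = 0
  · filter_upwards [hCb] with n hn
    refine (hbound n).trans ?_
    rw [Real.norm_of_nonneg (by positivity)]
    simp only [hf, hL1, Pi.add_apply, Pi.smul_apply, smul_eq_mul, zero_mul, add_zero]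
    calc ε / 2 / C * negBinom (s + 1) n ≤ ε / 2 / C * (C * (n : ℝ) ^ s) := by gcongr
      _ = ε / 2 * (n : ℝ) ^ s := by field_simp
      _ ≤ ε * (n : ℝ) ^ s := by gcongr; linarith
  · have hLpos : 0 < L := lt_of_le_of_ne hL0 (Ne.symm hL1)
    filter_upwards [hCb, hlin.bound (show 0 < ε / 2 / L by positivity)] with n hn hn2
    refine (hbound n).trans ?_
    rw [Real.norm_of_nonneg (by positivity), Real.norm_of_nonneg (by positivity)] at hn2
    rw [Real.norm_of_nonneg (by positivity)]
    simp only [hf, Pi.add_apply, Pi.smul_apply, smul_eq_mul, negBinom_two]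
    calc ε / 2 / C * negBinom (s + 1) n + L * ((n : ℝ) + 1)
        ≤ ε / 2 / C * (C * (n : ℝ) ^ s) + L * (ε / 2 / L * (n : ℝ) ^ s) := by gcongr
      _ = ε * (n : ℝ) ^ s := by field_simp; ring

end Asymptotics

end

/-! ### Location of the zeros of Λ and the threshold between 26 and 27 -/

noncomputable section

theorem indicial_eq (m : ℕ) (z : ℂ) : indicial m z = risingProd m z - m.factorial := rfl

theorem risingProd_two (m : ℕ) (hm : 1 ≤ m) : risingProd m (2 : ℝ) = m.factorial := by
  obtain ⟨k, rfl⟩ : ∃ k, m = k + 1 := ⟨m - 1, by omega⟩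
  rw [← Finset.prod_range_add_one_eq_factorial, Finset.prod_range_succ', risingProd,
    Nat.add_sub_cancel]
  push_cast
  simp only [mul_one]
  exact Finset.prod_congr rfl fun j _ => by ring

section Norm

theorem norm_add_natCast_le {z w : ℂ} (hz : 0 ≤ z.re) (h1 : z.re ≤ w.re) (h2 : |z.im| ≤ |w.im|)
    (j : ℕ) : ‖z + j‖ ≤ ‖w + j‖ := by
  have hj : (0 : ℝ) ≤ j := by positivity
  rw [← abs_of_nonneg (norm_nonneg (z + j)), ← abs_of_nonneg (norm_nonneg (w + j)), ← sq_le_sq,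
    Complex.sq_norm, Complex.sq_norm, Complex.normSq_apply, Complex.normSq_apply]
  have := sq_le_sq.2 h2
  simp
  nlinarith

theorem norm_add_natCast_lt {z w : ℂ} (hz : 0 < z.re) (h1 : z.re ≤ w.re) (h2 : |z.im| ≤ |w.im|)
    (h3 : z.re < w.re ∨ |z.im| < |w.im|) (j : ℕ) : ‖z + j‖ < ‖w + j‖ := by
  have hj : (0 : ℝ) ≤ j := by positivity
  rw [← abs_of_nonneg (norm_nonneg (z + j)), ← abs_of_nonneg (norm_nonneg (w + j)), ← sq_lt_sq,
    Complex.sq_norm, Complex.sq_norm, Complex.normSq_apply, Complex.normSq_apply]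
  simp
  rcases h3 with h3 | h3
  · have := sq_le_sq.2 h2
    nlinarith
  · have := sq_lt_sq.2 h3
    nlinarith

theorem norm_risingProd_le (m : ℕ) {z w : ℂ} (hz : 0 ≤ z.re) (h1 : z.re ≤ w.re)
    (h2 : |z.im| ≤ |w.im|) : ‖risingProd m z‖ ≤ ‖risingProd m w‖ := by
  rw [risingProd, risingProd, norm_prod, norm_prod]
  exact Finset.prod_le_prod (fun _ _ => norm_nonneg _) fun j _ => norm_add_natCast_le hz h1 h2 j

theorem norm_risingProd_lt {m : ℕ} (hm : 2 ≤ m) {z w : ℂ} (hz : 0 < z.re) (h1 : z.re ≤ w.re)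
    (h2 : |z.im| ≤ |w.im|) (h3 : z.re < w.re ∨ |z.im| < |w.im|) :
    ‖risingProd m z‖ < ‖risingProd m w‖ := by
  rw [risingProd, risingProd, norm_prod, norm_prod]
  refine Finset.prod_lt_prod_of_nonempty
    (fun j _ => norm_pos_iff.2 (add_natCast_ne_zero hz j))
    (fun j _ => norm_add_natCast_lt hz h1 h2 h3 j) (by simp; omega)

theorem risingProd_two_complex {m : ℕ} (hm : 1 ≤ m) : risingProd m (2 : ℂ) = m.factorial := by
  have := congrArg (fun x : ℝ => (x : ℂ)) (risingProd_two m hm)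
  simpa [risingProd] using this

theorem norm_risingProd_of_indicial_eq_zero {m : ℕ} {z : ℂ} (h : indicial m z = 0) :
    ‖risingProd m z‖ = m.factorial := by
  rw [indicial_eq, sub_eq_zero] at h
  rw [h, Complex.norm_natCast]

theorem indicial_two {m : ℕ} (hm : 1 ≤ m) : indicial m 2 = 0 := by
  rw [indicial_eq, risingProd_two_complex hm, sub_self]

/-- In the right half plane the modulus of the rising product strictly increases with Re z and with
|Im z|, and at 2 it already equals m!. -/
theorem re_lt_two_of_indicial {m : ℕ} (hm : 2 ≤ m) {z : ℂ} (h : indicial m z = 0) (hz : z ≠ 2) :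
    z.re < 2 := by
  by_contra hre
  rw [not_lt] at hre
  have h1 := norm_risingProd_of_indicial_eq_zero h
  have h2 := norm_risingProd_lt hm (z := 2) (w := z) (by simp) (by simpa using hre) (by simp) (by
    by_contra hne
    rw [not_or, not_lt, not_lt] at hne
    refine hz (Complex.ext ?_ ?_)
    · simp at hne ⊢; linarith [hne.1]
    · simpa using hne.2)
  rw [h1, risingProd_two_complex (by omega), Complex.norm_natCast] at h2
  exact lt_irrefl _ h2

theorem im_ne_zero_of_indicial {m : ℕ} (hm : 2 ≤ m) {z : ℂ} (h : indicial m z = 0) (hz : z ≠ 2)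
    (hre : 0 < z.re) : z.im ≠ 0 := by
  intro him
  have h1 := norm_risingProd_of_indicial_eq_zero h
  have h0 := re_lt_two_of_indicial hm h hz
  have h2 := norm_risingProd_lt hm (z := z) (w := 2) hre (by simpa using h0.le) (by simp [him])
    (Or.inl (by simpa using h0))
  rw [h1, risingProd_two_complex (by omega), Complex.norm_natCast] at h2
  exact lt_irrefl _ h2

/-- On a vertical line the modulus takes the value m! at only one height. This makes the second zero
unique up to conjugation. -/
theorem abs_im_eq_of_indicial {m : ℕ} (hm : 2 ≤ m) {z w : ℂ} (hz : indicial m z = 0)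
    (hw : indicial m w = 0) (hre : 0 < z.re) (h : z.re = w.re) : |z.im| = |w.im| := by
  have h1 := norm_risingProd_of_indicial_eq_zero hz
  have h2 := norm_risingProd_of_indicial_eq_zero hw
  rcases lt_trichotomy |z.im| |w.im| with h' | h' | h'
  · have := norm_risingProd_lt hm hre h.le h'.le (Or.inr h')
    rw [h1, h2] at this; exact absurd this (lt_irrefl _)
  · exact h'
  · have := norm_risingProd_lt hm (h ▸ hre) h.ge h'.le (Or.inr h')
    rw [h1, h2] at this; exact absurd this (lt_irrefl _)

theorem indicial_conj (m : ℕ) (z : ℂ) :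
    indicial m (starRingEnd ℂ z) = starRingEnd ℂ (indicial m z) := by
  simp [indicial]

end Norm

section Argument

/-- The continuous argument of `risingProd m z` in the right half plane. -/
def argSum (m : ℕ) (z : ℂ) : ℝ := ∑ j ∈ Finset.range (m - 1), Real.arctan (z.im / (z.re + j))

theorem norm_mul_exp_arctan {z : ℂ} (hz : 0 < z.re) :
    z = ‖z‖ * Complex.exp (Complex.I * Real.arctan (z.im / z.re)) := by
  have h1 : Real.arctan (z.im / z.re) = z.arg := by
    rw [← Complex.tan_arg, Real.arctan_tan]
    · exact (abs_lt.1 (Complex.abs_arg_lt_pi_div_two_iff.2 (Or.inl hz))).1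
    · exact (abs_lt.1 (Complex.abs_arg_lt_pi_div_two_iff.2 (Or.inl hz))).2
  rw [h1, mul_comm Complex.I, Complex.norm_mul_exp_arg_mul_I]

theorem risingProd_polar (m : ℕ) {z : ℂ} (hz : 0 < z.re) :
    risingProd m z = ‖risingProd m z‖ * Complex.exp (Complex.I * argSum m z) := by
  rw [argSum, Complex.ofReal_sum, Finset.mul_sum, Complex.exp_sum, risingProd, norm_prod,
    Complex.ofReal_prod, ← Finset.prod_mul_distrib]
  refine Finset.prod_congr rfl fun j _ => ?_
  have := norm_mul_exp_arctan (z := z + j) (by simp; positivity)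
  simpa using this

theorem im_risingProd (m : ℕ) {z : ℂ} (hz : 0 < z.re) :
    (risingProd m z).im = ‖risingProd m z‖ * Real.sin (argSum m z) := by
  conv_lhs => rw [risingProd_polar m hz]
  rw [Complex.im_ofReal_mul, mul_comm Complex.I,
    Complex.exp_ofReal_mul_I_im]

/-- Each arctangent grows with the imaginary part and decreases with the real part, and further
factors add nonnegative angles. -/
theorem argSum_le {m m' : ℕ} (hmm : m ≤ m') {z w : ℂ} (hw : 0 < w.re) (h1 : w.re ≤ z.re)
    (hz : 0 ≤ z.im) (h2 : z.im ≤ w.im) : argSum m z ≤ argSum m' w := by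
  have h3 : argSum m z ≤ argSum m w := by
    refine Finset.sum_le_sum fun j _ => Real.arctan_strictMono.monotone ?_
    have : 0 < w.re + j := by positivity
    have h0 : 0 ≤ w.im := hz.trans h2
    gcongr
  refine h3.trans (Finset.sum_le_sum_of_subset_of_nonneg ?_ fun j _ _ => ?_)
  · intro j; simp only [Finset.mem_range]; omega
  · rw [Real.arctan_nonneg]
    have : 0 ≤ w.im := hz.trans h2
    positivity

theorem argSum_pos {m : ℕ} (hm : 2 ≤ m) {z : ℂ} (hz : 0 < z.re) (h : 0 < z.im) :
    0 < argSum m z := by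
  refine Finset.sum_pos (fun j _ => ?_) (by simp; omega)
  rw [Real.arctan_pos]
  positivity

theorem argSum_of_indicial {m : ℕ} {z : ℂ} (hz : 0 < z.re) (h : indicial m z = 0) :
    ∃ k : ℤ, argSum m z = k * (2 * Real.pi) := by
  have h1 := risingProd_polar m hz
  have h0 := norm_risingProd_of_indicial_eq_zero h
  rw [h0] at h1
  rw [indicial_eq, sub_eq_zero] at h
  rw [h] at h1
  have h2 : (m.factorial : ℂ) ≠ 0 := by exact_mod_cast m.factorial_ne_zero
  push_cast at h1
  have h3 : Complex.exp (Complex.I * argSum m z) = 1 :=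
    mul_left_cancel₀ h2 (by rw [← h1, mul_one])
  obtain ⟨k, hk⟩ := Complex.exp_eq_one_iff.1 h3
  refine ⟨k, ?_⟩
  have h4 : (argSum m z : ℂ) = k * (2 * Real.pi) := by
    apply mul_left_cancel₀ Complex.I_ne_zero
    rw [hk]; ring
  exact_mod_cast h4

end Argument

section Numerics

/-- Real and imaginary part of `∏_{j < k} (a + b j + c i)`. -/
def gaussProd (a b c : ℤ) : ℕ → ℤ × ℤ
  | 0 => (1, 0)
  | k + 1 => ((gaussProd a b c k).1 * (a + b * k) - (gaussProd a b c k).2 * c,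
      (gaussProd a b c k).1 * c + (gaussProd a b c k).2 * (a + b * k))

theorem gaussProd_eq (a b c : ℤ) (hb : 0 < b) (k : ℕ) :
    (b : ℂ) ^ k * risingProd (k + 1) ((a / b : ℝ) + (c / b : ℝ) * Complex.I) =
      (gaussProd a b c k).1 + (gaussProd a b c k).2 * Complex.I := by
  have hb' : (b : ℂ) ≠ 0 := by exact_mod_cast hb.ne'
  rw [risingProd, Nat.add_sub_cancel]
  induction k with
  | zero => simp [gaussProd]
  | succ k ih =>
    rw [Finset.prod_range_succ, pow_succ]
    have e : (b : ℂ) * (((a / b : ℝ) : ℂ) + ((c / b : ℝ) : ℂ) * Complex.I + k) =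
        (a + b * k) + c * Complex.I := by
      push_cast; field_simp; ring
    rw [show ∀ p q r s : ℂ, p * q * (r * s) = (p * r) * (q * s) by intros; ring, ih, e, gaussProd]
    push_cast
    linear_combination ((gaussProd a b c k).2 : ℂ) * c * Complex.I_sq

theorem im_risingProd_gaussProd (a b c : ℤ) (hb : 0 < b) (k : ℕ) :
    (b : ℝ) ^ k * (risingProd (k + 1) (((a / b : ℝ) : ℂ) + ((c / b : ℝ) : ℂ) * Complex.I)).im =
      (gaussProd a b c k).2 := by
  have h := congrArg Complex.im (gaussProd_eq a b c hb k)
  rw [show (b : ℂ) ^ k = (((b : ℝ) ^ k : ℝ) : ℂ) by push_cast; rfl, Complex.im_ofReal_mul] at h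
  rw [h]; simp

theorem sq_norm_risingProd_gaussProd (a b c : ℤ) (hb : 0 < b) (k : ℕ) :
    ((b : ℝ) ^ k * ‖risingProd (k + 1) (((a / b : ℝ) : ℂ) + ((c / b : ℝ) : ℂ) * Complex.I)‖) ^ 2 =
      (gaussProd a b c k).1 ^ 2 + (gaussProd a b c k).2 ^ 2 := by
  have h := congrArg (fun z : ℂ => ‖z‖ ^ 2) (gaussProd_eq a b c hb k)
  simp only [norm_mul, norm_pow] at h
  rw [Complex.norm_intCast, abs_of_pos (by exact_mod_cast hb)] at h
  rw [h, Complex.sq_norm, Complex.normSq_apply]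
  simp
  ring

set_option maxRecDepth 20000 in
-- The point is 3/2 + 2.2045 i: high enough that the modulus exceeds m! for every m from 3 to 26,
-- low enough that the argument stays below 2π for m = 26. Denominators are cleared so that all is
-- integer arithmetic.
theorem gaussProd_critical_low : (gaussProd 3000 2000 4409 25).2 < 0 ∧
    ∀ k ∈ Finset.Icc 2 25, (2000 ^ k * (k + 1).factorial : ℤ) ^ 2 <
      (gaussProd 3000 2000 4409 k).1 ^ 2 + (gaussProd 3000 2000 4409 k).2 ^ 2 := by
  decide +kernel

set_option maxRecDepth 20000 in
-- The point is 3/2 + 2.2 i: for m = 27 the modulus is still at most m!, while the argument, located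
-- through the signs after 6 and 26 factors, exceeds 2π.
theorem gaussProd_critical_high : (gaussProd 15 10 22 6).2 < 0 ∧ 0 < (gaussProd 15 10 22 26).2 ∧
    (gaussProd 15 10 22 26).1 ^ 2 + (gaussProd 15 10 22 26).2 ^ 2 ≤
      (10 ^ 26 * (27 : ℕ).factorial : ℤ) ^ 2 := by
  decide +kernel

theorem norm_critical_low {m : ℕ} (hm : 3 ≤ m) (hm' : m ≤ 26) :
    (m.factorial : ℝ) <
      ‖risingProd m (((3000 / 2000 : ℝ) : ℂ) + ((4409 / 2000 : ℝ) : ℂ) * Complex.I)‖ := by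
  obtain ⟨k, rfl⟩ : ∃ k, m = k + 1 := ⟨m - 1, by omega⟩
  have h1 := gaussProd_critical_low.2 k (by rw [Finset.mem_Icc]; omega)
  have h2 := sq_norm_risingProd_gaussProd 3000 2000 4409 (by norm_num) k
  have h3 : ((2000 : ℝ) ^ k * (k + 1).factorial) ^ 2 <
      (gaussProd 3000 2000 4409 k).1 ^ 2 + (gaussProd 3000 2000 4409 k).2 ^ 2 := by exact_mod_cast h1
  rw [← h2] at h3
  have h4 := lt_of_pow_lt_pow_left₀ 2 (by positivity) h3
  push_cast at h4
  have h5 := lt_of_mul_lt_mul_left h4 (by positivity)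
  push_cast
  exact h5

theorem argSum_critical_low :
    argSum 26 (((3000 / 2000 : ℝ) : ℂ) + ((4409 / 2000 : ℝ) : ℂ) * Complex.I) < 2 * Real.pi := by
  set z : ℂ := ((3000 / 2000 : ℝ) : ℂ) + ((4409 / 2000 : ℝ) : ℂ) * Complex.I with hz
  have hre : z.re = 3 / 2 := by simp [hz]; norm_num
  have him : z.im = 4409 / 2000 := by simp [hz]
  have hpos : 0 < z.re := by rw [hre]; norm_num
  have h1 := im_risingProd_gaussProd 3000 2000 4409 (by norm_num) 25
  have h2 : ((gaussProd 3000 2000 4409 25).2 : ℝ) < 0 := by exact_mod_cast gaussProd_critical_low.1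
  rw [← h1] at h2
  push_cast at h2
  have h3 : (risingProd 26 z).im < 0 := by
    have := neg_of_mul_neg_right h2 (by positivity)
    rw [hz]; push_cast; exact this
  rw [im_risingProd 26 hpos] at h3
  have hsin : Real.sin (argSum 26 z) < 0 := neg_of_mul_neg_right h3 (norm_nonneg _)
  -- A negative sine excludes the interval [2π, 3π]; larger arguments are excluded by arctan x ≤ x,
  -- as the sum of the tangents is below 9 < 3π.
  have hub : argSum 26 z < 3 * Real.pi := by
    have h4 : argSum 26 z ≤ ∑ j ∈ Finset.range 25, z.im / (z.re + j) := by
      refine Finset.sum_le_sum fun j _ => ?_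
      have h0 : 0 ≤ z.im / (z.re + j) := by rw [hre, him]; positivity
      have := Real.le_tan (Real.arctan_nonneg.2 h0) (Real.arctan_lt_pi_div_two _)
      rwa [Real.tan_arctan] at this
    have h5 : ∑ j ∈ Finset.range 25, z.im / (z.re + j) < 9 := by
      rw [hre, him]
      norm_num [Finset.sum_range_succ]
    have := Real.pi_gt_three
    linarith
  by_contra hge
  rw [not_lt] at hge
  have h6 : 0 ≤ Real.sin (argSum 26 z - 2 * Real.pi) :=
    Real.sin_nonneg_of_nonneg_of_le_pi (by linarith) (by linarith)
  rw [Real.sin_sub_two_pi] at h6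
  linarith

theorem argSum_critical_high :
    2 * Real.pi < argSum 27 (((15 / 10 : ℝ) : ℂ) + ((22 / 10 : ℝ) : ℂ) * Complex.I) := by
  set z : ℂ := ((15 / 10 : ℝ) : ℂ) + ((22 / 10 : ℝ) : ℂ) * Complex.I with hz
  have hre : z.re = 3 / 2 := by simp [hz]; norm_num
  have him : z.im = 22 / 10 := by simp [hz]
  have hpos : 0 < z.re := by rw [hre]; norm_num
  have hipos : 0 < z.im := by rw [him]; norm_num
  -- The argument passes π within the first 6 factors because the imaginary part is negative there.
  -- A positive sine after 26 factors then forces it beyond 2π.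
  have h7 : Real.pi < argSum 7 z := by
    have h1 := im_risingProd_gaussProd 15 10 22 (by norm_num) 6
    have h2 : ((gaussProd 15 10 22 6).2 : ℝ) < 0 := by exact_mod_cast gaussProd_critical_high.1
    rw [← h1] at h2
    push_cast at h2
    have h3 : (risingProd 7 z).im < 0 := by
      have := neg_of_mul_neg_right h2 (by positivity)
      rw [hz]; push_cast; exact this
    rw [im_risingProd 7 hpos] at h3
    have hsin : Real.sin (argSum 7 z) < 0 := neg_of_mul_neg_right h3 (norm_nonneg _)
    by_contra hle
    have := Real.sin_nonneg_of_nonneg_of_le_pi (argSum_pos (m := 7) (by norm_num) hpos hipos).le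
      (not_lt.1 hle)
    linarith
  have h8 : argSum 7 z ≤ argSum 27 z := argSum_le (by norm_num) hpos le_rfl hipos.le le_rfl
  have h1 := im_risingProd_gaussProd 15 10 22 (by norm_num) 26
  have h2 : (0 : ℝ) < (gaussProd 15 10 22 26).2 := by exact_mod_cast gaussProd_critical_high.2.1
  rw [← h1] at h2
  push_cast at h2
  have h3 : 0 < (risingProd 27 z).im := by
    have := pos_of_mul_pos_right h2 (by positivity)
    rw [hz]; push_cast; exact this
  rw [im_risingProd 27 hpos] at h3
  have hsin : 0 < Real.sin (argSum 27 z) := pos_of_mul_pos_right h3 (norm_nonneg _)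
  by_contra hle
  have h9 : 0 ≤ Real.sin (argSum 27 z - Real.pi) :=
    Real.sin_nonneg_of_nonneg_of_le_pi (by linarith) (by linarith)
  rw [Real.sin_sub_pi] at h9
  linarith

theorem norm_critical_high {m : ℕ} (hm : 27 ≤ m) :
    ‖risingProd m (((15 / 10 : ℝ) : ℂ) + ((22 / 10 : ℝ) : ℂ) * Complex.I)‖ ≤ m.factorial := by
  induction m, hm using Nat.le_induction with
  | base =>
    have h1 := gaussProd_critical_high.2.2
    have h2 := sq_norm_risingProd_gaussProd 15 10 22 (by norm_num) 26
    have h3 : ((gaussProd 15 10 22 26).1 : ℝ) ^ 2 + (gaussProd 15 10 22 26).2 ^ 2 ≤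
      ((10 : ℝ) ^ 26 * (27 : ℕ).factorial) ^ 2 := by exact_mod_cast h1
    rw [← h2] at h3
    have h4 := le_of_sq_le_sq h3 (by positivity)
    push_cast at h4
    have h5 := le_of_mul_le_mul_left h4 (by positivity)
    push_cast
    exact h5
  | succ m hm ih =>
    obtain ⟨k, rfl⟩ : ∃ k, m = k + 1 := ⟨m - 1, by omega⟩
    have hs : ∀ z : ℂ, risingProd (k + 1 + 1) z = risingProd (k + 1) z * (z + k) := by
      intro z
      rw [risingProd, risingProd, Nat.add_sub_cancel, Nat.add_sub_cancel, Finset.prod_range_succ]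
    rw [hs, norm_mul, Nat.factorial_succ (k + 1), mul_comm (k + 1 + 1)]
    push_cast at ih ⊢
    -- The new factor satisfies |3/2 + k + 2.2 i| ≤ k + 2 for k ≥ 26, so the modulus grows no faster
    -- than the factorial.
    refine mul_le_mul ih ?_ (norm_nonneg _) (by positivity)
    have hk : (26 : ℝ) ≤ k := by
      have : 26 ≤ k := by omega
      exact_mod_cast this
    refine le_of_sq_le_sq ?_ (by positivity)
    rw [Complex.sq_norm, Complex.normSq_apply]
    have e : (15 / 10 : ℂ) = ((15 / 10 : ℝ) : ℂ) := by push_cast; rfl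
    have e' : (22 / 10 : ℂ) = ((22 / 10 : ℝ) : ℂ) := by push_cast; rfl
    rw [e, e']
    simp only [Complex.add_re, Complex.add_im, Complex.ofReal_re, Complex.ofReal_im, Complex.mul_re,
      Complex.mul_im, Complex.I_re, Complex.I_im, Complex.natCast_re, Complex.natCast_im]
    nlinarith

end Numerics

/-- A zero in the upper half plane with Re z ≥ 3/2 lies below the critical height, otherwise the
modulus exceeds m!. Its argument is then strictly between 0 and 2π, yet at a zero it is a multiple
of 2π. -/
theorem re_lt_of_indicial {m : ℕ} (hm : 3 ≤ m) (hm' : m ≤ 26) {z : ℂ} (h : indicial m z = 0)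
    (hz : z ≠ 2) : z.re < 3 / 2 := by
  have key : ∀ z : ℂ, indicial m z = 0 → 0 < z.im → z.re < 3 / 2 := by
    intro z h hpos
    by_contra hge
    rw [not_lt] at hge
    have hre : 0 < z.re := by linarith
    set w : ℂ := ((3000 / 2000 : ℝ) : ℂ) + ((4409 / 2000 : ℝ) : ℂ) * Complex.I with hw
    have hwre : w.re = 3 / 2 := by simp [hw]; norm_num
    have hwim : w.im = 4409 / 2000 := by simp [hw]
    have hlt : z.im < w.im := by
      by_contra hge'
      rw [not_lt] at hge'
      have h1 := norm_risingProd_le m (z := w) (w := z) (by rw [hwre]; norm_num)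
        (by rw [hwre]; exact hge) (by
          rw [abs_of_pos hpos, abs_of_nonneg (by rw [hwim]; norm_num)]; exact hge')
      rw [norm_risingProd_of_indicial_eq_zero h] at h1
      exact absurd (norm_critical_low hm hm') (not_lt.2 h1)
    have h2 := argSum_le hm' (z := z) (w := w) (by rw [hwre]; norm_num) (by rw [hwre]; exact hge)
      hpos.le hlt.le
    have h3 := argSum_pos (m := m) (by omega) hre hpos
    obtain ⟨k, hk⟩ := argSum_of_indicial hre h
    have h4 : argSum m z < 2 * Real.pi := h2.trans_lt argSum_critical_low
    have hpi := Real.two_pi_pos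
    rw [hk] at h3 h4
    have h5 : (0 : ℝ) < k := pos_of_mul_pos_left h3 hpi.le
    have h6 : (k : ℝ) < 1 := by
      by_contra h7
      nlinarith
    have h7 : (0 : ℤ) < k := by exact_mod_cast h5
    have h8 : k < (1 : ℤ) := by exact_mod_cast h6
    omega
  by_contra hge
  have hre : 0 < z.re := by linarith [not_lt.1 hge]
  rcases lt_or_gt_of_ne (im_ne_zero_of_indicial (by omega) h hz hre) with h1 | h1
  · have := key (starRingEnd ℂ z) (by rw [indicial_conj, h, map_zero]) (by simpa using h1)
    rw [Complex.conj_re] at this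
    exact hge this
  · exact hge (key z h h1)

section Existence

/-- An implicit function theorem by monotonicity in `y` alone: comparing `f x a` with `c` for fixed
`a` traps the solution. -/
theorem continuous_implicit {s : Set ℝ} {f : ℝ → ℝ → ℝ} {Y : ℝ → ℝ} {c : ℝ}
    (hf : ∀ y, Continuous fun x => f x y)
    (hmono : ∀ x ∈ s, StrictMonoOn (f x) (Set.Ici 0)) (hY0 : ∀ x ∈ s, 0 ≤ Y x)
    (hY : ∀ x ∈ s, f x (Y x) = c) : ContinuousOn Y s := by
  intro x hx
  rw [ContinuousWithinAt, tendsto_order]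
  constructor
  · intro a ha
    by_cases ha0 : a < 0
    · filter_upwards [self_mem_nhdsWithin] with x' hx'
      exact ha0.trans_le (hY0 x' hx')
    · rw [not_lt] at ha0
      have h1 : f x a < c := by
        rw [← hY x hx]; exact hmono x hx ha0 (hY0 x hx) ha
      filter_upwards [self_mem_nhdsWithin,
        mem_nhdsWithin_of_mem_nhds ((hf a).continuousAt.eventually_lt_const h1)] with x' hx' h2
      rw [← hY x' hx'] at h2
      exact ((hmono x' hx').lt_iff_lt ha0 (hY0 x' hx')).1 h2
  · intro a ha
    have ha0 : 0 ≤ a := (hY0 x hx).trans ha.le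
    have h1 : c < f x a := by
      rw [← hY x hx]; exact hmono x hx (hY0 x hx) ha0 ha
    filter_upwards [self_mem_nhdsWithin,
      mem_nhdsWithin_of_mem_nhds ((hf a).continuousAt.eventually_const_lt h1)] with x' hx' h2
    rw [← hY x' hx'] at h2
    exact ((hmono x' hx').lt_iff_lt (hY0 x' hx') ha0).1 h2

/-- Along the level curve on which the modulus is m!, a graph over [3/2, 2], the argument goes
continuously from more than 2π down to 0. Where it equals 2π the rising product equals m!. -/
theorem exists_indicial_zero {m : ℕ} (hm : 27 ≤ m) :
    ∃ z : ℂ, indicial m z = 0 ∧ 3 / 2 < z.re ∧ z ≠ 2 := by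
  set f : ℝ → ℝ → ℝ := fun x y => ‖risingProd m ((x : ℂ) + y * Complex.I)‖ with hf
  set s : Set ℝ := Set.Icc (3 / 2) 2 with hs
  have hcont : Continuous fun p : ℝ × ℝ => f p.1 p.2 := by
    simp only [hf, risingProd]
    fun_prop
  have hmono : ∀ x ∈ s, StrictMonoOn (f x) (Set.Ici 0) := by
    intro x hx y hy y' hy' hlt
    refine norm_risingProd_lt (by omega) ?_ ?_ ?_ (Or.inr ?_)
    · simp; linarith [hx.1]
    · simp
    · simp; rw [abs_of_nonneg hy, abs_of_nonneg hy']; exact hlt.le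
    · simp; rw [abs_of_nonneg hy, abs_of_nonneg hy']; exact hlt
  have hex : ∀ x ∈ s, ∃ y, 0 ≤ y ∧ f x y = m.factorial := by
    intro x hx
    have h0 : f x 0 ≤ m.factorial := by
      have := norm_risingProd_le m (z := (x : ℂ) + (0 : ℝ) * Complex.I) (w := 2)
        (by simp; linarith [hx.1]) (by simpa using hx.2) (by simp)
      rwa [risingProd_two_complex (by omega), Complex.norm_natCast] at this
    -- At height m! the factor j = 0 has modulus at least m!, and the others have modulus at least
    -- 1.
    have h1 : (m.factorial : ℝ) ≤ f x m.factorial := by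
      simp only [hf]
      obtain ⟨k, rfl⟩ : ∃ k, m = k + 2 := ⟨m - 2, by omega⟩
      rw [risingProd, show k + 2 - 1 = k + 1 by omega, Finset.prod_range_succ', norm_mul, norm_prod]
      have h2 : (1 : ℝ) ≤ ∏ i ∈ Finset.range k, ‖(x : ℂ) + (((k + 2).factorial : ℝ) : ℂ) * Complex.I
          + ((i + 1 : ℕ) : ℂ)‖ := by
        refine Finset.one_le_prod fun i _ => ?_
        refine le_trans ?_ (Complex.re_le_norm _)
        simp
        have : (0 : ℝ) ≤ i := by positivity
        linarith [hx.1]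
      have h3 : ((k + 2).factorial : ℝ) ≤ ‖(x : ℂ) + (((k + 2).factorial : ℝ) : ℂ) * Complex.I
          + ((0 : ℕ) : ℂ)‖ := by
        refine le_trans ?_ (Complex.im_le_norm _)
        simp
      calc ((k + 2).factorial : ℝ) = 1 * ((k + 2).factorial : ℝ) := (one_mul _).symm
        _ ≤ _ := by gcongr
    obtain ⟨y, hy, hy'⟩ := intermediate_value_Icc (show (0 : ℝ) ≤ m.factorial by positivity)
      (f := f x) (hcont.comp (Continuous.prodMk_right x)).continuousOn ⟨h0, h1⟩
    exact ⟨y, hy.1, hy'⟩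
  choose! Y hY0 hY using hex
  have hYc : ContinuousOn Y s :=
    continuous_implicit (fun y => hcont.comp (Continuous.prodMk_left y)) hmono hY0 hY
  set A : ℝ → ℝ := fun x => argSum m ((x : ℂ) + Y x * Complex.I) with hA
  have hAc : ContinuousOn A s := by
    simp only [hA, argSum]
    refine continuousOn_finsetSum _ fun j _ => Real.continuous_arctan.comp_continuousOn ?_
    simp
    refine hYc.div (by fun_prop) fun x hx => ?_
    have : 0 < x + j := by have := hx.1; positivity
    exact this.ne'
  have hA2 : A 2 = 0 := by
    have h2s : (2 : ℝ) ∈ s := by norm_num [hs]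
    have : Y 2 = 0 := by
      refine (hmono 2 h2s).injOn (hY0 2 h2s) (show (0 : ℝ) ≤ 0 from le_rfl) ?_
      rw [hY 2 h2s]
      have h := risingProd_two_complex (m := m) (by omega)
      simp [hf, h]
    simp [hA, argSum, this]
  have h32 : (3 / 2 : ℝ) ∈ s := by norm_num [hs]
  have hA32 : 2 * Real.pi < A (3 / 2) := by
    refine argSum_critical_high.trans_le ?_
    refine argSum_le hm ?_ ?_ ?_ ?_
    · simp
    · simp; norm_num
    · simp; norm_num
    · have h1 : f (3 / 2) (22 / 10) ≤ m.factorial := by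
        have := norm_critical_high hm
        simp only [hf]
        convert this using 4
        norm_num
      rw [← hY _ h32] at h1
      have := ((hmono _ h32).le_iff_le (show (0 : ℝ) ≤ 22 / 10 by norm_num) (hY0 _ h32)).1 h1
      simpa using this
  obtain ⟨x, hx, hxA⟩ := intermediate_value_Icc' (show (3 / 2 : ℝ) ≤ 2 by norm_num) hAc
    (show 2 * Real.pi ∈ Set.Icc (A 2) (A (3 / 2)) from ⟨by rw [hA2]; positivity, hA32.le⟩)
  refine ⟨(x : ℂ) + Y x * Complex.I, ?_, ?_, ?_⟩
  · have h1 := risingProd_polar m (z := (x : ℂ) + Y x * Complex.I) (by simp; linarith [hx.1])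
    have h2 : argSum m ((x : ℂ) + Y x * Complex.I) = 2 * Real.pi := hxA
    have h3 : ‖risingProd m ((x : ℂ) + Y x * Complex.I)‖ = m.factorial := hY x hx
    rw [indicial_eq, h1, h2, h3]
    push_cast
    rw [mul_comm Complex.I, Complex.exp_two_pi_mul_I]
    simp
  · have : x ≠ 3 / 2 := by
      rintro rfl
      rw [hxA] at hA32
      exact lt_irrefl _ hA32
    simp
    exact lt_of_le_of_ne hx.1 this.symm
  · intro h
    have h1 : A x = 0 := by
      simp only [hA, h]
      simp [argSum]
    rw [hxA] at h1
    exact Real.two_pi_pos.ne' h1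

end Existence

end

/-! ### Simplicity of the zeros, partial fractions, and the homogeneous recurrence -/

noncomputable section

section Roots

open Polynomial in
/-- The indicial polynomial. -/
def indicialPoly (m : ℕ) : ℂ[X] :=
  ∏ j ∈ Finset.range (m - 1), (X + C (j : ℂ)) - C (m.factorial : ℂ)

/-- The zeros of the indicial polynomial. -/
def indicialRoots (m : ℕ) : Finset ℂ := (indicialPoly m).roots.toFinset

theorem eval_indicialPoly (m : ℕ) (z : ℂ) : (indicialPoly m).eval z = indicial m z := by
  simp [indicialPoly, indicial, Polynomial.eval_prod]

open Polynomial in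
theorem monic_prod_X_add (m : ℕ) :
    (∏ j ∈ Finset.range (m - 1), (X + C (j : ℂ)) : ℂ[X]).Monic :=
  monic_prod_of_monic _ _ fun _ _ => monic_X_add_C _

open Polynomial in
theorem natDegree_prod_X_add (m : ℕ) :
    (∏ j ∈ Finset.range (m - 1), (X + C (j : ℂ)) : ℂ[X]).natDegree = m - 1 := by
  rw [natDegree_prod_of_monic _ _ fun _ _ => monic_X_add_C _]
  simp only [natDegree_X_add_C]
  simp

theorem natDegree_indicialPoly {m : ℕ} : (indicialPoly m).natDegree = m - 1 := by
  rw [indicialPoly, Polynomial.natDegree_sub_C, natDegree_prod_X_add]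

theorem monic_indicialPoly {m : ℕ} (hm : 2 ≤ m) : (indicialPoly m).Monic := by
  rw [indicialPoly]
  refine (monic_prod_X_add m).sub_of_left ?_
  rw [Polynomial.degree_eq_natDegree (monic_prod_X_add m).ne_zero, natDegree_prod_X_add]
  refine Polynomial.degree_C_le.trans_lt ?_
  exact_mod_cast (by omega : 0 < m - 1)

theorem mem_indicialRoots {m : ℕ} (hm : 2 ≤ m) {z : ℂ} :
    z ∈ indicialRoots m ↔ indicial m z = 0 := by
  rw [indicialRoots, Multiset.mem_toFinset, Polynomial.mem_roots (monic_indicialPoly hm).ne_zero,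
    Polynomial.IsRoot.def, eval_indicialPoly]

/-- Bounds the rising product by (m-1)! < m! at real points of [-(m-2), 0], so that Λ has no zero
there. -/
theorem prod_abs_sub_le (n : ℕ) {t : ℝ} (h0 : 0 ≤ t) (hn : t ≤ n) :
    ∏ j ∈ Finset.range (n + 1), |t - j| ≤ (n + 1).factorial := by
  induction n with
  | zero =>
    have : t = 0 := le_antisymm (by simpa using hn) h0
    simp [this]
  | succ n ih =>
    rw [Finset.prod_range_succ]
    push_cast at hn
    by_cases h : t ≤ n
    · rw [Nat.factorial_succ (n + 1), mul_comm (n + 1 + 1)]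
      push_cast
      refine mul_le_mul (by exact_mod_cast ih h) ?_ (abs_nonneg _) (by positivity)
      rw [abs_le]; constructor <;> linarith
    -- For t between n and n + 1 the factors are bounded in reverse order by n + 1 - j, and the last
    -- factor is at most 1.
    · rw [not_le] at h
      have h1 : ∏ j ∈ Finset.range (n + 1), |t - j| ≤ (n + 1).factorial := by
        rw [← Finset.prod_range_add_one_eq_factorial, ← Finset.prod_range_reflect]
        push_cast
        refine Finset.prod_le_prod (fun _ _ => abs_nonneg _) fun j hj => ?_
        rw [Finset.mem_range] at hj
        have : (j : ℝ) ≤ n := by exact_mod_cast (by omega : j ≤ n)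
        rw [Nat.cast_sub (by omega)]
        rw [abs_le]; constructor <;> linarith
      have h2 : |t - (n + 1 : ℕ)| ≤ 1 := by
        push_cast; rw [abs_le]; constructor <;> linarith
      have h3 : ((n + 1).factorial : ℝ) ≤ (n + 1 + 1).factorial := by
        exact_mod_cast Nat.factorial_le (by omega)
      calc _ ≤ ((n + 1).factorial : ℝ) * 1 := by
            exact mul_le_mul h1 h2 (abs_nonneg _) (by positivity)
        _ ≤ _ := by linarith

/-- The zeros of the indicial polynomial are simple. -/
theorem harmSum_ne_zero_of_indicial {m : ℕ} (hm : 3 ≤ m) {z : ℂ} (h : indicial m z = 0) :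
    harmSum z (m - 1) ≠ 0 := by
  intro h0
  have hP : risingProd m z = m.factorial := by rwa [indicial_eq, sub_eq_zero] at h
  have hne : ∀ j ∈ Finset.range (m - 1), z + (j : ℂ) ≠ 0 := by
    rw [← Finset.prod_ne_zero_iff]
    have : risingProd m z ≠ 0 := by
      rw [hP]; exact_mod_cast m.factorial_ne_zero
    exact this
  have hnsq : ∀ j ∈ Finset.range (m - 1), 0 < Complex.normSq (z + j) := fun j hj =>
    Complex.normSq_pos.2 (hne j hj)
  have hmem : 0 ∈ Finset.range (m - 1) := Finset.mem_range.2 (by omega)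
  -- The imaginary part of ∑ 1/(z+j) is -Im z ∑ 1/|z+j|^2, so a multiple zero would be real. To the
  -- right of 0 or to the left of -(m-2) all terms have one sign, and in between |Λ + m!| is too
  -- small.
  have him : z.im = 0 := by
    have h1 := congrArg Complex.im h0
    simp only [harmSum, one_div, Complex.im_sum, Complex.inv_im, Complex.zero_im, Complex.add_im,
      Complex.natCast_im, add_zero] at h1
    simp only [div_eq_mul_inv, ← Finset.mul_sum] at h1
    rcases mul_eq_zero.1 h1 with h2 | h2
    · linarith
    · have : 0 < ∑ j ∈ Finset.range (m - 1), (Complex.normSq (z + j))⁻¹ :=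
        Finset.sum_pos (fun j hj => inv_pos.2 (hnsq j hj)) ⟨0, hmem⟩
      linarith
  have hz : z = (z.re : ℂ) := Complex.ext (by simp) (by simp [him])
  have h1 := congrArg Complex.re h0
  simp only [harmSum, one_div, Complex.re_sum, Complex.inv_re, Complex.zero_re, Complex.add_re,
    Complex.natCast_re] at h1
  by_cases hpos : 0 < z.re
  · have : 0 < ∑ j ∈ Finset.range (m - 1), (z.re + j) / Complex.normSq (z + j) :=
      Finset.sum_pos (fun j hj => div_pos (by positivity) (hnsq j hj)) ⟨0, hmem⟩
    linarith
  by_cases hneg : z.re < -((m : ℝ) - 2)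
  · have : ∑ j ∈ Finset.range (m - 1), (z.re + j) / Complex.normSq (z + j) < 0 := by
      refine Finset.sum_neg (fun j hj => div_neg_of_neg_of_pos ?_ (hnsq j hj)) ⟨0, hmem⟩
      rw [Finset.mem_range] at hj
      have : (j : ℝ) + 2 ≤ m := by exact_mod_cast (by omega : j + 2 ≤ m)
      linarith
    linarith
  · rw [not_lt] at hpos hneg
    have h2 := norm_risingProd_of_indicial_eq_zero h
    rw [hz, risingProd, norm_prod] at h2
    obtain ⟨n, rfl⟩ : ∃ n, m = n + 2 := ⟨m - 2, by omega⟩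
    have h3 := prod_abs_sub_le n (t := -z.re) (by linarith) (by push_cast at hneg; linarith)
    have h4 : ∀ j ∈ Finset.range (n + 1), ‖((z.re : ℂ) + j)‖ = |-z.re - j| := by
      intro j _
      rw [← Complex.ofReal_natCast, ← Complex.ofReal_add, Complex.norm_real, Real.norm_eq_abs,
        ← abs_neg]
      congr 1; ring
    rw [show n + 2 - 1 = n + 1 by omega, Finset.prod_congr rfl h4] at h2
    have h5 : ((n + 1).factorial : ℝ) < (n + 2).factorial := by
      exact_mod_cast Nat.factorial_lt_of_lt (by omega) (by omega)
    linarith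

theorem hasDerivAt_indicial {m : ℕ} {z : ℂ} (h : risingProd m z ≠ 0) :
    HasDerivAt (indicial m) (risingProd m z * harmSum z (m - 1)) z :=
  (hasDerivAt_risingProd_of_ne_zero h).sub_const _

theorem eval_derivative_indicialPoly {m : ℕ} {z : ℂ} (h : risingProd m z ≠ 0) :
    (Polynomial.derivative (indicialPoly m)).eval z = risingProd m z * harmSum z (m - 1) := by
  refine ((indicialPoly m).hasDerivAt z).unique ?_
  have : (fun x => (indicialPoly m).eval x) = indicial m := by
    funext x; exact eval_indicialPoly m x
  rw [this]
  exact hasDerivAt_indicial h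

theorem nodup_roots_indicialPoly {m : ℕ} (hm : 3 ≤ m) : (indicialPoly m).roots.Nodup := by
  refine Polynomial.nodup_roots ?_
  have hm0 : (m.factorial : ℂ) ≠ 0 := by exact_mod_cast m.factorial_ne_zero
  rw [Polynomial.separable_def, Polynomial.isCoprime_iff_aeval_ne_zero_of_isAlgClosed ℂ ℂ]
  intro z
  by_contra! hz
  simp only [Polynomial.coe_aeval_eq_eval] at hz
  have h1 : indicial m z = 0 := by rw [← eval_indicialPoly]; exact hz.1
  have hP : risingProd m z = m.factorial := by rwa [indicial_eq, sub_eq_zero] at h1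
  have h2 := hz.2
  rw [eval_derivative_indicialPoly (hP ▸ hm0), hP] at h2
  exact (mul_ne_zero hm0 (harmSum_ne_zero_of_indicial hm h1)) h2

theorem card_indicialRoots {m : ℕ} (hm : 3 ≤ m) : (indicialRoots m).card = m - 1 := by
  rw [indicialRoots, Multiset.toFinset_card_of_nodup (nodup_roots_indicialPoly hm),
    IsAlgClosed.card_roots_eq_natDegree, natDegree_indicialPoly]

theorem indicialPoly_eq_nodal {m : ℕ} (hm : 3 ≤ m) :
    indicialPoly m = Lagrange.nodal (indicialRoots m) id := by
  have h := Polynomial.prod_multiset_X_sub_C_of_monic_of_roots_card_eq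
    (monic_indicialPoly (m := m) (by omega)) IsAlgClosed.card_roots_eq_natDegree
  rw [← h, Lagrange.nodal, Finset.prod, indicialRoots, Multiset.toFinset_val,
    (nodup_roots_indicialPoly hm).dedup]
  rfl

theorem prod_sub_indicialRoots {m : ℕ} (hm : 3 ≤ m) (z : ℂ) :
    ∏ w ∈ indicialRoots m, (z - w) = indicial m z := by
  rw [← eval_indicialPoly, indicialPoly_eq_nodal hm, Lagrange.eval_nodal]
  rfl

theorem prod_erase_sub_indicialRoots {m : ℕ} (hm : 3 ≤ m) {z : ℂ} (hz : z ∈ indicialRoots m) :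
    ∏ w ∈ (indicialRoots m).erase z, (z - w) = m.factorial * harmSum z (m - 1) := by
  have h1 := (mem_indicialRoots (by omega)).1 hz
  have hP : risingProd m z = m.factorial := by rwa [indicial_eq, sub_eq_zero] at h1
  have h2 := Lagrange.eval_nodal_derivative_eval_node_eq (v := (id : ℂ → ℂ)) hz
  rw [← indicialPoly_eq_nodal hm, id, eval_derivative_indicialPoly
    (hP ▸ (by exact_mod_cast m.factorial_ne_zero)), hP, Lagrange.eval_nodal] at h2
  rw [h2]; rfl

end Roots

section Means

open Polynomial in
/-- `negBinom` as a polynomial in its parameter. -/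
def negBinomPoly (n : ℕ) : ℂ[X] :=
  C ((n.factorial : ℂ)⁻¹) * ∏ k ∈ Finset.range n, (X + C (k : ℂ))

theorem eval_negBinomPoly (n : ℕ) (z : ℂ) : (negBinomPoly n).eval z = negBinom z n := by
  simp [negBinomPoly, negBinom, Polynomial.eval_prod]
  ring

theorem degree_negBinomPoly_le (n : ℕ) : (negBinomPoly n).degree ≤ n := by
  refine Polynomial.degree_le_of_natDegree_le ?_
  refine Polynomial.natDegree_C_mul_le _ _ |>.trans ?_
  exact (natDegree_prod_X_add (n + 1)).le

/-- The partial fraction identity behind the mean of the space requirement. -/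
theorem sum_coeffA_negBinom {m n : ℕ} (hm : 3 ≤ m) (hn : n < m) :
    ∑ z ∈ indicialRoots m, coeffA m z * negBinom z n =
      (if n = 0 then 0 else 1) + 1 / ((m : ℂ) - 1) := by
  have hm0 : (m.factorial : ℂ) ≠ 0 := by exact_mod_cast m.factorial_ne_zero
  have hm1 : (m : ℂ) - 1 ≠ 0 := by
    have : ((m - 1 : ℕ) : ℂ) ≠ 0 := by exact_mod_cast (by omega : m - 1 ≠ 0)
    rwa [Nat.cast_sub (by omega), Nat.cast_one] at this
  have hP0 : indicial m 0 = -(m.factorial : ℂ) := by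
    rw [indicial_eq, risingProd, Finset.prod_eq_zero (Finset.mem_range.2 (by omega : 0 < m - 1))
      (by simp), zero_sub]
  have hP1 : indicial m 1 = -((m : ℂ) - 1) * (m - 1).factorial := by
    have h1 : risingProd m (1 : ℂ) = (m - 1).factorial := by
      rw [risingProd_eq, negBinom_one, mul_one]
    have h2 : (m.factorial : ℂ) = m * (m - 1).factorial := by
      exact_mod_cast (Nat.mul_factorial_pred (by omega)).symm
    rw [indicial_eq, h1, h2]; ring
  have hf1 : ((m - 1).factorial : ℂ) ≠ 0 := by exact_mod_cast (m - 1).factorial_ne_zero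
  have h0S : (0 : ℂ) ∉ indicialRoots m := by
    rw [mem_indicialRoots (by omega), hP0]; exact neg_ne_zero.2 hm0
  have h1S : (1 : ℂ) ∉ indicialRoots m := by
    rw [mem_indicialRoots (by omega), hP1]; exact mul_ne_zero (neg_ne_zero.2 hm1) hf1
  -- Lagrange interpolation on the m + 1 zeros of z(z-1)Λ(z): a polynomial of degree n < m has
  -- vanishing divided difference. The weight at a zero of Λ is A(z)/m!, because Λ' = m! ∑ 1/(z+j)
  -- there; the nodes 0 and 1 give the right-hand side.
  set T := insert 0 (insert 1 (indicialRoots m)) with hT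
  have h0T : (0 : ℂ) ∉ insert 1 (indicialRoots m) := by simp [h0S]
  have hcard : T.card = m + 1 := by
    rw [hT, Finset.card_insert_of_notMem h0T, Finset.card_insert_of_notMem h1S,
      card_indicialRoots hm]
    omega
  have hdeg : (negBinomPoly n).degree < m := (degree_negBinomPoly_le n).trans_lt (by exact_mod_cast hn)
  have key := Lagrange.coeff_eq_sum (s := T) (v := id) Function.injective_id.injOn
    (P := negBinomPoly n) (by rw [hcard]; exact hdeg.trans (by exact_mod_cast Nat.lt_succ_self m))
  rw [hcard, Nat.add_sub_cancel, Polynomial.coeff_eq_zero_of_degree_lt hdeg, hT,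
    Finset.sum_insert h0T, Finset.sum_insert h1S] at key
  simp only [id, eval_negBinomPoly] at key
  have e0 : ∏ j ∈ (insert 0 (insert 1 (indicialRoots m))).erase 0, ((0 : ℂ) - j) =
      m.factorial := by
    rw [Finset.erase_insert h0T, Finset.prod_insert h1S, prod_sub_indicialRoots hm, hP0]
    ring
  have e1 : ∏ j ∈ (insert 0 (insert 1 (indicialRoots m))).erase 1, ((1 : ℂ) - j) =
      -((m : ℂ) - 1) * (m - 1).factorial := by
    rw [Finset.erase_insert_of_ne zero_ne_one, Finset.erase_insert h1S, Finset.prod_insert h0S,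
      prod_sub_indicialRoots hm, hP1]
    ring
  have e2 : ∀ z ∈ indicialRoots m, negBinom z n /
      ∏ j ∈ (insert 0 (insert 1 (indicialRoots m))).erase z, (z - j) =
      coeffA m z * negBinom z n / m.factorial := by
    intro z hz
    have z0 : z ≠ 0 := fun h => h0S (h ▸ hz)
    have z1 : z ≠ 1 := fun h => h1S (h ▸ hz)
    rw [Finset.erase_insert_of_ne z0.symm, Finset.prod_insert (by simp [h0S]),
      Finset.erase_insert_of_ne z1.symm, Finset.prod_insert (by simp [h1S]),
      prod_erase_sub_indicialRoots hm hz, coeffA]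
    have h1 := harmSum_ne_zero_of_indicial hm ((mem_indicialRoots (by omega)).1 hz)
    have h2 : ∑ j ∈ Finset.range (m - 1), 1 / ((j : ℂ) + z) = harmSum z (m - 1) :=
      Finset.sum_congr rfl fun j _ => by rw [add_comm]
    have z1' : z - 1 ≠ 0 := sub_ne_zero.2 z1
    rw [h2]
    field_simp
    ring
  rw [Finset.sum_congr rfl e2, ← Finset.sum_div, e0, e1, negBinom_one] at key
  have h3 : (m.factorial : ℂ) = m * (m - 1).factorial := by
    exact_mod_cast (Nat.mul_factorial_pred (by omega)).symm
  have hmm : (m : ℂ) ≠ 0 := by exact_mod_cast (by omega : m ≠ 0)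
  have hz0 : negBinom (0 : ℂ) n = if n = 0 then 1 else 0 := by
    rcases n with _ | n
    · simp
    · simp [negBinom, Finset.prod_range_succ']
  rw [hz0, h3] at key
  have key2 : ∑ z ∈ indicialRoots m, coeffA m z * negBinom z n =
      (m : ℂ) / (m - 1) - (if n = 0 then 1 else 0) := by
    field_simp at key ⊢
    linear_combination -key
  rw [key2]
  split_ifs <;> field_simp <;> ring

theorem splitSum_congr {𝕜 : Type*} [Field 𝕜] [CharZero 𝕜] {m n : ℕ} (hn : m - 1 ≤ n) {a b : ℕ → 𝕜}
    (h : ∀ k ≤ n - (m - 1), a k = b k) : splitSum m a n = splitSum m b n := by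
  rw [splitSum_eq hn, splitSum_eq hn]
  congr 1
  exact Finset.sum_congr rfl fun p hp => by
    rw [h _ (Finset.HasAntidiagonal.antidiagonal.fst_le hp)]

theorem splitSum_sum {𝕜 ι : Type*} [Field 𝕜] (m : ℕ) (t : Finset ι) (f : ι → ℕ → 𝕜) :
    splitSum m (∑ i ∈ t, f i) = ∑ i ∈ t, splitSum m (f i) := by
  classical
  induction t using Finset.induction_on with
  | empty =>
    have := splitSum_smul m (0 : 𝕜) 0
    simpa using this
  | insert i t hi ih => rw [Finset.sum_insert hi, Finset.sum_insert hi, splitSum_add, ih]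

/-- Two solutions of the recurrence that agree initially agree. -/
theorem eq_of_splitSum {m : ℕ} (hm : 3 ≤ m) {a b : ℕ → ℂ} (h0 : ∀ n < m - 1, a n = b n)
    (h : ∀ n, m - 1 ≤ n → a n - splitSum m a n = b n - splitSum m b n) : a = b := by
  funext n
  induction n using Nat.strong_induction_on with
  | _ n ih =>
    by_cases hn : n < m - 1
    · exact h0 n hn
    · rw [not_lt] at hn
      have h1 := h n hn
      rw [splitSum_congr (b := b) hn fun k hk => ih k (by omega)] at h1
      exact sub_left_injective h1

theorem splitSum_negBinom_root {m n : ℕ} (hm : 2 ≤ m) (hn : m - 1 ≤ n) {z : ℂ}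
    (hz : z ∈ indicialRoots m) : splitSum m (negBinom z) n = negBinom z n := by
  have h1 := (mem_indicialRoots hm).1 hz
  have hP : risingProd m z = m.factorial := by rwa [indicial_eq, sub_eq_zero] at h1
  have hm0 : (m.factorial : ℂ) ≠ 0 := by exact_mod_cast m.factorial_ne_zero
  rw [splitSum_negBinom (by omega) hn (hP ▸ hm0), hP, div_self hm0, one_mul]

/-- Multiplication by z acts through the index: z `negBinom z n` = (n+1) `negBinom z (n+1)` - n
`negBinom z n`. A relation valid for all `n` thus survives multiplication of its coefficients by any
polynomial in z. -/
theorem sum_mul_eval_eq_zero {S : Finset ℂ} {d : ℂ → ℂ}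
    (h : ∀ n, ∑ z ∈ S, d z * negBinom z n = 0) (p : Polynomial ℂ) (n : ℕ) :
    ∑ z ∈ S, d z * p.eval z * negBinom z n = 0 := by
  induction p using Polynomial.induction_on' generalizing n with
  | add p q hp hq =>
    simp only [Polynomial.eval_add, mul_add, add_mul, Finset.sum_add_distrib, hp, hq, add_zero]
  | monomial k a =>
    have key : ∀ n, ∑ z ∈ S, d z * z ^ k * negBinom z n = 0 := by
      induction k with
      | zero => simpa using h
      | succ k ih =>
        intro n
        have h1 : ∀ z ∈ S, d z * z ^ (k + 1) * negBinom z n =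
            ((n : ℂ) + 1) * (d z * z ^ k * negBinom z (n + 1)) - n * (d z * z ^ k * negBinom z n) := by
          intro z _
          linear_combination (-(d z * z ^ k)) * negBinom_succ z n
        rw [Finset.sum_congr rfl h1, Finset.sum_sub_distrib, ← Finset.mul_sum, ← Finset.mul_sum,
          ih, ih]
        simp
    simp only [Polynomial.eval_monomial]
    have h2 : ∀ z ∈ S, d z * (a * z ^ k) * negBinom z n = a * (d z * z ^ k * negBinom z n) :=
      fun z _ => by ring
    rw [Finset.sum_congr rfl h2, ← Finset.mul_sum, key, mul_zero]

/-- The solutions of the homogeneous recurrence. -/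
theorem exists_eq_sum_negBinom {m : ℕ} (hm : 3 ≤ m) (a : ℕ → ℂ)
    (h : ∀ n, m - 1 ≤ n → splitSum m a n = a n) :
    ∃ d : ℂ → ℂ, a = ∑ z ∈ indicialRoots m, d z • negBinom z := by
  have hom : ∀ d : ℂ → ℂ, ∀ n, m - 1 ≤ n →
      splitSum m (∑ z ∈ indicialRoots m, d z • negBinom z) n =
        (∑ z ∈ indicialRoots m, d z • negBinom z) n := by
    intro d n hn
    rw [splitSum_sum, Finset.sum_apply, Finset.sum_apply]
    refine Finset.sum_congr rfl fun z hz => ?_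
    rw [splitSum_smul, Pi.smul_apply, splitSum_negBinom_root (by omega) hn hz, Pi.smul_apply]
  -- Coefficients at the m - 1 zeros are mapped to the m - 1 initial values. The map is bijective,
  -- and the recurrence extends the agreement to all indices.
  let L : (indicialRoots m → ℂ) →ₗ[ℂ] (Fin (m - 1) → ℂ) :=
    { toFun := fun d n => ∑ z : indicialRoots m, d z * negBinom z.1 n
      map_add' := fun d e => by
        funext n; simp [add_mul, Finset.sum_add_distrib]
      map_smul' := fun c d => by
        funext n; simp [Finset.mul_sum, mul_assoc] }
  have hext : ∀ (d : indicialRoots m → ℂ) (n : ℕ), ∑ z : indicialRoots m, d z * negBinom z.1 n =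
      (∑ z ∈ indicialRoots m,
        (fun z => if hz : z ∈ indicialRoots m then d ⟨z, hz⟩ else 0) z • negBinom z) n := by
    intro d n
    rw [Finset.sum_apply, ← Finset.sum_coe_sort (indicialRoots m)]
    refine Finset.sum_congr rfl fun z _ => ?_
    simp
  have hinj : Function.Injective L := by
    rw [injective_iff_map_eq_zero]
    intro d hd
    set D : ℂ → ℂ := fun z => if hz : z ∈ indicialRoots m then d ⟨z, hz⟩ else 0 with hD
    have hzero : (∑ z ∈ indicialRoots m, D z • negBinom z) = 0 := by
      refine eq_of_splitSum hm (fun n hn => ?_) fun n hn => ?_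
      · have := congrFun hd ⟨n, hn⟩
        have h2 : ∑ z : indicialRoots m, d z * negBinom z.1 n = 0 := this
        rw [hext] at h2
        exact h2
      · rw [hom D n hn]
        have := splitSum_smul m (0 : ℂ) 0
        rw [zero_smul, zero_smul] at this
        rw [this]; simp
    have hz2 : ∀ n, ∑ z ∈ indicialRoots m, D z * negBinom z n = 0 := by
      intro n
      have := congrFun hzero n
      simpa [Finset.sum_apply] using this
    funext ⟨w, hw⟩
    -- The polynomial vanishing at all zeros but `w` isolates the coefficient at `w`, read off at
    -- index 0 where `negBinom` is 1.
    have h3 := sum_mul_eval_eq_zero hz2 (Lagrange.nodal ((indicialRoots m).erase w) id) 0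
    rw [Finset.sum_eq_single w] at h3
    · simp only [negBinom_zero, mul_one, Lagrange.eval_nodal, id] at h3
      rcases mul_eq_zero.1 h3 with h4 | h4
      · simpa [hD, hw] using h4
      · rw [Finset.prod_eq_zero_iff] at h4
        obtain ⟨v, hv, hv2⟩ := h4
        exact absurd (sub_eq_zero.1 hv2).symm (Finset.ne_of_mem_erase hv)
    · intro z hz hzw
      rw [Lagrange.eval_nodal, Finset.prod_eq_zero (Finset.mem_erase.2 ⟨hzw, hz⟩) (by simp)]
      simp
    · intro h; exact absurd hw h
  have hsurj : Function.Surjective L :=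
    (LinearMap.injective_iff_surjective_of_finrank_eq_finrank (by
      simp [card_indicialRoots hm])).1 hinj
  obtain ⟨d, hd⟩ := hsurj fun n => a n
  refine ⟨fun z => if hz : z ∈ indicialRoots m then d ⟨z, hz⟩ else 0, ?_⟩
  refine eq_of_splitSum hm (fun n hn => ?_) fun n hn => ?_
  · have := congrFun hd ⟨n, hn⟩
    rw [← hext]
    exact this.symm
  · rw [h n hn, hom _ n hn, sub_self, sub_self]

end Means

end

/-! ### Means of the two functionals and growth estimates -/

noncomputable section

section Means

theorem two_mem_indicialRoots {m : ℕ} (hm : 2 ≤ m) : (2 : ℂ) ∈ indicialRoots m :=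
  (mem_indicialRoots hm).2 (indicial_two (by omega))

theorem conj_mem_indicialRoots {m : ℕ} (hm : 2 ≤ m) {z : ℂ} (hz : z ∈ indicialRoots m) :
    starRingEnd ℂ z ∈ indicialRoots m := by
  rw [mem_indicialRoots hm] at hz ⊢
  rw [indicial_conj, hz, map_zero]

theorem harmSum_two {m : ℕ} (hm : 1 ≤ m) : harmSum 2 (m - 1) = ((harm m - 1 : ℝ) : ℂ) := by
  obtain ⟨k, rfl⟩ : ∃ k, m = k + 1 := ⟨m - 1, by omega⟩
  rw [Nat.add_sub_cancel, harmSum]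
  induction k with
  | zero => simp [harm]
  | succ k ih =>
    have : harm (k + 1 + 1) = harm (k + 1) + 1 / ((k + 1 + 1 : ℕ) : ℝ) := by
      rw [harm, harm, Finset.sum_Icc_succ_top (by omega)]
    rw [Finset.sum_range_succ, ih (by omega), this]
    push_cast
    ring

theorem one_lt_harm {m : ℕ} (hm : 3 ≤ m) : 1 < harm m := by
  rw [harm, ← Finset.add_sum_erase _ _ (Finset.mem_Icc.2 ⟨le_rfl, by omega⟩ :
    1 ∈ Finset.Icc 1 m)]
  have : 0 < ∑ j ∈ (Finset.Icc 1 m).erase 1, 1 / (j : ℝ) := by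
    refine Finset.sum_pos (fun j hj => ?_) ⟨2, by simp; omega⟩
    have := (Finset.mem_Icc.1 (Finset.mem_of_mem_erase hj)).1
    positivity
  simpa using this

theorem occ_pos {m : ℕ} (hm : 3 ≤ m) : 0 < occ m := by
  have := one_lt_harm hm
  rw [occ]
  exact div_pos one_pos (by linarith)

theorem two_mul_occ_mul_harmSum {m : ℕ} (hm : 3 ≤ m) :
    2 * (occ m : ℂ) * harmSum 2 (m - 1) = 1 := by
  rw [harmSum_two (by omega), ← Complex.ofReal_ofNat, ← Complex.ofReal_mul, ← Complex.ofReal_mul,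
    occ]
  have := one_lt_harm hm
  have h : harm m - 1 ≠ 0 := by linarith
  field_simp
  simp

theorem coeffA_two {m : ℕ} (hm : 3 ≤ m) : coeffA m 2 = occ m := by
  have h := two_mul_occ_mul_harmSum hm
  have h2 : ∑ j ∈ Finset.range (m - 1), 1 / ((j : ℂ) + 2) = harmSum 2 (m - 1) :=
    Finset.sum_congr rfl fun j _ => by rw [add_comm]
  rw [coeffA, h2]
  have : harmSum 2 (m - 1) ≠ 0 := fun h0 => by simp [h0] at h
  field_simp
  linear_combination -h

/-- Since A(2) = φ and `negBinom 2 n` = n + 1, the subtracted φ(n+1) is exactly the component at the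
zero 2. The initial values are matched by `sum_coeffA_negBinom`. -/
theorem exists_mean_space {m : ℕ} (hm : 3 ≤ m) :
    ∃ u : ℕ → ℝ, IsMean (centredSpace m) u ∧ (∀ n, m - 1 ≤ n → splitSum m u n = u n) ∧
      (fun n => (u n : ℂ)) = ∑ z ∈ (indicialRoots m).erase 2, coeffA m z • negBinom z := by
  obtain ⟨u, hu, h0, h1⟩ := (isSplitAdditive_centredSpace (show 2 ≤ m by omega)).exists_mean
    (by omega)
  refine ⟨u, hu, fun n hn => by rw [h1 n hn]; simp, ?_⟩
  have key : ∀ n, (∑ z ∈ (indicialRoots m).erase 2, coeffA m z • negBinom z) n =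
      ∑ z ∈ indicialRoots m, coeffA m z * negBinom z n - occ m * (n + 1) := by
    intro n
    rw [← Finset.add_sum_erase _ _ (two_mem_indicialRoots (show 2 ≤ m by omega)), coeffA_two hm,
      negBinom_two, add_sub_cancel_left, Finset.sum_apply]
    rfl
  refine eq_of_splitSum hm (fun n hn => ?_) fun n hn => ?_
  · rw [h0 n hn, key, sum_coeffA_negBinom hm (by omega)]
    push_cast
    split_ifs <;> push_cast <;> ring
  · rw [← ofReal_splitSum hn, h1 n hn, splitSum_sum, Finset.sum_apply, Finset.sum_apply]
    have h2 : ∀ z ∈ (indicialRoots m).erase 2, splitSum m (coeffA m z • negBinom z) n =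
        (coeffA m z • negBinom z) n := fun z hz => by
      rw [splitSum_smul, Pi.smul_apply, splitSum_negBinom_root (by omega) hn
        (Finset.mem_of_mem_erase hz)]; rfl
    rw [Finset.sum_congr rfl h2]
    simp

/-- The toll n + 1 is itself a fixed point of T. This resonance is solved by the parameter
derivative at 2, with factor 2φ = 1/(H_m - 1); it produces the n log n term. The remainder is
homogeneous. -/
theorem exists_mean_path {m : ℕ} (hm : 3 ≤ m) :
    ∃ (d : ℝ) (k : ℕ → ℝ) (e : ℂ → ℂ), IsMean (shiftedPath m d) k ∧
      (∀ n, m - 1 ≤ n → splitSum m k n = k n - (n + 1)) ∧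
      (fun n => (k n : ℂ)) = (2 * (occ m : ℂ)) • negBinomD 2 +
        ∑ z ∈ (indicialRoots m).erase 2, e z • negBinom z := by
  obtain ⟨k0, hk0, h0, h1⟩ := (isSplitAdditive_shiftedPath (show 2 ≤ m by omega) 0).exists_mean
    (by omega)
  have hm0 : (m.factorial : ℂ) ≠ 0 := by exact_mod_cast m.factorial_ne_zero
  obtain ⟨d, hd⟩ := exists_eq_sum_negBinom hm
    ((fun n => (k0 n : ℂ)) - (2 * (occ m : ℂ)) • negBinomD 2) (by
      intro n hn
      rw [splitSum_sub, splitSum_smul, Pi.sub_apply, Pi.sub_apply, Pi.smul_apply, Pi.smul_apply,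
        ← ofReal_splitSum hn, splitSum_negBinomD (by omega) hn (by simp),
        risingProd_two_complex (by omega), div_self hm0, h1 n hn, negBinom_two]
      have := two_mul_occ_mul_harmSum hm
      push_cast
      simp only [smul_eq_mul]
      linear_combination ((n : ℂ) + 1) * this)
  have hreal : ∀ n, starRingEnd ℂ (negBinomD 2 n) = negBinomD 2 n := by
    intro n
    simp [negBinomD, negBinom, harmSum, Complex.conj_ofNat]
  -- Averaging with the conjugate coefficients is allowed since the sequence is real. It makes the
  -- coefficient at 2 real, so the shift `d` can remove it.
  set e : ℂ → ℂ := fun z => (d z + starRingEnd ℂ (d (starRingEnd ℂ z))) / 2 with he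
  have hconj : ∀ n, (k0 n : ℂ) - 2 * occ m * negBinomD 2 n =
      ∑ z ∈ indicialRoots m, e z * negBinom z n := by
    intro n
    have a1 : (k0 n : ℂ) - 2 * occ m * negBinomD 2 n =
        ∑ z ∈ indicialRoots m, d z * negBinom z n := by
      have := congrFun hd n
      simpa [Finset.sum_apply] using this
    have a2 : (k0 n : ℂ) - 2 * occ m * negBinomD 2 n =
        ∑ z ∈ indicialRoots m, starRingEnd ℂ (d (starRingEnd ℂ z)) * negBinom z n := by
      have := congrArg (starRingEnd ℂ) a1
      simp only [map_sub, map_mul, Complex.conj_ofReal, hreal, map_sum, Complex.conj_ofNat] at this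
      rw [this]
      refine Finset.sum_nbij' (starRingEnd ℂ) (starRingEnd ℂ)
        (fun z hz => conj_mem_indicialRoots (by omega) hz)
        (fun z hz => conj_mem_indicialRoots (by omega) hz) (fun z _ => by simp) (fun z _ => by simp)
        fun z _ => ?_
      simp [negBinom]
    have a3 : (k0 n : ℂ) - 2 * occ m * negBinomD 2 n =
        (∑ z ∈ indicialRoots m, d z * negBinom z n +
          ∑ z ∈ indicialRoots m, starRingEnd ℂ (d (starRingEnd ℂ z)) * negBinom z n) / 2 := by
      rw [← a1, ← a2]; ring
    rw [a3, ← Finset.sum_add_distrib, Finset.sum_div]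
    refine Finset.sum_congr rfl fun z _ => ?_
    simp only [he]; ring
  have he2 : e 2 = ((e 2).re : ℂ) := by
    refine (Complex.conj_eq_iff_re.1 ?_).symm
    simp only [he, map_div₀, map_add, Complex.conj_conj, Complex.conj_ofNat]
    ring
  set D := (e 2).re with hD
  set k : ℕ → ℝ := fun n => k0 n - D * (n + 1) with hk
  refine ⟨D, k, e, ?_, ?_, ?_⟩
  · intro α _ s
    have h2 := hk0 α s
    have h3 : ∀ l : List α, shiftedPath m D α l =
        shiftedPath m 0 α l + (-D * (l.length + 1)) := by
      intro l; simp only [shiftedPath]; ring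
    rw [arrAvg_congr rfl (g := fun l => shiftedPath m 0 α l + (-D * (s.card + 1))), arrAvg_add,
      arrAvg_const rfl, h2, hk]
    · ring
    · intro l hl hls
      rw [h3, length_of_toFinset hl hls]
  · intro n hn
    have : k = k0 - D • negBinom 2 := by
      funext n; simp [hk, negBinom_two]
    have hm0' : (m.factorial : ℝ) ≠ 0 := by positivity
    have hP2 := risingProd_two m (by omega)
    rw [this, splitSum_sub, splitSum_smul, Pi.sub_apply, Pi.sub_apply, Pi.smul_apply, Pi.smul_apply,
      splitSum_negBinom (by omega) hn (hP2 ▸ hm0'), hP2, div_self hm0', h1 n hn]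
    ring
  · funext n
    have h4 := hconj n
    rw [← Finset.add_sum_erase _ _ (two_mem_indicialRoots (show 2 ≤ m by omega)), negBinom_two,
      he2] at h4
    rw [Pi.add_apply, Pi.smul_apply, Finset.sum_apply]
    simp only [Pi.smul_apply, smul_eq_mul, hk]
    push_cast
    linear_combination h4

end Means

section Order

theorem isBigO_natCast_rpow {r s : ℝ} (h : r ≤ s) :
    (fun n : ℕ => (n : ℝ) ^ r) =O[atTop] fun n : ℕ => (n : ℝ) ^ s := by
  rcases h.lt_or_eq with h | rfl
  · exact (isLittleO_natCast_rpow h).isBigO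
  · exact Asymptotics.isBigO_refl _ _

/-- For s > -1 the sequence `negBinom (s + 1)` is positive, so the majorant holds at every index, as
the positivity of the splitting operators requires. -/
theorem exists_norm_le_negBinom {a : ℕ → ℂ} {s : ℝ} (hs : -1 < s)
    (h : a =O[atTop] fun n : ℕ => (n : ℝ) ^ s) :
    ∃ C > 0, ∀ n, ‖a n‖ ≤ C * negBinom (s + 1) n := by
  have h1 := isBigO_rpow_negBinom (σ := s + 1) (by linarith)
  rw [add_sub_cancel_right] at h1
  obtain ⟨C, hC, h2⟩ := Asymptotics.bound_of_isBigO_nat_atTop (h.trans h1)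
  refine ⟨C, hC, fun n => ?_⟩
  have hp := negBinom_pos (μ := s + 1) (by linarith) n
  have := h2 (x := n) hp.ne'
  rwa [Real.norm_of_nonneg hp.le] at this

theorem isBigO_negBinom {μ : ℂ} {s : ℝ} (h : μ.re - 1 ≤ s) :
    negBinom μ =O[atTop] fun n : ℕ => (n : ℝ) ^ s :=
  (isBigO_negBinom_rpow μ).trans (isBigO_natCast_rpow h)

theorem isBigO_sum_negBinom {S : Finset ℂ} (c : ℂ → ℂ) {s : ℝ} (h : ∀ z ∈ S, z.re - 1 ≤ s) :
    (∑ z ∈ S, c z • negBinom z) =O[atTop] fun n : ℕ => (n : ℝ) ^ s := by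
  induction S using Finset.induction_on with
  | empty => simp only [Finset.sum_empty]; exact Asymptotics.isBigO_zero _ _
  | insert z S hz ih =>
    rw [Finset.sum_insert hz]
    exact ((isBigO_negBinom (h z (by simp))).const_smul_left (c z)).add
      (ih fun w hw => h w (by simp [hw]))

theorem isBigO_harmSum {w : ℂ} (hw : 0 < w.re) {δ : ℝ} (hδ : 0 < δ) :
    harmSum w =O[atTop] fun n : ℕ => (n : ℝ) ^ δ := by
  have h1 := (tendsto_harmSum_sub_log hw).isBigO_one ℝ
  have h2 : (fun n : ℕ => Complex.log n) =O[atTop] fun n : ℕ => (n : ℝ) ^ δ := by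
    have h3 := (isLittleO_log_rpow_atTop hδ).isBigO.comp_tendsto tendsto_natCast_atTop_atTop
    refine (Asymptotics.isBigO_norm_left.1 (h3.norm_left.congr_left fun n => ?_))
    rw [Function.comp, ← Complex.natCast_log, Complex.norm_real]
  have h4 : (fun _ : ℕ => (1 : ℝ)) =O[atTop] fun n : ℕ => (n : ℝ) ^ δ := by
    simpa using isBigO_natCast_rpow hδ.le
  exact ((h1.trans h4).add h2).congr_left fun n => sub_add_cancel _ _

theorem isBigO_mul_rpow {a b : ℕ → ℂ} {s t r : ℝ} (ha : a =O[atTop] fun n : ℕ => (n : ℝ) ^ s)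
    (hb : b =O[atTop] fun n : ℕ => (n : ℝ) ^ t) (h : s + t ≤ r) :
    (fun n => a n * b n) =O[atTop] fun n : ℕ => (n : ℝ) ^ r := by
  refine (ha.mul hb).trans (Asymptotics.IsBigO.trans ?_ (isBigO_natCast_rpow h))
  refine Asymptotics.IsBigO.of_bound 1 ?_
  filter_upwards [eventually_gt_atTop 0] with n hn
  have : (0 : ℝ) < n := by exact_mod_cast hn
  rw [Real.rpow_add this, one_mul]

theorem isBigO_negBinomD {w : ℂ} (hw : 0 < w.re) {s : ℝ} (h : w.re - 1 < s) :
    negBinomD w =O[atTop] fun n : ℕ => (n : ℝ) ^ s :=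
  isBigO_mul_rpow (isBigO_negBinom (μ := w) le_rfl) (isBigO_harmSum hw (sub_pos.2 h)) (by linarith)

theorem isBigO_natCast_add_one : (fun n : ℕ => (n : ℂ) + 1) =O[atTop] fun n : ℕ => (n : ℝ) ^ (1 : ℝ) := by
  have := isBigO_negBinom (μ := 2) (s := 1) (by simp; norm_num)
  exact this.congr_left fun n => negBinom_two n

/-- Both arguments are majorised by multiples of `negBinom`, for which the operator is explicit. -/
theorem isBigO_splitPair {m : ℕ} (hm : 2 ≤ m) {a b : ℕ → ℂ} {s t r : ℝ} (hs : -1 < s) (ht : -1 < t)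
    (hst : -1 < s + t) (ha : a =O[atTop] fun n : ℕ => (n : ℝ) ^ s)
    (hb : b =O[atTop] fun n : ℕ => (n : ℝ) ^ t) (h : s + t ≤ r) :
    splitPair m a b =O[atTop] fun n : ℕ => (n : ℝ) ^ r := by
  obtain ⟨C, hC, h1⟩ := exists_norm_le_negBinom hs ha
  obtain ⟨C', hC', h2⟩ := exists_norm_le_negBinom ht hb
  have hP : risingProd m (s + t + 1) ≠ 0 :=
    (Finset.prod_pos fun j _ => by
      have : 0 < s + t + 1 := by linarith
      positivity).ne'
  have h3 : ∀ᶠ n in atTop, ‖splitPair m a b n‖ ≤ C * C' * (((m : ℝ) - 1) *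
      (m.factorial / risingProd m (s + t + 1) * negBinom (s + t + 1) n)) := by
    filter_upwards [eventually_ge_atTop (m - 1)] with n hn
    refine (norm_splitPair_le (by omega) hn h1 h2).trans (le_of_eq ?_)
    have e1 : (fun n => C * negBinom (s + 1) n) = C • negBinom (s + 1) := rfl
    have e2 : (fun n => C' * negBinom (t + 1) n) = C' • negBinom (t + 1) := rfl
    rw [e1, e2, splitPair_smul_left, splitPair_smul_right, Pi.smul_apply, Pi.smul_apply,
      splitPair_negBinom hm, show s + 1 + (t + 1) - 1 = s + t + 1 by ring,
      splitSum_negBinom (by omega) hn hP]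
    simp only [smul_eq_mul]
    ring
  have h4 : negBinom (s + t + 1) =O[atTop] fun n : ℕ => (n : ℝ) ^ (s + t) := by
    have := isBigO_negBinom (μ := ((s + t + 1 : ℝ) : ℂ)) (s := s + t) (by simp)
    refine Asymptotics.isBigO_norm_left.1 (this.norm_left.congr_left fun n => ?_)
    rw [← ofReal_negBinom, Complex.norm_real]
  refine (Asymptotics.IsBigO.trans ?_ h4).trans (isBigO_natCast_rpow h)
  refine Asymptotics.IsBigO.of_bound
    (C * C' * (((m : ℝ) - 1) * |m.factorial / risingProd m (s + t + 1)|)) ?_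
  filter_upwards [h3] with n hn
  refine hn.trans ?_
  have hm1 : (0 : ℝ) ≤ (m : ℝ) - 1 := by
    have : (2 : ℝ) ≤ m := by exact_mod_cast hm
    linarith
  have := negBinom_nonneg (μ := s + t + 1) (by linarith) n
  rw [Real.norm_of_nonneg this]
  have h5 := le_abs_self ((m.factorial : ℝ) / risingProd m (s + t + 1))
  calc _ ≤ C * C' * (((m : ℝ) - 1) *
      (|m.factorial / risingProd m (s + t + 1)| * negBinom (s + t + 1) n)) := by gcongr
    _ = _ := by ring

/-- The transfer of asymptotic expansions from the toll to the solution of the recurrence. -/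
theorem isLittleO_sub_of_splitSum {m : ℕ} (hm : 3 ≤ m) {a p b b' : ℕ → ℂ} {s : ℝ} (hs : 1 < s)
    (ha : ∀ᶠ n in atTop, a n - splitSum m a n = b n)
    (hp : ∀ᶠ n in atTop, p n - splitSum m p n = b' n)
    (h : (fun n => b n - b' n) =o[atTop] fun n : ℕ => (n : ℝ) ^ s) :
    (fun n => a n - p n) =o[atTop] fun n : ℕ => (n : ℝ) ^ s := by
  refine isLittleO_of_sub_splitSum hm hs (h.congr' ?_ (EventuallyEq.refl _ _))
  filter_upwards [ha, hp] with n h1 h2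
  have : (fun n => a n - p n) = a - p := rfl
  rw [← h1, ← h2, this, splitSum_sub, Pi.sub_apply]
  ring

end Order

end

/-! ### The system of first and second moments, and expansions in powers of n -/

noncomputable section

/-- The properties of the means `u, k, q, c, r` of the centred space requirement, of the shifted
key path length, and of their products; `e` holds the coefficients of the homogeneous part of
`k`. -/
structure IsMomentSystem (m : ℕ) (u k q c r : ℕ → ℝ) (e : ℂ → ℂ) : Prop where
  variance_space : ∀ n, Var[spaceReq m n; permMeasure n] = q n - u n * u n
  covariance : ∀ n, cov[spaceReq m n, keyPath m n; permMeasure n] = c n - u n * k n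
  variance_path : ∀ n, Var[keyPath m n; permMeasure n] = r n - k n * k n
  splitSum_space : ∀ n, m - 1 ≤ n → splitSum m u n = u n
  space_sq : ∀ n, m - 1 ≤ n → q n = splitSum m q n + splitPair m u u n
  space_mul_path : ∀ n, m - 1 ≤ n →
    c n = splitSum m c n + (splitPair m u k n + (n + 1) * u n)
  path_sq : ∀ n, m - 1 ≤ n →
    r n = splitSum m r n + (splitPair m k k n + 2 * (n + 1) * k n - (n + 1) ^ 2)
  space_eq : (fun n => (u n : ℂ)) = ∑ z ∈ (indicialRoots m).erase 2, coeffA m z • negBinom z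
  path_eq : (fun n => (k n : ℂ)) = (2 * (occ m : ℂ)) • negBinomD 2 +
    ∑ z ∈ (indicialRoots m).erase 2, e z • negBinom z

theorem exists_isMomentSystem {m : ℕ} (hm : 3 ≤ m) :
    ∃ (u k q c r : ℕ → ℝ) (e : ℂ → ℂ), IsMomentSystem m u k q c r e := by
  obtain ⟨u, hu, hu1, hu2⟩ := exists_mean_space hm
  obtain ⟨d, k, e, hk, hk1, hk2⟩ := exists_mean_path hm
  have hS := isSplitAdditive_centredSpace (show 2 ≤ m by omega)
  have hK := isSplitAdditive_shiftedPath (show 2 ≤ m by omega) d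
  obtain ⟨q, hq, -, hq1⟩ := hS.exists_mean_mul (by omega) hS hu hu
  obtain ⟨c, hc, -, hc1⟩ := hS.exists_mean_mul (by omega) hK hu hk
  obtain ⟨r, hr, -, hr1⟩ := hK.exists_mean_mul (by omega) hK hk hk
  refine ⟨u, k, q, c, r, e, variance_spaceReq hu hq, covariance_spaceReq_keyPath hu hk hc,
    variance_keyPath hk hr, hu1, fun n hn => ?_, fun n hn => ?_, fun n hn => ?_, hu2, hk2⟩
  · rw [hq1 n hn]; simp
  · rw [hc1 n hn, hu1 n hn]; simp
  · rw [hr1 n hn, hk1 n hn]; ring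

section Tolls

variable {m n : ℕ}

/-- The solution of the recurrence with toll `splitSum (negBinom w)`. -/
theorem solve_splitSum_negBinom (hm : 1 ≤ m) (hn : m - 1 ≤ n) {w : ℂ} (hP : risingProd m w ≠ 0)
    (h : indicial m w ≠ 0) :
    ((m.factorial / indicial m w) • negBinom w) n -
      splitSum m ((m.factorial / indicial m w) • negBinom w) n = splitSum m (negBinom w) n := by
  rw [splitSum_smul, Pi.smul_apply, Pi.smul_apply, splitSum_negBinom hm hn hP, indicial_eq]
  rw [indicial_eq] at h
  simp only [smul_eq_mul]
  field_simp

theorem risingProd_add_one (hm : 1 ≤ m) (w : ℂ) :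
    w * risingProd m (w + 1) = risingProd m w * (w + m - 1) := by
  obtain ⟨k, rfl⟩ : ∃ k, m = k + 1 := ⟨m - 1, by omega⟩
  have h : (∏ j ∈ Finset.range k, (w + 1 + j)) * w = (∏ j ∈ Finset.range k, (w + j)) * (w + k) := by
    rw [← Finset.prod_range_succ, Finset.prod_range_succ']
    congr 1
    · exact Finset.prod_congr rfl fun j _ => by push_cast; ring
    · simp
  rw [risingProd, risingProd, Nat.add_sub_cancel, mul_comm, h]
  push_cast
  ring

end Tolls

section Expansion

theorem norm_natCast_cpow {n : ℕ} (hn : 0 < n) (w : ℂ) : ‖(n : ℂ) ^ w‖ = (n : ℝ) ^ w.re := by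
  rw [← Complex.ofReal_natCast, Complex.norm_cpow_eq_rpow_re_of_pos (by exact_mod_cast hn)]

theorem isBigO_natCast_cpow {w : ℂ} {s : ℝ} (h : w.re ≤ s) :
    (fun n : ℕ => (n : ℂ) ^ w) =O[atTop] fun n : ℕ => (n : ℝ) ^ s := by
  refine Asymptotics.IsBigO.trans ?_ (isBigO_natCast_rpow h)
  refine Asymptotics.IsBigO.of_bound 1 ?_
  filter_upwards [eventually_gt_atTop 0] with n hn
  rw [norm_natCast_cpow hn, one_mul, Real.norm_of_nonneg (by positivity)]

theorem isLittleO_of_tendsto_div_cpow {a : ℕ → ℂ} {w c : ℂ}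
    (h : Tendsto (fun n : ℕ => a n / (n : ℂ) ^ w) atTop (𝓝 c)) :
    (fun n : ℕ => a n - c * (n : ℂ) ^ w) =o[atTop] fun n : ℕ => (n : ℝ) ^ w.re := by
  have h1 : (fun n : ℕ => a n / (n : ℂ) ^ w - c) =o[atTop] fun _ : ℕ => (1 : ℝ) := by
    rw [Asymptotics.isLittleO_one_iff]
    simpa using h.sub_const c
  refine (h1.mul_isBigO (isBigO_natCast_cpow (w := w) le_rfl)).congr' ?_ (by simp)
  filter_upwards [eventually_gt_atTop 0] with n hn
  have : (n : ℂ) ^ w ≠ 0 := by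
    rw [← norm_pos_iff, norm_natCast_cpow hn]
    have : (0 : ℝ) < n := by exact_mod_cast hn
    positivity
  field_simp

theorem isLittleO_negBinom_sub_cpow (w : ℂ) :
    (fun n : ℕ => negBinom w n - (Complex.Gamma w)⁻¹ * (n : ℂ) ^ (w - 1)) =o[atTop]
      fun n : ℕ => (n : ℝ) ^ (w.re - 1) := by
  simpa using isLittleO_of_tendsto_div_cpow (tendsto_negBinom_div_cpow w)

theorem isLittleO_mul_rpow {a b : ℕ → ℂ} {s t : ℝ} (ha : a =o[atTop] fun n : ℕ => (n : ℝ) ^ s)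
    (hb : b =O[atTop] fun n : ℕ => (n : ℝ) ^ t) :
    (fun n => a n * b n) =o[atTop] fun n : ℕ => (n : ℝ) ^ (s + t) := by
  refine (ha.mul_isBigO hb).congr' (EventuallyEq.refl _ _) ?_
  filter_upwards [eventually_gt_atTop 0] with n hn
  have : (0 : ℝ) < n := by exact_mod_cast hn
  rw [Real.rpow_add this]

theorem isLittleO_of_isBigO_lt {a : ℕ → ℂ} {s t : ℝ} (ha : a =O[atTop] fun n : ℕ => (n : ℝ) ^ s)
    (h : s < t) : a =o[atTop] fun n : ℕ => (n : ℝ) ^ t :=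
  ha.trans_isLittleO (isLittleO_natCast_rpow h)

theorem isLittleO_negBinom_mul_negBinom_sub_cpow (w v : ℂ) :
    (fun n : ℕ => negBinom w n * negBinom v n -
      (Complex.Gamma w * Complex.Gamma v)⁻¹ * (n : ℂ) ^ (w + v - 2)) =o[atTop]
      fun n : ℕ => (n : ℝ) ^ (w.re + v.re - 2) := by
  have h1 := isLittleO_mul_rpow (isLittleO_negBinom_sub_cpow w) (isBigO_negBinom_rpow v)
  have h2 := isLittleO_mul_rpow (isLittleO_negBinom_sub_cpow v)
    ((isBigO_natCast_cpow (w := w - 1) (s := w.re - 1) (by simp)).const_mul_left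
      (Complex.Gamma w)⁻¹)
  rw [show w.re - 1 + (v.re - 1) = w.re + v.re - 2 by ring] at h1
  rw [show v.re - 1 + (w.re - 1) = w.re + v.re - 2 by ring] at h2
  refine (h1.add h2).congr' ?_ (EventuallyEq.refl _ _)
  filter_upwards [eventually_gt_atTop 0] with n hn
  have hn' : (n : ℂ) ≠ 0 := by exact_mod_cast hn.ne'
  rw [show w + v - 2 = (v - 1) + (w - 1) by ring, Complex.cpow_add _ _ hn', mul_inv]
  ring

end Expansion

end

/-! ### Expansion of the variance of the space requirement -/

noncomputable section

section SpaceVariance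

theorem indicial_ne_zero_of_two_lt_re {m : ℕ} (hm : 2 ≤ m) {w : ℂ} (hw : 2 < w.re) :
    indicial m w ≠ 0 := by
  intro h
  have h2 : w ≠ 2 := by rintro rfl; simp at hw
  linarith [re_lt_two_of_indicial hm h h2]

theorem Gamma_add_sub_one (m : ℕ) (hm : 1 ≤ m) {w : ℂ} (hw : 0 < w.re) :
    Complex.Gamma (w + m - 1) = risingProd m w * Complex.Gamma w := by
  obtain ⟨k, rfl⟩ : ∃ k, m = k + 1 := ⟨m - 1, by omega⟩
  rw [risingProd, Nat.add_sub_cancel]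
  push_cast
  rw [add_sub_assoc, add_sub_cancel_right]
  induction k with
  | zero => simp
  | succ k ih =>
    push_cast
    rw [← add_assoc, Complex.Gamma_add_one _ (add_natCast_ne_zero hw k), ih (by omega),
      Finset.prod_range_succ]
    ring

/-- The coefficient of `n ^ (w + v - 2)` contributed to the variance by the pair `w, v`. -/
def pairCoeff (m : ℕ) (w v : ℂ) : ℂ :=
  (Complex.Gamma w * Complex.Gamma v)⁻¹ * (-1 + (m.factorial : ℂ) * ((m : ℂ) - 1) *
    (Complex.Gamma w * Complex.Gamma v) / (Complex.Gamma (w + v + m - 2) -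
      (m.factorial : ℂ) * Complex.Gamma (w + v - 1)))

variable {m : ℕ}

/-- Γ(x + m - 1) is the rising product at x times Γ(x); with x = w + v - 1 the gamma quotient of F_1
becomes the factor m!/Λ(x) from the solved recurrence. -/
theorem pairCoeff_eq (hm : 2 ≤ m) {w v : ℂ} (hw : 0 < w.re) (hv : 0 < v.re)
    (h : 3 < (w + v).re) : pairCoeff m w v =
      ((m : ℂ) - 1) * (m.factorial / indicial m (w + v - 1)) * (Complex.Gamma (w + v - 1))⁻¹ -
        (Complex.Gamma w * Complex.Gamma v)⁻¹ := by
  have h0 : 2 < (w + v - 1).re := by rw [Complex.sub_re, Complex.one_re]; linarith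
  have h1 := Gamma_add_sub_one m (by omega) (w := w + v - 1) (by linarith)
  have h2 := indicial_ne_zero_of_two_lt_re hm h0
  rw [pairCoeff, show w + v + m - 2 = w + v - 1 + m - 1 by ring, h1, ← sub_mul,
    ← indicial_eq]
  have g1 := Complex.Gamma_ne_zero_of_re_pos hw
  have g2 := Complex.Gamma_ne_zero_of_re_pos hv
  have g3 := Complex.Gamma_ne_zero_of_re_pos (s := w + v - 1) (by linarith)
  field_simp
  ring

theorem isLittleO_pair (hm : 2 ≤ m) {w v : ℂ} {s : ℝ} (hw : 0 < w.re) (hv : 0 < v.re)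
    (h : 3 < (w + v).re) (hs : w.re + v.re - 2 = s) :
    (fun n => (((m : ℂ) - 1) * (m.factorial / indicial m (w + v - 1))) * negBinom (w + v - 1) n -
      negBinom w n * negBinom v n - pairCoeff m w v * (n : ℂ) ^ (w + v - 2)) =o[atTop]
        fun n : ℕ => (n : ℝ) ^ s := by
  have h1 := (isLittleO_negBinom_sub_cpow (w + v - 1)).const_mul_left
    (((m : ℂ) - 1) * (m.factorial / indicial m (w + v - 1)))
  have h2 := isLittleO_negBinom_mul_negBinom_sub_cpow w v
  rw [hs] at h2
  rw [show (w + v - 1).re - 1 = s by rw [← hs]; simp; ring,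
    show w + v - 1 - 1 = w + v - 2 by ring] at h1
  refine (h1.sub h2).congr_left fun n => ?_
  rw [pairCoeff_eq hm hw hv h]
  ring

theorem splitPair_comb (a b : ℂ) (x y : ℕ → ℂ) :
    splitPair m (a • x + b • y) (a • x + b • y) =
      (a * a) • splitPair m x x + (2 * (a * b)) • splitPair m x y + (b * b) • splitPair m y y := by
  rw [splitPair_add_left, splitPair_add_right, splitPair_add_right]
  simp only [splitPair_smul_left, splitPair_smul_right, splitPair_comm m y x]
  module

/-- The leading toll is a combination of T `negBinom` at w+w-1, w+v-1, v+v-1, solved exactly in `p`.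
As σ > 3/2, these points have real part above 2, where Λ has no zero, and 2σ - 2 > 1, so the errors
transfer. -/
theorem isLittleO_variance_space (hm : 3 ≤ m) {u q k c r : ℕ → ℝ} {e : ℂ → ℂ}
    (H : IsMomentSystem m u k q c r e) {w v a b : ℂ} {σ s : ℝ} {E : ℕ → ℂ}
    (hw : w.re = σ) (hv : v.re = σ) (hσ : 3 / 2 < σ) (hs : s < σ - 1) (hs0 : 0 ≤ s)
    (hu : (fun n => (u n : ℂ)) = a • negBinom w + b • negBinom v + E)
    (hE : E =O[atTop] fun n : ℕ => (n : ℝ) ^ s) :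
    (fun n => ((q n - u n * u n : ℝ) : ℂ) - (a * a * (pairCoeff m w w * (n : ℂ) ^ (w + w - 2)) +
      2 * (a * b) * (pairCoeff m w v * (n : ℂ) ^ (w + v - 2)) +
      b * b * (pairCoeff m v v * (n : ℂ) ^ (v + v - 2)))) =o[atTop]
        fun n : ℕ => (n : ℝ) ^ (2 * σ - 2) := by
  set X : ℕ → ℂ := a • negBinom w + b • negBinom v with hX
  have hXO : X =O[atTop] fun n : ℕ => (n : ℝ) ^ (σ - 1) :=
    ((isBigO_negBinom (by rw [hw])).const_smul_left a).add
      ((isBigO_negBinom (by rw [hv])).const_smul_left b)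
  have hUO : (fun n => (u n : ℂ)) =O[atTop] fun n : ℕ => (n : ℝ) ^ (σ - 1) := by
    rw [hu]; exact hXO.add (hE.trans (isBigO_natCast_rpow hs.le))
  have re1 : 2 < (w + w - 1).re := by simp [hw]; linarith
  have re2 : 2 < (w + v - 1).re := by simp [hw, hv]; linarith
  have re3 : 2 < (v + v - 1).re := by simp [hv]; linarith
  set d : ℂ → ℕ → ℂ := fun z => (m.factorial / indicial m z) • negBinom z with hd
  have hdn : ∀ z : ℂ, 2 < z.re → ∀ n, m - 1 ≤ n →
      d z n - splitSum m (d z) n = splitSum m (negBinom z) n := fun z hz n hn =>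
    solve_splitSum_negBinom (by omega) hn (risingProd_ne_zero (by linarith) m)
      (indicial_ne_zero_of_two_lt_re (by omega) hz)
  clear_value d X
  set p : ℕ → ℂ := (a * a * ((m : ℂ) - 1)) • d (w + w - 1) +
    (2 * (a * b) * ((m : ℂ) - 1)) • d (w + v - 1) + (b * b * ((m : ℂ) - 1)) • d (v + v - 1) with hp
  have hpn : ∀ᶠ n in atTop, p n - splitSum m p n = splitPair m X X n := by
    filter_upwards [eventually_ge_atTop (m - 1)] with n hn
    rw [hX, splitPair_comb, hp, splitSum_add, splitSum_add, splitSum_smul, splitSum_smul,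
      splitSum_smul]
    simp only [Pi.add_apply, Pi.smul_apply, smul_eq_mul]
    rw [splitPair_negBinom (by omega), splitPair_negBinom (by omega), splitPair_negBinom (by omega),
      ← hdn _ re1 n hn, ← hdn _ re2 n hn, ← hdn _ re3 n hn]
    ring
  have hqn : ∀ᶠ n in atTop, (fun n => (q n : ℂ)) n - splitSum m (fun n => (q n : ℂ)) n =
      splitPair m (X + E) (X + E) n := by
    filter_upwards [eventually_ge_atTop (m - 1)] with n hn
    rw [← hu, ← ofReal_splitSum hn, ← ofReal_splitPair hn]
    rw [← Complex.ofReal_sub]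
    congr 1
    linarith [H.space_sq n hn]
  have htoll : (fun n => splitPair m (X + E) (X + E) n - splitPair m X X n) =o[atTop]
      fun n : ℕ => (n : ℝ) ^ (2 * σ - 2) := by
    have e1 := isBigO_splitPair (m := m) (by omega) (by linarith) (by linarith) (by linarith)
      hXO hE (r := σ - 1 + s) le_rfl
    have e2 := isBigO_splitPair (m := m) (by omega) (by linarith) (by linarith) (by linarith)
      hE hE (r := σ - 1 + s) (by linarith)
    refine isLittleO_of_isBigO_lt (((e1.const_smul_left (2 : ℂ)).add e2).congr_left fun n => ?_)
      (by linarith)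
    rw [splitPair_add_left, splitPair_add_right, splitPair_add_right, splitPair_comm m E X]
    simp only [Pi.add_apply, Pi.smul_apply, smul_eq_mul]
    ring
  have h1 := isLittleO_sub_of_splitSum hm (by linarith) hqn hpn htoll
  have h2 : (fun n => (u n : ℂ) * u n - X n * X n) =o[atTop]
      fun n : ℕ => (n : ℝ) ^ (2 * σ - 2) := by
    have e1 := isBigO_mul_rpow hUO hE (r := σ - 1 + s) le_rfl
    have e2 := isBigO_mul_rpow hXO hE (r := σ - 1 + s) le_rfl
    refine isLittleO_of_isBigO_lt ((e1.add e2).congr_left fun n => ?_)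
      (show σ - 1 + s < 2 * σ - 2 by linarith)
    have := congrFun hu n
    simp only [Pi.add_apply] at this
    rw [this]
    ring
  have h3 := (isLittleO_pair (m := m) (w := w) (v := w) (s := 2 * σ - 2) (by omega) (by linarith)
    (by linarith) (by simp [hw]; linarith) (by rw [hw]; ring)).const_mul_left (a * a)
  have h4 := (isLittleO_pair (m := m) (w := w) (v := v) (s := 2 * σ - 2) (by omega) (by linarith)
    (by linarith) (by simp [hw, hv]; linarith) (by rw [hw, hv]; ring)).const_mul_left (2 * (a * b))
  have h5 := (isLittleO_pair (m := m) (w := v) (v := v) (s := 2 * σ - 2) (by omega) (by linarith)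
    (by linarith) (by simp [hv]; linarith) (by rw [hv]; ring)).const_mul_left (b * b)
  refine ((h1.sub h2).add ((h3.add h4).add h5)).congr_left fun n => ?_
  simp only [hp, hX, hd, Pi.add_apply, Pi.smul_apply, smul_eq_mul]
  push_cast
  ring

theorem pairCoeff_conj (m : ℕ) (w v : ℂ) :
    pairCoeff m (starRingEnd ℂ w) (starRingEnd ℂ v) = starRingEnd ℂ (pairCoeff m w v) := by
  simp only [pairCoeff, map_mul, map_inv₀, map_add, map_sub, map_neg, map_one, map_div₀,
    map_natCast, ← Complex.Gamma_conj, Complex.conj_ofNat]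

theorem coeffA_conj (m : ℕ) (w : ℂ) : coeffA m (starRingEnd ℂ w) = starRingEnd ℂ (coeffA m w) := by
  simp [coeffA]

theorem exp_two_mul_I_log {n : ℕ} (hn : 0 < n) (w : ℂ) :
    (n : ℂ) ^ (w + w - 2) = (((n : ℝ) ^ (2 * w.re - 2) : ℝ) : ℂ) *
      Complex.exp (2 * Complex.I * ((w.im * Real.log n : ℝ) : ℂ)) := by
  have hn' : (n : ℂ) ≠ 0 := by exact_mod_cast hn.ne'
  have hn'' : (0 : ℝ) < n := by exact_mod_cast hn
  rw [Complex.cpow_def_of_ne_zero hn', Real.rpow_def_of_pos hn'', Complex.ofReal_exp,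
    ← Complex.exp_add, ← Complex.natCast_log]
  congr 1
  conv_lhs => rw [← Complex.re_add_im w]
  push_cast
  ring

theorem periodicF1_eq (m : ℕ) (lam : ℂ) (t : ℝ) :
    (periodicF1 m lam t : ℂ) = 2 * (coeffA m lam * starRingEnd ℂ (coeffA m lam)) *
        pairCoeff m lam (starRingEnd ℂ lam) +
      (coeffA m lam * coeffA m lam * pairCoeff m lam lam * Complex.exp (2 * Complex.I * t) +
        starRingEnd ℂ (coeffA m lam * coeffA m lam * pairCoeff m lam lam *
          Complex.exp (2 * Complex.I * t))) := by
  rw [Complex.add_conj, periodicF1, Complex.ofReal_add]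
  congr 1
  · have h1 : pairCoeff m lam (starRingEnd ℂ lam) = (((‖Complex.Gamma lam‖ ^ 2)⁻¹ *
      (-1 + (m.factorial : ℝ) * ((m : ℝ) - 1) * ‖Complex.Gamma lam‖ ^ 2 /
        (Real.Gamma (2 * lam.re + m - 2) -
          (m.factorial : ℝ) * Real.Gamma (2 * lam.re - 1))) : ℝ) : ℂ) := by
      rw [pairCoeff, Complex.Gamma_conj, Complex.mul_conj, Complex.normSq_eq_norm_sq,
        Complex.add_conj]
      push_cast [← Complex.Gamma_ofReal]
      rfl
    rw [h1, Complex.mul_conj, Complex.normSq_eq_norm_sq]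
    push_cast
    ring
  · push_cast
    congr 3
    rw [pairCoeff]
    rw [show 2 * lam = lam + lam by ring]
    simp only [pow_two, mul_inv, div_eq_mul_inv]
    ring

/-- The asymptotic expansion of the variance of the space requirement. -/
theorem tendsto_variance_space_sub (hm : 3 ≤ m) {u q k c r : ℕ → ℝ} {e : ℂ → ℂ}
    (H : IsMomentSystem m u k q c r e) {lam : ℂ} {s : ℝ} {E : ℕ → ℂ}
    (hlam : 3 / 2 < lam.re) (hs : s < lam.re - 1) (hs0 : 0 ≤ s)
    (hu : (fun n => (u n : ℂ)) = coeffA m lam • negBinom lam +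
      coeffA m (starRingEnd ℂ lam) • negBinom (starRingEnd ℂ lam) + E)
    (hE : E =O[atTop] fun n : ℕ => (n : ℝ) ^ s) :
    Tendsto (fun n : ℕ => (q n - u n * u n) / (n : ℝ) ^ (2 * lam.re - 2) -
      periodicF1 m lam (lam.im * Real.log n)) atTop (𝓝 0) := by
  have h := isLittleO_variance_space hm H rfl (Complex.conj_re lam) hlam hs hs0 hu hE
  have h1 := (Asymptotics.isLittleO_norm_norm.2 h).tendsto_div_nhds_zero
  rw [tendsto_zero_iff_norm_tendsto_zero]
  refine h1.congr' ?_
  filter_upwards [eventually_gt_atTop 0] with n hn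
  have hn'' : (0 : ℝ) < n := by exact_mod_cast hn
  have hp : 0 < (n : ℝ) ^ (2 * lam.re - 2) := by positivity
  have hn2 : ‖(n : ℝ) ^ (2 * lam.re - 2)‖ = ‖(((n : ℝ) ^ (2 * lam.re - 2) : ℝ) : ℂ)‖ :=
    (Complex.norm_real _).symm
  conv_rhs => rw [← Complex.norm_real]
  rw [hn2, ← norm_div]
  congr 1
  rw [Complex.ofReal_sub (_ / _), periodicF1_eq, exp_two_mul_I_log hn lam,
    exp_two_mul_I_log hn (starRingEnd ℂ lam), coeffA_conj, pairCoeff_conj]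
  have e1 : (n : ℂ) ^ (lam + starRingEnd ℂ lam - 2) = (((n : ℝ) ^ (2 * lam.re - 2) : ℝ) : ℂ) := by
    rw [Complex.add_conj, Complex.ofReal_cpow hn''.le]
    push_cast
    rfl
  have e2 : starRingEnd ℂ (Complex.exp (2 * Complex.I * ((lam.im * Real.log n : ℝ) : ℂ))) =
      Complex.exp (2 * Complex.I * (((starRingEnd ℂ lam).im * Real.log n : ℝ) : ℂ)) := by
    rw [← Complex.exp_conj]
    congr 1
    simp only [map_mul, Complex.conj_I, Complex.conj_ofNat, Complex.conj_ofReal, Complex.conj_im]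
    push_cast
    ring
  have hp' : (((n : ℝ) ^ (2 * lam.re - 2) : ℝ) : ℂ) ≠ 0 := by exact_mod_cast hp.ne'
  rw [e1, Complex.conj_re, map_mul, map_mul, map_mul, e2, Complex.ofReal_div]
  generalize (((n : ℝ) ^ (2 * lam.re - 2) : ℝ) : ℂ) = P at hp' ⊢
  generalize Complex.exp (2 * Complex.I * ((lam.im * Real.log n : ℝ) : ℂ)) = e₁
  generalize Complex.exp (2 * Complex.I * (((starRingEnd ℂ lam).im * Real.log n : ℝ) : ℂ)) = e₂
  field_simp
  ring

end SpaceVariance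

end

/-! ### Expansion of the covariance -/

noncomputable section

section Covariance

variable {m : ℕ}

/-- The coefficient of `n ^ w / Γ(w)` contributed to the covariance by the root `w`. -/
def covCoeff (m : ℕ) (w : ℂ) : ℂ :=
  2 * occ m * (Complex.digamma 2 - Complex.digamma (w + 1)) +
    (1 - 2 * occ m * harmSum (w + 1) (m - 1)) * ((w + m - 1) / (m - 1))

theorem factorial_div_risingProd_add_one (hm : 1 ≤ m) {w : ℂ} (hw : 0 < w.re)
    (h : indicial m w = 0) :
    (m.factorial : ℂ) / risingProd m (w + 1) = w / (w + m - 1) := by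
  have h1 := risingProd_add_one hm w
  have h2 : risingProd m (w + 1) ≠ 0 :=
    risingProd_ne_zero (by rw [Complex.add_re, Complex.one_re]; linarith) m
  have h3 : w + m - 1 ≠ 0 := by
    obtain ⟨k, rfl⟩ : ∃ k, m = k + 1 := ⟨m - 1, by omega⟩
    have := add_natCast_ne_zero hw k
    push_cast
    rwa [add_sub_assoc, add_sub_cancel_right]
  rw [indicial_eq, sub_eq_zero] at h
  rw [div_eq_div_iff h2 h3, h1, h]

theorem natCast_sub_one_ne_zero (hm : 2 ≤ m) : (m : ℂ) - 1 ≠ 0 := by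
  have : ((m - 1 : ℕ) : ℂ) ≠ 0 := by exact_mod_cast (by omega : m - 1 ≠ 0)
  rwa [Nat.cast_sub (by omega), Nat.cast_one] at this

/-- The contribution of the root `w` to the mixed second moment. -/
def covTerm (m : ℕ) (w : ℂ) : ℕ → ℂ :=
  (2 * (occ m : ℂ) * w) • negBinomD (w + 1) +
    ((1 - 2 * occ m * harmSum (w + 1) (m - 1)) * (w * (w + m - 1) / (m - 1))) • negBinom (w + 1)

/-- At a zero `w` the eigenvalue for w + 1 is w/(w+m-1), which makes the particular solution
rational in `w`. The toll w `negBinom (w + 1)` stands for (n+1) `negBinom w` up to lower order. -/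
theorem covTerm_sub_splitSum (hm : 2 ≤ m) {n : ℕ} (hn : m - 1 ≤ n) {w : ℂ} (hw : 0 < w.re)
    (h : indicial m w = 0) :
    covTerm m w n - splitSum m (covTerm m w) n =
      2 * occ m * splitPair m (negBinom w) (negBinomD 2) n + w * negBinom (w + 1) n := by
  have hm1 := natCast_sub_one_ne_zero hm
  have hw1 : 0 < (w + 1).re := by rw [Complex.add_re, Complex.one_re]; linarith
  have h3 : w + m - 1 ≠ 0 := by
    obtain ⟨k, rfl⟩ : ∃ k, m = k + 1 := ⟨m - 1, by omega⟩
    have := add_natCast_ne_zero hw k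
    push_cast
    rwa [add_sub_assoc, add_sub_cancel_right]
  rw [splitPair_negBinom_negBinomD hm hw (by simp) (by simp; linarith),
    show w + 2 - 1 = w + 1 by ring, covTerm, splitSum_add, splitSum_smul, splitSum_smul]
  simp only [Pi.add_apply, Pi.smul_apply, smul_eq_mul]
  rw [splitSum_negBinom (by omega) hn (risingProd_ne_zero hw1 m),
    splitSum_negBinomD (by omega) hn hw1, factorial_div_risingProd_add_one (by omega) hw h]
  field_simp
  ring

/-- The logarithms of the mixed moment and of the product of means cancel: what remains is a
difference of two harmonic sums, with limit ψ(2) - ψ(w+1). Hence the covariance has order n^α with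
no logarithm. -/
theorem isLittleO_covTerm (hm : 2 ≤ m) {w : ℂ} (hw : 0 < w.re) :
    (fun n => covTerm m w n - 2 * occ m * (negBinom w n * negBinomD 2 n) -
      (Complex.Gamma w)⁻¹ * covCoeff m w * (n : ℂ) ^ w) =o[atTop]
        fun n : ℕ => (n : ℝ) ^ w.re := by
  have hw0 : w ≠ 0 := by rintro rfl; simp at hw
  have hw1 : 0 < (w + 1).re := by rw [Complex.add_re, Complex.one_re]; linarith
  have hm1 := natCast_sub_one_ne_zero hm
  have h1 : (fun n => harmSum (w + 1) n - harmSum 2 n -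
      (Complex.digamma 2 - Complex.digamma (w + 1))) =o[atTop] fun n : ℕ => (n : ℝ) ^ (0 : ℝ) := by
    simp only [Real.rpow_zero]
    rw [Asymptotics.isLittleO_one_iff]
    have := ((tendsto_harmSum_sub_log hw1).sub (tendsto_harmSum_sub_log (w := 2) (by simp))).sub_const
      (Complex.digamma 2 - Complex.digamma (w + 1))
    rw [show -Complex.digamma (w + 1) - -Complex.digamma 2 -
      (Complex.digamma 2 - Complex.digamma (w + 1)) = 0 by ring] at this
    exact this.congr fun n => by ring
  have h2 := (isLittleO_mul_rpow h1 (isBigO_negBinom (μ := w + 1) (s := w.re) (by simp))).const_mul_left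
    (2 * occ m * w : ℂ)
  rw [zero_add] at h2
  have h3 := (isLittleO_negBinom_sub_cpow (w + 1)).const_mul_left (w * covCoeff m w)
  rw [Complex.add_re, Complex.one_re, add_sub_cancel_right, add_sub_cancel_right] at h3
  have h4 := (isLittleO_of_isBigO_lt (isBigO_mul_rpow (isBigO_negBinom (μ := w) (s := w.re - 1) le_rfl)
    (isBigO_harmSum (w := 2) (by simp) (show (0 : ℝ) < 1 / 2 by norm_num)) le_rfl)
    (show w.re - 1 + 1 / 2 < w.re by linarith)).const_mul_left (2 * occ m * (w - 1) : ℂ)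
  refine ((h2.add h3).add h4).congr_left fun n => ?_
  have e1 := negBinom_add_one w n
  have e2 : (Complex.Gamma w)⁻¹ = w * (Complex.Gamma (w + 1))⁻¹ := by
    rw [Complex.Gamma_add_one w hw0, mul_inv]
    field_simp
  rw [e2, covTerm, covCoeff, negBinomD, negBinom_two]
  simp only [Pi.add_apply, Pi.smul_apply, smul_eq_mul, negBinomD]
  linear_combination (-2 * occ m * harmSum 2 n : ℂ) * e1

theorem isLittleO_covariance (hm : 3 ≤ m) {u q k c r : ℕ → ℝ} {e : ℂ → ℂ}
    (H : IsMomentSystem m u k q c r e) {w v a b : ℂ} {σ s g : ℝ} {E G : ℕ → ℂ}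
    (hw : w.re = σ) (hv : v.re = σ) (hwr : indicial m w = 0) (hvr : indicial m v = 0)
    (hs : s < σ - 1) (hs0 : 0 ≤ s) (hg : g < 1) (hg0 : 0 ≤ g)
    (hu : (fun n => (u n : ℂ)) = a • negBinom w + b • negBinom v + E)
    (hE : E =O[atTop] fun n : ℕ => (n : ℝ) ^ s)
    (hk : (fun n => (k n : ℂ)) = (2 * (occ m : ℂ)) • negBinomD 2 + G)
    (hG : G =O[atTop] fun n : ℕ => (n : ℝ) ^ g) :
    (fun n => ((c n - u n * k n : ℝ) : ℂ) -
      (a * ((Complex.Gamma w)⁻¹ * covCoeff m w * (n : ℂ) ^ w) +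
        b * ((Complex.Gamma v)⁻¹ * covCoeff m v * (n : ℂ) ^ v))) =o[atTop]
        fun n : ℕ => (n : ℝ) ^ σ := by
  set X : ℕ → ℂ := a • negBinom w + b • negBinom v with hX
  have hXO : X =O[atTop] fun n : ℕ => (n : ℝ) ^ (σ - 1) :=
    ((isBigO_negBinom (by rw [hw])).const_smul_left a).add
      ((isBigO_negBinom (by rw [hv])).const_smul_left b)
  -- The exponent δ absorbs the logarithm of the mean of K_n within the gap between s and σ - 1.
  obtain ⟨δ, hδ, hδ1⟩ : ∃ δ > 0, s + (1 + δ) < σ := ⟨(σ - 1 - s) / 2, by linarith, by linarith⟩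
  have hDO : negBinomD 2 =O[atTop] fun n : ℕ => (n : ℝ) ^ (1 + δ) :=
    isBigO_negBinomD (by simp) (by rw [Complex.re_ofNat]; linarith)
  set Y : ℕ → ℂ := (2 * (occ m : ℂ)) • negBinomD 2 with hY
  have hYO : Y =O[atTop] fun n : ℕ => (n : ℝ) ^ (1 + δ) := hDO.const_smul_left _
  have hKO : (fun n => (k n : ℂ)) =O[atTop] fun n : ℕ => (n : ℝ) ^ (1 + δ) := by
    rw [hk]; exact hYO.add (hG.trans (isBigO_natCast_rpow (by linarith)))
  clear_value X Y
  set p : ℕ → ℂ := a • covTerm m w + b • covTerm m v with hp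
  have hpn : ∀ᶠ n in atTop, p n - splitSum m p n = splitPair m X Y n +
      (a * (w * negBinom (w + 1) n) + b * (v * negBinom (v + 1) n)) := by
    filter_upwards [eventually_ge_atTop (m - 1)] with n hn
    have t1 := covTerm_sub_splitSum (by omega) hn (by linarith) hwr
    have t2 := covTerm_sub_splitSum (by omega) hn (by linarith) hvr
    rw [hX, hY, splitPair_add_left]
    simp only [splitPair_smul_left, splitPair_smul_right]
    rw [hp, splitSum_add, splitSum_smul, splitSum_smul]
    simp only [Pi.add_apply, Pi.smul_apply, smul_eq_mul]
    linear_combination a * t1 + b * t2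
  have hcn : ∀ᶠ n in atTop, (fun n => (c n : ℂ)) n - splitSum m (fun n => (c n : ℂ)) n =
      splitPair m (X + E) (Y + G) n + ((n : ℂ) + 1) * u n := by
    filter_upwards [eventually_ge_atTop (m - 1)] with n hn
    rw [← hu, ← hk, ← ofReal_splitSum hn, ← ofReal_splitPair hn]
    have := congrArg (fun x : ℝ => (x : ℂ)) (H.space_mul_path n hn)
    push_cast at this
    linear_combination this
  have hXE : (X + E) =O[atTop] fun n : ℕ => (n : ℝ) ^ (σ - 1) :=
    hXO.add (hE.trans (isBigO_natCast_rpow hs.le))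
  have htoll : (fun n => splitPair m (X + E) (Y + G) n + ((n : ℂ) + 1) * u n -
      (splitPair m X Y n + (a * (w * negBinom (w + 1) n) + b * (v * negBinom (v + 1) n)))) =o[atTop]
        fun n : ℕ => (n : ℝ) ^ σ := by
    have e1 := isLittleO_of_isBigO_lt (isBigO_splitPair (m := m) (by omega) (by linarith)
      (by linarith) (by linarith) hXE hG (r := σ - 1 + g) le_rfl) (show _ < σ by linarith)
    have e2 := isLittleO_of_isBigO_lt (isBigO_splitPair (m := m) (by omega) (by linarith)
      (by linarith) (by linarith) hE hYO le_rfl) hδ1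
    have e3 := isLittleO_of_isBigO_lt (isBigO_mul_rpow isBigO_natCast_add_one hE
      le_rfl) (show 1 + s < σ by linarith)
    -- From (n+1) `negBinom w` = w `negBinom (w + 1)` + (1-w) `negBinom w`, the last term is
    -- negligible.
    have e4 := isLittleO_of_isBigO_lt (((isBigO_negBinom (μ := w) (s := σ - 1)
      (by rw [hw])).const_mul_left (a * (1 - w))).add ((isBigO_negBinom (μ := v) (s := σ - 1)
      (by rw [hv])).const_mul_left (b * (1 - v)))) (show _ < σ by linarith)
    refine (((e1.add e2).add e3).add e4).congr_left fun n => ?_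
    have := congrFun hu n
    simp only [hX, Pi.add_apply, Pi.smul_apply, smul_eq_mul] at this
    rw [splitPair_add_right m (X + E), splitPair_add_left m X E Y, negBinom_add_one,
      negBinom_add_one, this]
    simp only [Pi.add_apply]
    ring
  have h1 := isLittleO_sub_of_splitSum hm (by linarith) hcn hpn htoll
  have h2 : (fun n => (u n : ℂ) * k n - X n * Y n) =o[atTop]
      fun n : ℕ => (n : ℝ) ^ σ := by
    have e1 := isLittleO_of_isBigO_lt (isBigO_mul_rpow hXO hG le_rfl)
      (show σ - 1 + g < σ by linarith)
    have e2 := isLittleO_of_isBigO_lt (isBigO_mul_rpow hE hKO le_rfl) hδ1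
    refine (e1.add e2).congr_left fun n => ?_
    have t1 := congrFun hu n
    have t2 := congrFun hk n
    simp only [Pi.add_apply] at t1 t2
    rw [t1, t2]
    ring
  have h3 := (isLittleO_covTerm (m := m) (w := w) (by omega) (by linarith)).const_mul_left a
  have h4 := (isLittleO_covTerm (m := m) (w := v) (by omega) (by linarith)).const_mul_left b
  rw [hw] at h3
  rw [hv] at h4
  refine ((h1.sub h2).add (h3.add h4)).congr_left fun n => ?_
  simp only [hp, hX, hY, Pi.add_apply, Pi.smul_apply, smul_eq_mul]
  push_cast
  ring

/-- The covariance is of smaller order than `n ^ (3 / 2)` if the mean of the space requirement is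
linear up to smaller order than `√n`. -/
theorem isLittleO_covariance_of_lt (hm : 3 ≤ m) {u q k c r : ℕ → ℝ} {e : ℂ → ℂ}
    (H : IsMomentSystem m u k q c r e) {s g : ℝ} {G : ℕ → ℂ}
    (hs : s < 1 / 2) (hs0 : 0 ≤ s) (hg : g < 1)
    (hu : (fun n => (u n : ℂ)) =O[atTop] fun n : ℕ => (n : ℝ) ^ s)
    (hk : (fun n => (k n : ℂ)) = (2 * (occ m : ℂ)) • negBinomD 2 + G)
    (hG : G =O[atTop] fun n : ℕ => (n : ℝ) ^ g) :
    (fun n => ((c n - u n * k n : ℝ) : ℂ)) =o[atTop] fun n : ℕ => (n : ℝ) ^ (3 / 2 : ℝ) := by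
  obtain ⟨δ, hδ, hδ1⟩ : ∃ δ > 0, s + (1 + δ) < 3 / 2 :=
    ⟨(1 / 2 - s) / 2, by linarith, by linarith⟩
  have hDO : negBinomD 2 =O[atTop] fun n : ℕ => (n : ℝ) ^ (1 + δ) :=
    isBigO_negBinomD (by simp) (by rw [Complex.re_ofNat]; linarith)
  have hKO : (fun n => (k n : ℂ)) =O[atTop] fun n : ℕ => (n : ℝ) ^ (1 + δ) := by
    rw [hk]; exact (hDO.const_smul_left _).add (hG.trans (isBigO_natCast_rpow (by linarith)))
  have h1 := isLittleO_of_isBigO_lt (isBigO_splitPair (m := m) (by omega) (by linarith)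
    (by linarith) (by linarith) hu hKO le_rfl) hδ1
  have h2 := isLittleO_of_isBigO_lt (isBigO_mul_rpow isBigO_natCast_add_one hu le_rfl)
    (show 1 + s < 3 / 2 by linarith)
  have h3 := isLittleO_of_isBigO_lt (isBigO_mul_rpow hu hKO le_rfl) hδ1
  have h4 : (fun n => (c n : ℂ)) =o[atTop] fun n : ℕ => (n : ℝ) ^ (3 / 2 : ℝ) := by
    refine isLittleO_of_sub_splitSum hm (by norm_num) ((h1.add h2).congr' ?_ (EventuallyEq.refl _ _))
    filter_upwards [eventually_ge_atTop (m - 1)] with n hn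
    rw [← ofReal_splitSum hn, ← ofReal_splitPair hn]
    have := congrArg (fun x : ℝ => (x : ℂ)) (H.space_mul_path n hn)
    push_cast at this
    linear_combination -this
  refine (h4.sub h3).congr_left fun n => ?_
  push_cast
  ring

theorem digamma_conj {w : ℂ} (hw : 0 < w.re) :
    Complex.digamma (starRingEnd ℂ w) = starRingEnd ℂ (Complex.digamma w) := by
  have h1 := tendsto_harmSum_sub_log hw
  have h2 := tendsto_harmSum_sub_log (w := starRingEnd ℂ w) (by simpa using hw)
  have h3 := (Complex.continuous_conj.tendsto _).comp h1
  rw [map_neg] at h3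
  refine neg_injective (tendsto_nhds_unique h2 (h3.congr fun n => ?_))
  rw [Function.comp, map_sub, ← Complex.natCast_log, Complex.conj_ofReal]
  simp [harmSum]

theorem covCoeff_conj {w : ℂ} (hw : 0 < w.re) :
    covCoeff m (starRingEnd ℂ w) = starRingEnd ℂ (covCoeff m w) := by
  have h2 : starRingEnd ℂ (Complex.digamma 2) = Complex.digamma 2 := by
    rw [← digamma_conj (by simp), Complex.conj_ofNat]
  have h1 : Complex.digamma (starRingEnd ℂ w + 1) = starRingEnd ℂ (Complex.digamma (w + 1)) := by
    rw [← digamma_conj (by rw [Complex.add_re, Complex.one_re]; linarith), map_add, map_one]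
  rw [covCoeff, covCoeff, h1]
  simp [harmSum, h2, Complex.conj_ofNat]

theorem digamma_two : Complex.digamma 2 = 1 - (Real.eulerMascheroniConstant : ℂ) := by
  have := Complex.digamma_apply_add_one 1 (by
    intro k h
    have := congrArg Complex.re h
    simp at this
    have hk : (0 : ℝ) ≤ k := by positivity
    linarith)
  rw [show (1 : ℂ) + 1 = 2 by norm_num, Complex.digamma_one] at this
  rw [this]
  ring

theorem harmSum_eq_digamma_sub {w : ℂ} (hw : 0 < w.re) (n : ℕ) :
    harmSum w n = Complex.digamma (w + n) - Complex.digamma w := by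
  induction n with
  | zero => simp [harmSum]
  | succ n ih =>
    have h := Complex.digamma_apply_add_one (w + n) (by
      intro k h
      have := add_natCast_ne_zero hw (n + k)
      push_cast at this
      exact this (by rw [← add_assoc, h]; ring))
    rw [harmSum, Finset.sum_range_succ, ← harmSum, ih]
    push_cast
    rw [← add_assoc, h]
    ring

/-- The harmonic sum in `covCoeff` is ψ(λ+m) - ψ(λ+1) and ψ(2) = 1 - γ; the contributions of λ and
of its conjugate form twice a real part. -/
theorem periodicF2_eq (hm : 3 ≤ m) {lam : ℂ} (hlam : 0 < lam.re) (t : ℝ) :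
    (periodicF2 m lam t : ℂ) =
      coeffA m lam * ((Complex.Gamma lam)⁻¹ * covCoeff m lam) * Complex.exp (Complex.I * t) +
        starRingEnd ℂ (coeffA m lam * ((Complex.Gamma lam)⁻¹ * covCoeff m lam) *
          Complex.exp (Complex.I * t)) := by
  rw [Complex.add_conj, periodicF2]
  have hm1 := natCast_sub_one_ne_zero (m := m) (by omega)
  have hφ := (occ_pos hm).ne'
  have hφ' : (occ m : ℂ) ≠ 0 := by exact_mod_cast hφ
  have hΓ := Complex.Gamma_ne_zero_of_re_pos hlam
  have h3 : lam + m - 1 ≠ 0 := by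
    obtain ⟨k, rfl⟩ : ∃ k, m = k + 1 := ⟨m - 1, by omega⟩
    have := add_natCast_ne_zero hlam k
    push_cast
    rwa [add_sub_assoc, add_sub_cancel_right]
  have hL := harmSum_eq_digamma_sub (w := lam + 1) (by rw [Complex.add_re, Complex.one_re]; linarith)
    (m - 1)
  rw [Nat.cast_sub (by omega), Nat.cast_one, show lam + 1 + ((m : ℂ) - 1) = lam + m by ring] at hL
  have key : (2 * occ m : ℝ) * ((lam + m - 1) * coeffA m lam * Complex.exp (Complex.I * t) /
        (((m : ℂ) - 1) * Complex.Gamma lam) *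
      (1 / (2 * (occ m : ℂ)) -
        1 / (lam + m - 1) *
          ((lam + m - 1) * Complex.digamma (lam + m) - lam * Complex.digamma (lam + 1) -
            ((m : ℂ) - 1) * (1 - (Real.eulerMascheroniConstant : ℂ))))) =
      coeffA m lam * ((Complex.Gamma lam)⁻¹ * covCoeff m lam) * Complex.exp (Complex.I * t) := by
    rw [covCoeff, digamma_two, hL]
    push_cast
    field_simp
    ring
  rw [← key, Complex.re_ofReal_mul]
  congr 1
  ring

theorem cpow_eq_rpow_mul_exp {n : ℕ} (hn : 0 < n) (w : ℂ) :
    (n : ℂ) ^ w = (((n : ℝ) ^ w.re : ℝ) : ℂ) *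
      Complex.exp (Complex.I * ((w.im * Real.log n : ℝ) : ℂ)) := by
  have hn' : (n : ℂ) ≠ 0 := by exact_mod_cast hn.ne'
  have hn'' : (0 : ℝ) < n := by exact_mod_cast hn
  rw [Complex.cpow_def_of_ne_zero hn', Real.rpow_def_of_pos hn'', Complex.ofReal_exp,
    ← Complex.exp_add, ← Complex.natCast_log]
  congr 1
  conv_lhs => rw [← Complex.re_add_im w]
  push_cast
  ring

/-- The asymptotic expansion of the covariance. -/
theorem tendsto_covariance_sub (hm : 3 ≤ m) {u q k c r : ℕ → ℝ} {e : ℂ → ℂ}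
    (H : IsMomentSystem m u k q c r e) {lam : ℂ} {s g : ℝ} {E G : ℕ → ℂ}
    (hroot : indicial m lam = 0)
    (hlam : 3 / 2 < lam.re) (hs : s < lam.re - 1) (hs0 : 0 ≤ s) (hg : g < 1) (hg0 : 0 ≤ g)
    (hu : (fun n => (u n : ℂ)) = coeffA m lam • negBinom lam +
      coeffA m (starRingEnd ℂ lam) • negBinom (starRingEnd ℂ lam) + E)
    (hE : E =O[atTop] fun n : ℕ => (n : ℝ) ^ s)
    (hk : (fun n => (k n : ℂ)) = (2 * (occ m : ℂ)) • negBinomD 2 + G)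
    (hG : G =O[atTop] fun n : ℕ => (n : ℝ) ^ g) :
    Tendsto (fun n : ℕ => (c n - u n * k n) / (n : ℝ) ^ lam.re -
      periodicF2 m lam (lam.im * Real.log n)) atTop (𝓝 0) := by
  have h := isLittleO_covariance hm H rfl (Complex.conj_re lam) hroot
    (by rw [indicial_conj, hroot, map_zero]) hs hs0 hg hg0 hu hE hk hG
  have h1 := (Asymptotics.isLittleO_norm_norm.2 h).tendsto_div_nhds_zero
  rw [tendsto_zero_iff_norm_tendsto_zero]
  refine h1.congr' ?_
  filter_upwards [eventually_gt_atTop 0] with n hn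
  have hn'' : (0 : ℝ) < n := by exact_mod_cast hn
  have hp : 0 < (n : ℝ) ^ lam.re := by positivity
  have hn2 : ‖(n : ℝ) ^ lam.re‖ = ‖(((n : ℝ) ^ lam.re : ℝ) : ℂ)‖ :=
    (Complex.norm_real _).symm
  conv_rhs => rw [← Complex.norm_real]
  rw [hn2, ← norm_div]
  congr 1
  have e2 : starRingEnd ℂ (Complex.exp (Complex.I * ((lam.im * Real.log n : ℝ) : ℂ))) =
      Complex.exp (Complex.I * (((starRingEnd ℂ lam).im * Real.log n : ℝ) : ℂ)) := by
    rw [← Complex.exp_conj]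
    congr 1
    simp only [map_mul, Complex.conj_I, Complex.conj_ofReal, Complex.conj_im]
    push_cast
    ring
  have hp' : (((n : ℝ) ^ lam.re : ℝ) : ℂ) ≠ 0 := by exact_mod_cast hp.ne'
  rw [Complex.ofReal_sub (_ / _), periodicF2_eq hm (by linarith), cpow_eq_rpow_mul_exp hn lam,
    cpow_eq_rpow_mul_exp hn (starRingEnd ℂ lam), coeffA_conj, covCoeff_conj (by linarith),
    Complex.Gamma_conj, Complex.conj_re, map_mul, map_mul, map_mul, map_inv₀, e2,
    Complex.ofReal_div]
  generalize (((n : ℝ) ^ lam.re : ℝ) : ℂ) = P at hp' ⊢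
  generalize Complex.exp (Complex.I * ((lam.im * Real.log n : ℝ) : ℂ)) = e₁
  generalize Complex.exp (Complex.I * (((starRingEnd ℂ lam).im * Real.log n : ℝ) : ℂ)) = e₂
  have hΓ := Complex.Gamma_ne_zero_of_re_pos (s := lam) (by linarith)
  have hΓ' : starRingEnd ℂ (Complex.Gamma lam) ≠ 0 := by simpa using hΓ
  field_simp

end Covariance

end

/-! ### Variance of the key path length and positivity of C_K -/

noncomputable section

section PathVariance

variable {m : ℕ}

theorem harmSum_three (n : ℕ) : harmSum 3 n = harmSum 2 n - 1 / 2 + 1 / ((n : ℂ) + 2) := by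
  induction n with
  | zero => simp [harmSum]
  | succ n ih =>
    have h2 := add_natCast_ne_zero (w := 2) (by simp) n
    have h3 := add_natCast_ne_zero (w := 3) (by simp) n
    rw [harmSum, harmSum, Finset.sum_range_succ, Finset.sum_range_succ, ← harmSum, ← harmSum, ih]
    push_cast
    rw [show (n : ℂ) + 1 + 2 = 3 + n by ring, add_comm (n : ℂ) 2]
    ring

theorem sqSum_three (n : ℕ) : sqSum 3 n = sqSum 2 n - 1 / 4 + 1 / ((n : ℂ) + 2) ^ 2 := by
  induction n with
  | zero => norm_num [sqSum]
  | succ n ih =>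
    rw [sqSum, sqSum, Finset.sum_range_succ, Finset.sum_range_succ, ← sqSum, ← sqSum, ih]
    push_cast
    rw [show (n : ℂ) + 1 + 2 = 3 + n by ring, add_comm (n : ℂ) 2]
    ring

theorem sqSum_two (n : ℕ) : sqSum 2 n = ((harm2 (n + 1) - 1 : ℝ) : ℂ) := by
  induction n with
  | zero => simp [sqSum, harm2]
  | succ n ih =>
    have : harm2 (n + 1 + 1) = harm2 (n + 1) + 1 / ((n + 1 + 1 : ℕ) : ℝ) ^ 2 := by
      rw [harm2, harm2, Finset.sum_Icc_succ_top (by omega)]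
    rw [sqSum, Finset.sum_range_succ, ← sqSum, ih, this]
    push_cast
    ring

theorem tendsto_harm2 : Tendsto harm2 atTop (𝓝 (Real.pi ^ 2 / 6)) := by
  have h := (hasSum_zeta_two.tendsto_sum_nat).comp (tendsto_add_atTop_nat 1)
  refine h.congr fun n => ?_
  rw [Function.comp, harm2, Finset.range_eq_Ico, Finset.sum_eq_sum_Ico_succ_bot (by omega)]
  simp only [CharP.cast_eq_zero, ne_eq, OfNat.ofNat_ne_zero, not_false_eq_true, zero_pow, div_zero,
    zero_add]
  rfl

theorem tendsto_sqSum_three : Tendsto (fun n => sqSum 3 n) atTop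
    (𝓝 ((Real.pi ^ 2 / 6 - 5 / 4 : ℝ) : ℂ)) := by
  have h1 := (Complex.continuous_ofReal.tendsto _).comp
    ((tendsto_harm2.comp (tendsto_add_atTop_nat 1)).sub_const 1)
  have h2 : Tendsto (fun n : ℕ => 1 / ((n : ℂ) + 2) ^ 2) atTop (𝓝 0) := by
    rw [tendsto_zero_iff_norm_tendsto_zero]
    refine squeeze_zero (fun n => norm_nonneg _) (fun n => ?_)
      (tendsto_one_div_add_atTop_nhds_zero_nat (𝕜 := ℝ))
    have : ‖(n : ℂ) + 2‖ = (n : ℝ) + 2 := by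
      rw [show (n : ℂ) + 2 = (((n : ℝ) + 2 : ℝ) : ℂ) by push_cast; rfl, Complex.norm_real,
        Real.norm_of_nonneg (by positivity)]
    rw [norm_div, norm_pow, this, norm_one]
    gcongr
    nlinarith [(Nat.cast_nonneg n : (0 : ℝ) ≤ n)]
  have h3 := (h1.sub_const (1 / 4)).add h2
  rw [show ((Real.pi ^ 2 / 6 - 1 : ℝ) : ℂ) - 1 / 4 + 0 = ((Real.pi ^ 2 / 6 - 5 / 4 : ℝ) : ℂ) by
    push_cast; ring] at h3
  exact h3.congr fun n => by rw [sqSum_three, sqSum_two]; rfl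

theorem factorial_div_risingProd_three (hm : 1 ≤ m) :
    (m.factorial : ℂ) / risingProd m 3 = 2 / ((m : ℂ) + 1) := by
  rw [show (3 : ℂ) = 2 + 1 by norm_num,
    factorial_div_risingProd_add_one hm (by simp) (indicial_two hm)]
  congr 1
  ring

/-- The solution of the recurrence for the leading part of the second moment of the path length. -/
def pathTerm (m : ℕ) : ℕ → ℂ :=
  (4 * (occ m : ℂ) ^ 2) • ((2 : ℂ) • negBinomD2 3 +
    (-4 * harmSum 3 (m - 1) * ((m + 1) / (m - 1)) : ℂ) • negBinomD 3 +
    (2 * ((m + 1) / (m - 1)) * (harmSum 3 (m - 1) ^ 2 + sqSum 3 (m - 1)) +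
      8 * ((m + 1) / (m - 1)) * harmSum 3 (m - 1) ^ 2 / (m - 1) : ℂ) • negBinom 3) +
  (8 * (occ m : ℂ)) • (((m + 1) / (m - 1) : ℂ) • negBinomD 3 -
    (2 * (m + 1) / (m - 1) ^ 2 * harmSum 3 (m - 1) : ℂ) • negBinom 3) +
  ((4 * occ m - 2) * ((m + 1) / (m - 1)) : ℂ) • negBinom 3

/-- On the span of `negBinom 3` and its two derivatives T is triangular with eigenvalue 2/(m+1), so
I - T can be inverted explicitly. The last two tolls are the leading parts of 2(n+1)k and -(n+1)^2.
-/
theorem pathTerm_sub_splitSum (hm : 2 ≤ m) {n : ℕ} (hn : m - 1 ≤ n) :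
    pathTerm m n - splitSum m (pathTerm m) n =
      4 * occ m ^ 2 * splitPair m (negBinomD 2) (negBinomD 2) n + 8 * occ m * negBinomD 3 n +
        (4 * occ m - 2) * negBinom 3 n := by
  have hm1 := natCast_sub_one_ne_zero hm
  have hm2 : (m : ℂ) + 1 ≠ 0 := by exact_mod_cast Nat.succ_ne_zero m
  rw [splitPair_negBinomD_negBinomD hm (by simp) (by simp) (by norm_num [Complex.add_re]),
    show (2 : ℂ) + 2 - 1 = 3 by norm_num, pathTerm]
  simp only [splitSum_add, splitSum_sub, splitSum_smul]
  simp only [Pi.add_apply, Pi.sub_apply, Pi.smul_apply, smul_eq_mul]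
  rw [splitSum_negBinom (by omega) hn (risingProd_ne_zero (by simp) m),
    splitSum_negBinomD (by omega) hn (by simp), splitSum_negBinomD2 (by omega) hn (by simp),
    factorial_div_risingProd_three (by omega)]
  generalize harmSum 3 (m - 1) = L
  generalize sqSum 3 (m - 1) = M
  field_simp
  ring

/-- After subtracting the squared mean, the n^2 log^2 n and n^2 log n terms cancel. The constant C_K
appears because ∑ 1/j^2 over j ≥ 3 is π^2/6 - 5/4; the rest is of smaller order than n^2. -/
theorem pathTerm_sub_sq (hm : 3 ≤ m) (n : ℕ) :
    pathTerm m n - 4 * occ m ^ 2 * (negBinomD 2 n * negBinomD 2 n) =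
      2 * constK m * negBinom 3 n -
      8 * occ m ^ 2 * ((sqSum 3 n - (Real.pi ^ 2 / 6 - 5 / 4 : ℝ)) * negBinom 3 n) +
      4 * occ m ^ 2 * ((n + 1) * (harmSum 2 n * harmSum 2 n) + 2 * ((n + 1) * harmSum 2 n) +
        (n + 1) / (n + 2)) := by
  have hm1 := natCast_sub_one_ne_zero (m := m) (by omega)
  have hm2 : (m : ℂ) + 1 ≠ 0 := by exact_mod_cast Nat.succ_ne_zero m
  have hn2 : (n : ℂ) + 2 ≠ 0 := by exact_mod_cast Nat.succ_ne_zero (n + 1)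
  have hφ : (occ m : ℂ) ≠ 0 := by exact_mod_cast (occ_pos hm).ne'
  have h1 := two_mul_occ_mul_harmSum hm
  have h2 : harmSum 2 (m - 1) = 1 / (2 * occ m) := by
    field_simp
    linear_combination h1
  have h3 : harmSum 3 (m - 1) = 1 / (2 * occ m) - 1 / 2 + 1 / ((m : ℂ) + 1) := by
    rw [harmSum_three, h2, Nat.cast_sub (by omega)]
    push_cast
    ring
  have h4 : sqSum 3 (m - 1) = harm2 m - 5 / 4 + 1 / ((m : ℂ) + 1) ^ 2 := by
    rw [sqSum_three, sqSum_two, Nat.cast_sub (by omega), show m - 1 + 1 = m by omega]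
    push_cast
    ring
  rw [pathTerm, constK]
  simp only [Pi.add_apply, Pi.sub_apply, Pi.smul_apply, smul_eq_mul]
  rw [h3, h4, negBinomD2, negBinomD, negBinomD, harmSum_three n, negBinom_three, negBinom_two]
  generalize harmSum 2 n = h
  generalize sqSum 3 n = s
  push_cast
  field_simp
  ring

theorem isLittleO_variance_path (hm : 3 ≤ m) {u q k c r : ℕ → ℝ} {e : ℂ → ℂ}
    (H : IsMomentSystem m u k q c r e) {g : ℝ} {G : ℕ → ℂ} (hg : g < 1) (hg0 : 0 ≤ g)
    (hk : (fun n => (k n : ℂ)) = (2 * (occ m : ℂ)) • negBinomD 2 + G)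
    (hG : G =O[atTop] fun n : ℕ => (n : ℝ) ^ g) :
    (fun n => ((r n - k n * k n : ℝ) : ℂ) - constK m * (n : ℂ) ^ (2 : ℂ)) =o[atTop]
        fun n : ℕ => (n : ℝ) ^ (2 : ℝ) := by
  obtain ⟨δ, hδ, hδ1, hδ2⟩ : ∃ δ > 0, g + (1 + δ) < 2 ∧ δ < 1 / 2 :=
    ⟨min ((1 - g) / 2) (1 / 4), lt_min (by linarith) (by norm_num),
      by linarith [min_le_left ((1 - g) / 2) (1 / 4)],
      by linarith [min_le_right ((1 - g) / 2) (1 / 4)]⟩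
  have hDO : negBinomD 2 =O[atTop] fun n : ℕ => (n : ℝ) ^ (1 + δ) :=
    isBigO_negBinomD (by simp) (by rw [Complex.re_ofNat]; linarith)
  set Y : ℕ → ℂ := (2 * (occ m : ℂ)) • negBinomD 2 with hY
  have hYO : Y =O[atTop] fun n : ℕ => (n : ℝ) ^ (1 + δ) := hDO.const_smul_left _
  have hKO : (fun n => (k n : ℂ)) =O[atTop] fun n : ℕ => (n : ℝ) ^ (1 + δ) := by
    rw [hk]; exact hYO.add (hG.trans (isBigO_natCast_rpow (by linarith)))
  have hYG : (Y + G) =O[atTop] fun n : ℕ => (n : ℝ) ^ (1 + δ) := by rw [← hk]; exact hKO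
  clear_value Y
  have hpn : ∀ᶠ n in atTop, pathTerm m n - splitSum m (pathTerm m) n =
      splitPair m Y Y n + (8 * occ m * negBinomD 3 n + (4 * occ m - 2) * negBinom 3 n) := by
    filter_upwards [eventually_ge_atTop (m - 1)] with n hn
    rw [pathTerm_sub_splitSum (by omega) hn, hY]
    simp only [splitPair_smul_left, splitPair_smul_right]
    simp only [Pi.smul_apply, smul_eq_mul]
    ring
  have hrn : ∀ᶠ n in atTop, (fun n => (r n : ℂ)) n - splitSum m (fun n => (r n : ℂ)) n =
      splitPair m (Y + G) (Y + G) n + 2 * ((n : ℂ) + 1) * k n - ((n : ℂ) + 1) ^ 2 := by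
    filter_upwards [eventually_ge_atTop (m - 1)] with n hn
    rw [← hk, ← ofReal_splitSum hn, ← ofReal_splitPair hn]
    have := congrArg (fun x : ℝ => (x : ℂ)) (H.path_sq n hn)
    push_cast at this
    linear_combination this
  have hnO : (fun n : ℕ => (n : ℂ) + 1) =o[atTop] fun n : ℕ => (n : ℝ) ^ (2 : ℝ) :=
    isLittleO_of_isBigO_lt isBigO_natCast_add_one (by norm_num)
  have hhO : harmSum 2 =O[atTop] fun n : ℕ => (n : ℝ) ^ δ := isBigO_harmSum (by simp) hδ
  have hD2 : negBinomD 2 =o[atTop] fun n : ℕ => (n : ℝ) ^ (2 : ℝ) :=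
    isLittleO_of_isBigO_lt hDO (by linarith)
  have htoll : (fun n => splitPair m (Y + G) (Y + G) n + 2 * ((n : ℂ) + 1) * k n -
      ((n : ℂ) + 1) ^ 2 - (splitPair m Y Y n +
        (8 * occ m * negBinomD 3 n + (4 * occ m - 2) * negBinom 3 n))) =o[atTop]
        fun n : ℕ => (n : ℝ) ^ (2 : ℝ) := by
    have e1 := isLittleO_of_isBigO_lt (isBigO_splitPair (m := m) (by omega) (by linarith)
      (by linarith) (by linarith) hG hYG le_rfl) hδ1
    have e2 := isLittleO_of_isBigO_lt (isBigO_splitPair (m := m) (by omega) (by linarith)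
      (by linarith) (by linarith) hG hYO le_rfl) hδ1
    have e3 := (isLittleO_of_isBigO_lt (isBigO_mul_rpow isBigO_natCast_add_one hG
      le_rfl) (show 1 + g < 2 by linarith)).const_mul_left 2
    have e4 := hD2.const_mul_left (-4 * occ m : ℂ)
    have e5 := hnO.const_mul_left (1 - 4 * occ m : ℂ)
    refine ((((e1.add e2).add e3).add e4).add e5).congr_left fun n => ?_
    have := congrFun hk n
    simp only [hY, Pi.add_apply, Pi.smul_apply, smul_eq_mul] at this
    have hn2 : (n : ℂ) + 2 ≠ 0 := by exact_mod_cast Nat.succ_ne_zero (n + 1)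
    rw [splitPair_add_left m Y G (Y + G), splitPair_add_right m Y Y G, splitPair_comm m Y G, this,
      negBinomD, negBinomD, negBinom_two, negBinom_three, harmSum_three]
    simp only [Pi.add_apply]
    field_simp
    ring
  have h1 := isLittleO_sub_of_splitSum hm (by norm_num) hrn hpn htoll
  have h2 : (fun n => (k n : ℂ) * k n - Y n * Y n) =o[atTop]
      fun n : ℕ => (n : ℝ) ^ (2 : ℝ) := by
    have e1 := isLittleO_of_isBigO_lt (isBigO_mul_rpow hG hKO le_rfl) hδ1
    have e2 := isLittleO_of_isBigO_lt (isBigO_mul_rpow hG hYO le_rfl) hδ1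
    refine (e1.add e2).congr_left fun n => ?_
    have t2 := congrFun hk n
    simp only [Pi.add_apply] at t2
    rw [t2]
    ring
  have h3 : (fun n => pathTerm m n - 4 * occ m ^ 2 * (negBinomD 2 n * negBinomD 2 n) -
      2 * constK m * negBinom 3 n) =o[atTop] fun n : ℕ => (n : ℝ) ^ (2 : ℝ) := by
    have e0 : (fun n => sqSum 3 n - (Real.pi ^ 2 / 6 - 5 / 4 : ℝ)) =o[atTop]
        fun n : ℕ => (n : ℝ) ^ (0 : ℝ) := by
      simp only [Real.rpow_zero]
      rw [Asymptotics.isLittleO_one_iff]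
      exact tendsto_sub_nhds_zero_iff.2 tendsto_sqSum_three
    have e1 := isLittleO_mul_rpow e0 (isBigO_negBinom (μ := 3) (s := 2) (by simp; norm_num))
    rw [zero_add] at e1
    have e2 := isLittleO_of_isBigO_lt (isBigO_mul_rpow isBigO_natCast_add_one
      (isBigO_mul_rpow hhO hhO le_rfl) le_rfl) (show 1 + (δ + δ) < 2 by linarith)
    have e3 := isLittleO_of_isBigO_lt (isBigO_mul_rpow isBigO_natCast_add_one hhO le_rfl)
      (show 1 + δ < 2 by linarith)
    have e4 : (fun n : ℕ => ((n : ℂ) + 1) / (n + 2)) =o[atTop] fun n : ℕ => (n : ℝ) ^ (2 : ℝ) := by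
      refine Asymptotics.IsBigO.trans_isLittleO ?_ hnO
      refine Asymptotics.IsBigO.of_bound 1 (Eventually.of_forall fun n => ?_)
      have : ‖(n : ℂ) + 2‖ = (n : ℝ) + 2 := by
        rw [show (n : ℂ) + 2 = (((n : ℝ) + 2 : ℝ) : ℂ) by push_cast; rfl, Complex.norm_real,
          Real.norm_of_nonneg (by positivity)]
      rw [norm_div, this, one_mul]
      exact div_le_self (norm_nonneg _) (by linarith [(Nat.cast_nonneg n : (0 : ℝ) ≤ n)])
    refine ((e1.const_mul_left (-(8 * occ m ^ 2) : ℂ)).add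
      (((e2.add (e3.const_mul_left 2)).add e4).const_mul_left (4 * occ m ^ 2 : ℂ))).congr_left
      fun n => ?_
    rw [pathTerm_sub_sq hm]
    ring
  have h4 := (isLittleO_negBinom_sub_cpow 3).const_mul_left (2 * constK m : ℂ)
  rw [show Complex.re 3 - 1 = 2 by simp; norm_num, show (3 : ℂ) - 1 = 2 by norm_num] at h4
  have hΓ : Complex.Gamma 3 = 2 := by
    rw [show (3 : ℂ) = (2 : ℕ) + 1 by norm_num, Complex.Gamma_nat_eq_factorial]
    norm_num
  refine (((h1.sub h2).add h3).add h4).congr_left fun n => ?_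
  simp only [hY, Pi.smul_apply, smul_eq_mul, hΓ]
  push_cast
  ring

theorem tendsto_variance_path (hm : 3 ≤ m) {u q k c r : ℕ → ℝ} {e : ℂ → ℂ}
    (H : IsMomentSystem m u k q c r e) {g : ℝ} {G : ℕ → ℂ} (hg : g < 1) (hg0 : 0 ≤ g)
    (hk : (fun n => (k n : ℂ)) = (2 * (occ m : ℂ)) • negBinomD 2 + G)
    (hG : G =O[atTop] fun n : ℕ => (n : ℝ) ^ g) :
    Tendsto (fun n : ℕ => (r n - k n * k n) / (n : ℝ) ^ (2 : ℝ)) atTop (𝓝 (constK m)) := by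
  have h := isLittleO_variance_path hm H hg hg0 hk hG
  have h1 := (Asymptotics.isLittleO_norm_norm.2 h).tendsto_div_nhds_zero
  rw [← tendsto_sub_nhds_zero_iff, tendsto_zero_iff_norm_tendsto_zero]
  refine h1.congr' ?_
  filter_upwards [eventually_gt_atTop 0] with n hn
  have hn'' : (0 : ℝ) < n := by exact_mod_cast hn
  have hp : 0 < (n : ℝ) ^ (2 : ℝ) := by positivity
  have e1 : (n : ℂ) ^ (2 : ℂ) = (((n : ℝ) ^ (2 : ℝ) : ℝ) : ℂ) := by
    rw [Complex.ofReal_cpow hn''.le]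
    push_cast
    rfl
  rw [e1, ← Complex.ofReal_mul, ← Complex.ofReal_sub, Complex.norm_real, ← norm_div, sub_div,
    mul_div_cancel_right₀ _ hp.ne']

/-- Telescoping: 1/(n+1)^2 ≤ 1/(n+1/2) - 1/(n+3/2), so the right-hand side decreases to its limit
π^2/6. -/
theorem pi_sq_le_harm2_add (n : ℕ) : Real.pi ^ 2 / 6 ≤ harm2 n + 1 / ((n : ℝ) + 1 / 2) := by
  have h1 : Tendsto (fun n : ℕ => harm2 n + 1 / ((n : ℝ) + 1 / 2)) atTop
      (𝓝 (Real.pi ^ 2 / 6 + 0)) := by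
    refine tendsto_harm2.add ?_
    simp only [one_div]
    exact (tendsto_natCast_atTop_atTop.atTop_add tendsto_const_nhds).inv_tendsto_atTop
  rw [add_zero] at h1
  refine (antitone_nat_of_succ_le fun n => ?_).le_of_tendsto h1 n
  rw [harm2, Finset.sum_Icc_succ_top (by omega), ← harm2]
  have h2 : 1 / ((n : ℝ) + 1) ^ 2 ≤ 1 / ((n : ℝ) + 1 / 2) - 1 / ((n : ℝ) + 1 + 1 / 2) := by
    rw [div_sub_div _ _ (by positivity) (by positivity), div_le_div_iff₀ (by positivity)
      (by positivity)]
    nlinarith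
  push_cast
  linarith

theorem constK_pos (hm : 3 ≤ m) : 0 < constK m := by
  have h1 := pi_sq_le_harm2_add m
  have hm' : (3 : ℝ) ≤ m := by exact_mod_cast hm
  have h2 := Real.pi_gt_d2
  -- The worst case is m = 3; positivity of C_K then reduces to π^2/3 > 2 + 8/7.
  have h3 : ((m : ℝ) + 1) * (1 / ((m : ℝ) + 1 / 2)) ≤ 8 / 7 := by
    rw [mul_one_div, div_le_div_iff₀ (by positivity) (by norm_num)]
    linarith
  have h4 : (1 : ℝ) + 2 / 7 < Real.pi ^ 2 / 3 - 2 + 1 / 7 := by nlinarith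
  have h5 := occ_pos hm
  rw [constK]
  refine mul_pos (by positivity) ?_
  rw [sub_pos, lt_div_iff₀ (by linarith)]
  have h6 := mul_le_mul_of_nonneg_left h1 (show (0 : ℝ) ≤ (m : ℝ) + 1 by positivity)
  nlinarith

end PathVariance

end

/-! ### A linear lower bound for the variance of the space requirement -/

noncomputable section

section SplitCov

variable {m : ℕ}

/-- The covariance of `∑ a (Iᵢ)` and `∑ b (Iᵢ)`, where `(I₁, …, I_m)` are the sizes of the
subtrees. -/
def splitCov {𝕜 : Type*} [Field 𝕜] (m : ℕ) (a b : ℕ → 𝕜) (n : ℕ) : 𝕜 :=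
  splitPair m a b n + splitSum m (a * b) n - splitSum m a n * splitSum m b n

theorem splitCov_comm {𝕜 : Type*} [Field 𝕜] [CharZero 𝕜] (a b : ℕ → 𝕜) :
    splitCov m a b = splitCov m b a := by
  funext n
  rw [splitCov, splitCov, splitPair_comm, mul_comm a b]
  ring

theorem splitCov_add_left {𝕜 : Type*} [Field 𝕜] [CharZero 𝕜] (a b c : ℕ → 𝕜) :
    splitCov m (a + b) c = splitCov m a c + splitCov m b c := by
  funext n
  simp only [splitCov, splitPair_add_left, add_mul, splitSum_add, Pi.add_apply]
  ring

theorem splitCov_smul_left {𝕜 : Type*} [Field 𝕜] [CharZero 𝕜] (t : 𝕜) (a b : ℕ → 𝕜) :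
    splitCov m (t • a) b = t • splitCov m a b := by
  funext n
  simp only [splitCov, splitPair_smul_left, smul_mul_assoc, splitSum_smul, Pi.smul_apply,
    smul_eq_mul]
  ring

/-- It is the average of the square of ∑ a(I_i) minus its mean `t`, over arrangements of n keys. -/
theorem splitCov_self_nonneg (hm : 2 ≤ m) {n : ℕ} (hn : m - 1 ≤ n) (a : ℕ → ℝ) :
    0 ≤ splitCov m a a n := by
  have hlen : ∀ b : ℕ → ℝ, ∀ C : Finset (Fin n), arrAvg C.card C (fun l => b l.length) = b C.card := by
    intro b C
    rw [arrAvg_congr rfl (g := fun _ => b C.card) fun l hl hlC => by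
      rw [length_of_toFinset hl hlC], arrAvg_const rfl]
  have h1 := arrAvg_sum_cell hm hn (s := (Finset.univ : Finset (Fin n))) (by simp)
    (fun l => a l.length) a fun C _ => hlen a C
  have h2 := arrAvg_sum_cell hm hn (s := (Finset.univ : Finset (Fin n))) (by simp)
    (fun l => a l.length * a l.length) (a * a) fun C _ => hlen (a * a) C
  have h3 := arrAvg_pair_cell hm hn (s := (Finset.univ : Finset (Fin n))) (by simp)
    (fun l => a l.length) (fun l => a l.length) a a (fun C _ => hlen a C) fun C _ => hlen a C
  set t := splitSum m a n with ht
  have h4 : 0 ≤ arrAvg n (Finset.univ : Finset (Fin n)) (fun l =>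
      (∑ i ∈ Finset.range m, a (cell m l i).length - t) ^ 2) :=
    arrAvg_nonneg fun l => sq_nonneg _
  have h5 : ∀ l : List (Fin n), (∑ i ∈ Finset.range m, a (cell m l i).length - t) ^ 2 =
      (∑ i ∈ Finset.range m, ∑ k ∈ (Finset.range m).erase i,
        a (cell m l i).length * a (cell m l k).length) +
      (∑ i ∈ Finset.range m, a (cell m l i).length * a (cell m l i).length) +
      ((-2 * t) * ∑ i ∈ Finset.range m, a (cell m l i).length) + t ^ 2 := by
    intro l
    rw [sub_sq, sq (∑ i ∈ Finset.range m, a (cell m l i).length), Finset.sum_mul_sum,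
      ← Finset.sum_add_distrib]
    rw [Finset.sum_congr rfl fun i hi => (Finset.sum_erase_add (Finset.range m)
      (fun k => a (cell m l i).length * a (cell m l k).length) hi).symm]
    ring
  simp only [h5] at h4
  rw [arrAvg_add, arrAvg_add, arrAvg_add, arrAvg_const_mul, arrAvg_const (by simp), h1, h2, h3] at h4
  rw [splitCov, ← ht]
  linarith

/-- Cauchy-Schwarz, from the discriminant of the nonnegative quadratic in t given by the variance of
a + t b. -/
theorem sq_splitCov_le (hm : 2 ≤ m) {n : ℕ} (hn : m - 1 ≤ n) (a b : ℕ → ℝ) :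
    splitCov m a b n ^ 2 ≤ splitCov m a a n * splitCov m b b n := by
  have h : ∀ t : ℝ, 0 ≤ splitCov m b b n * (t * t) + 2 * splitCov m a b n * t +
      splitCov m a a n := by
    intro t
    have := splitCov_self_nonneg hm hn (a + t • b)
    rw [splitCov_add_left, splitCov_smul_left, splitCov_comm a, splitCov_comm b,
      splitCov_add_left, splitCov_add_left, splitCov_smul_left, splitCov_smul_left,
      splitCov_comm b a] at this
    simp only [Pi.add_apply, Pi.smul_apply, smul_eq_mul] at this
    linarith
  have := discrim_le_zero h
  rw [discrim] at this
  linarith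

theorem splitSum_nonneg {n : ℕ} (hn : m - 1 ≤ n) {a : ℕ → ℝ} (h : ∀ k, 0 ≤ a k) :
    0 ≤ splitSum m a n := by
  have := splitSum_mono hn (a := (0 : ℝ) • a) (b := a) fun k _ => by simpa using h k
  rwa [splitSum_smul, zero_smul] at this

/-- Decomposition of the variance given the subtree sizes: the conditional variance averages to T of
the variance, and the conditional mean ∑ u(I_i) contributes `splitCov`. -/
theorem IsMomentSystem.variance_sub {u q k c r : ℕ → ℝ} {e : ℂ → ℂ}
    (H : IsMomentSystem m u k q c r e) {n : ℕ} (hn : m - 1 ≤ n) :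
    (q n - u n * u n) - splitSum m (q - u * u) n = splitCov m u u n := by
  rw [splitSum_sub, Pi.sub_apply, splitCov, H.splitSum_space n hn]
  linarith [H.space_sq n hn]

theorem IsMomentSystem.variance_nonneg {u q k c r : ℕ → ℝ} {e : ℂ → ℂ}
    (H : IsMomentSystem m u k q c r e) (n : ℕ) : 0 ≤ q n - u n * u n := by
  rw [← H.variance_space]
  exact ProbabilityTheory.variance_nonneg _ _

theorem IsMomentSystem.splitSum_variance_le (hm : 2 ≤ m) {u q k c r : ℕ → ℝ} {e : ℂ → ℂ}
    (H : IsMomentSystem m u k q c r e) {n : ℕ} (hn : m - 1 ≤ n) :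
    splitSum m (q - u * u) n ≤ q n - u n * u n := by
  linarith [H.variance_sub hn, splitCov_self_nonneg hm hn u]

theorem IsMomentSystem.splitCov_le_variance {u q k c r : ℕ → ℝ} {e : ℂ → ℂ}
    (H : IsMomentSystem m u k q c r e) {n : ℕ} (hn : m - 1 ≤ n) :
    splitCov m u u n ≤ q n - u n * u n := by
  have h : 0 ≤ splitSum m (q - u * u) n := splitSum_nonneg hn fun k => H.variance_nonneg k
  linarith [H.variance_sub hn]

theorem IsMomentSystem.space_of_lt (hm : 3 ≤ m) {u q k c r : ℕ → ℝ} {e : ℂ → ℂ}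
    (H : IsMomentSystem m u k q c r e) {n : ℕ} (hn : n < m) :
    u n = (if n = 0 then 0 else 1) + 1 / ((m : ℝ) - 1) - occ m * (n + 1) := by
  have h1 := sum_coeffA_negBinom hm hn
  have h2 := congrFun H.space_eq n
  rw [← Finset.add_sum_erase _ _ (two_mem_indicialRoots (show 2 ≤ m by omega)), coeffA_two hm,
    negBinom_two] at h1
  rw [Finset.sum_apply] at h2
  simp only [Pi.smul_apply, smul_eq_mul] at h2
  rw [← h2] at h1
  apply Complex.ofReal_injective
  push_cast
  split_ifs at h1 ⊢ <;> push_cast <;> linear_combination h1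

/-- With m + 1 keys two keys are left for the subtrees. They share a subtree with probability p =
2/(m+1), which decides between 2 and 3 nodes, so the variance is p(1-p). -/
theorem IsMomentSystem.variance_pos_add_one (hm : 3 ≤ m) {u q k c r : ℕ → ℝ} {e : ℂ → ℂ}
    (H : IsMomentSystem m u k q c r e) : 0 < q (m + 1) - u (m + 1) * u (m + 1) := by
  refine lt_of_lt_of_le ?_ (H.splitCov_le_variance (show m - 1 ≤ m + 1 by omega))
  have hm' : (3 : ℝ) ≤ m := by exact_mod_cast hm
  have hc : (((m + 1).choose (m - 1) : ℕ) : ℝ) = ((m : ℝ) + 1) * m / 2 := by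
    rw [show m - 1 = m + 1 - 2 by omega, Nat.choose_symm (by omega), Nat.cast_choose_two]
    push_cast
    ring
  have x1 : ∀ w : ℝ, negBinom w 1 = w := fun w => by simp [negBinom]
  have x2 : ∀ w : ℝ, negBinom w 2 = w * (w + 1) / 2 := fun w => by
    simp [negBinom, Finset.prod_range_succ]
  have key : splitCov m u u (m + 1) = 2 * (m - 1) / ((m : ℝ) + 1) ^ 2 := by
    have u0 := H.space_of_lt hm (n := 0) (by omega)
    have u1 := H.space_of_lt hm (n := 1) (by omega)
    have u2 := H.space_of_lt hm (n := 2) (by omega)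
    norm_num at u0 u1 u2
    rw [splitCov, splitPair_eq (by omega), splitSum_eq (by omega), splitSum_eq (by omega), hc,
      show m + 1 - (m - 1) = 2 by omega]
    simp only [Finset.Nat.sum_antidiagonal_eq_sum_range_succ_mk, Finset.sum_range_succ,
      Finset.sum_range_zero]
    simp [x1, x2]
    rw [u0, u1, u2, Nat.cast_sub (by omega), Nat.cast_sub (by omega)]
    have : (m : ℝ) - 1 ≠ 0 := by linarith
    push_cast
    field_simp
    ring
  rw [key]
  exact div_pos (by linarith) (by positivity)

theorem splitSum_pos (hm : 2 ≤ m) {n : ℕ} (hn : m - 1 ≤ n) {a : ℕ → ℝ} (h : ∀ k, 0 ≤ a k) {j : ℕ}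
    (hj : j ≤ n - (m - 1)) (hpos : 0 < a j) : 0 < splitSum m a n := by
  have hm1 : (0 : ℝ) < ((m - 1 : ℕ) : ℝ) := by exact_mod_cast (by omega : 0 < m - 1)
  rw [splitSum_eq hn]
  refine mul_pos (div_pos (by positivity) (by exact_mod_cast Nat.choose_pos hn)) ?_
  refine Finset.sum_pos' (fun p _ => mul_nonneg (h _) (negBinom_pos hm1 _).le)
    ⟨(j, n - (m - 1) - j), by simp; omega, mul_pos hpos (negBinom_pos hm1 _)⟩

theorem risingProd_three_halves_lt (hm : 2 ≤ m) : risingProd m (3 / 2 : ℝ) < m.factorial := by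
  rw [← risingProd_two m (by omega), risingProd, risingProd]
  refine Finset.prod_lt_prod_of_nonempty (fun j _ => by positivity) (fun j _ => by norm_num)
    (by simp; omega)

theorem tendsto_negBinom_three_halves : Tendsto (negBinom (3 / 2 : ℝ)) atTop atTop := by
  have h1 := tendsto_negBinom_div_rpow (σ := 3 / 2)
  have h2 := (tendsto_rpow_atTop (show (0 : ℝ) < 3 / 2 - 1 by norm_num)).comp
    tendsto_natCast_atTop_atTop
  refine (h1.pos_mul_atTop (inv_pos.2 (Real.Gamma_pos_of_pos (by norm_num))) h2).congr' ?_
  filter_upwards [eventually_gt_atTop 0] with n hn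
  have : (0 : ℝ) < n := by exact_mod_cast hn
  rw [Function.comp, div_mul_cancel₀ _ (by positivity)]

/-- The variance of the space requirement grows at least linearly. -/
theorem IsMomentSystem.exists_le_variance (hm : 3 ≤ m) {u q k c r : ℕ → ℝ} {e : ℂ → ℂ}
    (H : IsMomentSystem m u k q c r e) :
    ∃ C > 0, ∀ᶠ n : ℕ in atTop, C * n ≤ q n - u n * u n := by
  set v : ℕ → ℝ := q - u * u with hv
  have hvn : ∀ n, v n = q n - u n * u n := fun n => rfl
  have hv0 : ∀ n, 0 ≤ v n := fun n => H.variance_nonneg n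
  have hTv : ∀ n, m - 1 ≤ n → splitSum m v n ≤ v n := fun n hn =>
    H.splitSum_variance_le (by omega) hn
  have hvpos : ∀ n, 2 * m ≤ n → 0 < v n := fun n hn =>
    (splitSum_pos (by omega) (by omega) hv0 (j := m + 1) (by omega)
      (H.variance_pos_add_one hm)).trans_le (hTv n (by omega))
  set x : ℕ → ℝ := negBinom (3 / 2) with hx
  -- Large enough that the comparison sequence `f` below is nonpositive for n < 2m, where the
  -- variance may vanish.
  set D : ℝ := 2 * m + ∑ j ∈ Finset.range (2 * m), x j with hD
  have hx0 : ∀ n, 0 ≤ x n := fun n => negBinom_nonneg (by norm_num) n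
  set f : ℕ → ℝ := negBinom 2 + x - D • negBinom 1 with hf
  have hfn : ∀ n, f n = n + 1 + x n - D := fun n => by
    simp [hf, negBinom_two, negBinom_one]
  have hP0 : 0 < risingProd m (3 / 2 : ℝ) := Finset.prod_pos fun j _ => by positivity
  set θ : ℝ := m.factorial / risingProd m (3 / 2 : ℝ) with hθ
  have hθ1 : 1 < θ := (one_lt_div hP0).2 (risingProd_three_halves_lt (by omega))
  have hm0 : (m.factorial : ℝ) ≠ 0 := by positivity
  have hT1 : ∀ n, m - 1 ≤ n → splitSum m (negBinom (1 : ℝ)) n = m := by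
    intro n hn
    have h1 : risingProd m (1 : ℝ) = (m - 1).factorial := by
      rw [risingProd, ← Finset.prod_range_add_one_eq_factorial]
      push_cast
      exact Finset.prod_congr rfl fun j _ => by ring
    rw [splitSum_negBinom (by omega) hn (by rw [h1]; positivity), h1, negBinom_one, mul_one,
      ← Nat.mul_factorial_pred (by omega : m ≠ 0)]
    push_cast
    field_simp
  have hTf : ∀ n, m - 1 ≤ n → splitSum m f n = n + 1 + θ * x n - D * m := by
    intro n hn
    rw [hf, splitSum_sub, splitSum_add, splitSum_smul]
    simp only [Pi.sub_apply, Pi.add_apply, Pi.smul_apply, smul_eq_mul]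
    rw [hT1 n hn, splitSum_negBinom (by omega) hn hP0.ne', splitSum_negBinom (by omega) hn
      (by rw [risingProd_two m (by omega)]; exact hm0), risingProd_two m (by omega),
      div_self hm0, one_mul, negBinom_two]
  -- Beyond N the sequence satisfies f ≤ T f: T multiplies `negBinom (3 / 2)` by θ > 1, and this
  -- gain outweighs the constant D being multiplied by m. Since T v ≤ v for the variance v, a bound
  -- C f ≤ v on an initial stretch propagates.
  obtain ⟨N, hN⟩ := eventually_atTop.1 ((tendsto_negBinom_three_halves.eventually_ge_atTop
    (D * m / (θ - 1))).and (tendsto_negBinom_three_halves.eventually_ge_atTop D))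
  set M := N + 2 * m with hM
  obtain ⟨C, hC, hCv⟩ : ∃ C > 0, ∀ n < M, C * f n ≤ v n := by
    have hex : ∀ n, ∃ C > 0, ∀ C', C' ≤ C → 0 < C' → C' * f n ≤ v n := by
      intro n
      by_cases h : f n ≤ 0
      · exact ⟨1, one_pos, fun C' _ h0 => (mul_nonpos_of_nonneg_of_nonpos h0.le h).trans (hv0 n)⟩
      · rw [not_le] at h
        have h2 : 2 * m ≤ n := by
          by_contra hlt
          rw [not_le] at hlt
          have h3 := Finset.single_le_sum (f := x) (fun j _ => hx0 j) (Finset.mem_range.2 hlt)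
          have h4 : (n : ℝ) + 1 ≤ 2 * m := by exact_mod_cast hlt
          rw [hfn] at h
          linarith
        refine ⟨v n / f n, div_pos (hvpos n h2) h, fun C' hC' _ => ?_⟩
        rwa [le_div_iff₀ h] at hC'
    choose g hg hgv using hex
    have hne : (Finset.range (M + 1)).Nonempty := ⟨0, by simp⟩
    refine ⟨(Finset.range (M + 1)).inf' hne g, by
      rw [gt_iff_lt, Finset.lt_inf'_iff]; exact fun n _ => hg n, fun n hn => ?_⟩
    refine hgv n _ (Finset.inf'_le _ (Finset.mem_range.2 (by omega))) ?_
    rw [Finset.lt_inf'_iff]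
    exact fun n _ => hg n
  have hall : ∀ n, C * f n ≤ v n := by
    intro n
    induction n using Nat.strong_induction_on with
    | _ n ih =>
      by_cases hn : n < M
      · exact hCv n hn
      · have hn' : m - 1 ≤ n := by omega
        have h1 : splitSum m (C • f) n ≤ splitSum m v n :=
          splitSum_mono hn' fun k hk => ih k (by omega)
        rw [splitSum_smul, Pi.smul_apply, smul_eq_mul, hTf n hn'] at h1
        have h2 := (hN n (by omega)).1
        change _ ≤ x n at h2
        rw [div_le_iff₀ (by linarith)] at h2
        have hD0 : 0 ≤ D := add_nonneg (by positivity) (Finset.sum_nonneg fun j _ => hx0 j)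
        have h3 : f n ≤ n + 1 + θ * x n - D * m := by
          rw [hfn]
          nlinarith
        exact (mul_le_mul_of_nonneg_left h3 hC.le).trans (h1.trans (hTv n hn'))
  refine ⟨C, hC, eventually_atTop.2 ⟨N, fun n hn => ?_⟩⟩
  refine le_trans (mul_le_mul_of_nonneg_left ?_ hC.le) (hall n)
  rw [hfn]
  linarith [(hN n hn).2]

end SplitCov

end

/-! ### Positivity of F_1 -/

noncomputable section

section Positivity

variable {m : ℕ}

theorem isLittleO_splitSum (hm : 2 ≤ m) {a : ℕ → ℂ} {s : ℝ} (hs : 0 < s)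
    (ha : a =o[atTop] fun n : ℕ => (n : ℝ) ^ s) :
    splitSum m a =o[atTop] fun n : ℕ => (n : ℝ) ^ s := by
  set x : ℕ → ℝ := negBinom (s + 1) with hx
  have hxpos : ∀ n, 0 < x n := fun n => negBinom_pos (by linarith) n
  have h1 := isBigO_rpow_negBinom (σ := s + 1) (by linarith)
  rw [add_sub_cancel_right] at h1
  have hax : a =o[atTop] x := ha.trans_isBigO h1
  have hxs : x =O[atTop] fun n : ℕ => (n : ℝ) ^ s := by
    have := isBigO_negBinom_rpow ((s + 1 : ℝ) : ℂ)
    rw [Complex.ofReal_re, add_sub_cancel_right] at this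
    refine Asymptotics.isBigO_norm_left.1 (this.norm_left.congr_left fun n => ?_)
    rw [← ofReal_negBinom, Complex.norm_real]
  refine Asymptotics.IsLittleO.trans_isBigO ?_ hxs
  have hP : 0 < risingProd m (s + 1) := Finset.prod_pos fun j _ => by positivity
  have hP1 : 0 < risingProd m (1 : ℝ) := Finset.prod_pos fun j _ => by positivity
  set θ : ℝ := m.factorial / risingProd m (s + 1) with hθ
  have hθ0 : 0 < θ := div_pos (by positivity) hP
  rw [Asymptotics.isLittleO_iff]
  intro ε hε
  obtain ⟨N, hN⟩ := eventually_atTop.1 (Asymptotics.isLittleO_iff.1 hax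
    (show 0 < ε / (2 * θ) by positivity))
  set C := ∑ j ∈ Finset.range N, ‖a j‖ with hC
  have hC0 : 0 ≤ C := Finset.sum_nonneg fun j _ => norm_nonneg _
  have hle : ∀ n, ‖a n‖ ≤ ((ε / (2 * θ)) • x + C • negBinom (1 : ℝ)) n := by
    intro n
    simp only [Pi.add_apply, Pi.smul_apply, smul_eq_mul, negBinom_one, mul_one]
    by_cases hn : N ≤ n
    · have := hN n hn
      rw [Real.norm_of_nonneg (hxpos n).le] at this
      linarith
    · have h2 := Finset.single_le_sum (f := fun j => ‖a j‖) (fun j _ => norm_nonneg _)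
        (Finset.mem_range.2 (not_le.1 hn))
      have h3 : 0 < ε / (2 * θ) * x n := mul_pos (by positivity) (hxpos n)
      linarith
  have hconst : (fun _ : ℕ => C * (m.factorial / risingProd m (1 : ℝ))) =o[atTop] x := by
    refine Asymptotics.IsLittleO.trans_isBigO ?_ h1
    refine (Asymptotics.isLittleO_const_left.2 (Or.inr ?_))
    refine (tendsto_norm_atTop_atTop.comp ((tendsto_rpow_atTop hs).comp
      tendsto_natCast_atTop_atTop))
  filter_upwards [eventually_ge_atTop (m - 1), Asymptotics.isLittleO_iff.1 hconst (half_pos hε)]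
    with n hn h2
  have h3 := (norm_splitSum_le hn a).trans (splitSum_mono hn fun k _ => hle k)
  rw [splitSum_add, splitSum_smul, splitSum_smul] at h3
  simp only [Pi.add_apply, Pi.smul_apply, smul_eq_mul] at h3
  rw [splitSum_negBinom (by omega) hn hP.ne', splitSum_negBinom (by omega) hn hP1.ne',
    negBinom_one, mul_one] at h3
  rw [Real.norm_of_nonneg (hxpos n).le] at h2 ⊢
  have h4 := le_trans (le_abs_self _) h2
  have h5 : ε / (2 * θ) * (θ * x n) = ε / 2 * x n := by field_simp
  change ‖splitSum m a n‖ ≤ ε / (2 * θ) * (θ * x n) + _ at h3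
  linarith

theorem isBigO_splitSum (hm : 2 ≤ m) {a : ℕ → ℂ} {s : ℝ} (hs : -1 < s)
    (ha : a =O[atTop] fun n : ℕ => (n : ℝ) ^ s) :
    splitSum m a =O[atTop] fun n : ℕ => (n : ℝ) ^ s := by
  have h1 := isBigO_splitPair hm (t := 0) hs (by norm_num) (by linarith) ha
    (isBigO_negBinom (μ := 1) (by simp)) (by simp; rfl)
  have hm1 := natCast_sub_one_ne_zero hm
  refine (h1.const_mul_left ((m : ℂ) - 1)⁻¹).congr_left fun n => ?_
  rw [splitPair_eq_splitSum hm (c := a) (by rw [mk_one_eq_mk_negBinom])]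
  field_simp

/-- The coefficient of `n ^ (w + v - 2)` in `splitCov (negBinom w) (negBinom v)`. -/
def splitCoeff (m : ℕ) (w v : ℂ) : ℂ :=
  m.factorial / risingProd m (w + v - 1) *
      (((m : ℂ) - 1) * (Complex.Gamma (w + v - 1))⁻¹ + (Complex.Gamma w * Complex.Gamma v)⁻¹) -
    m.factorial / risingProd m w * (m.factorial / risingProd m v) *
      (Complex.Gamma w * Complex.Gamma v)⁻¹

/-- The product of the two binomial sequences is replaced by the multiple `t` of the eigenvector
`negBinom (w + v - 1)` with the same leading term; `isLittleO_splitSum` controls T of the error. -/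
theorem isLittleO_splitCov (hm : 2 ≤ m) {w v : ℂ} {s : ℝ} (hw : 0 < w.re) (hv : 0 < v.re)
    (hs : w.re + v.re - 2 = s) (hs0 : 0 < s) :
    (fun n => splitCov m (negBinom w) (negBinom v) n - splitCoeff m w v * (n : ℂ) ^ (w + v - 2))
      =o[atTop] fun n : ℕ => (n : ℝ) ^ s := by
  have hwv : 0 < (w + v - 1).re := by simp; linarith
  have h1 := isLittleO_negBinom_sub_cpow (w + v - 1)
  rw [show (w + v - 1).re - 1 = s by rw [← hs]; simp; ring,
    show w + v - 1 - 1 = w + v - 2 by ring] at h1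
  have h2 := isLittleO_negBinom_mul_negBinom_sub_cpow w v
  rw [hs] at h2
  have hΓ := Complex.Gamma_ne_zero_of_re_pos hwv
  set t : ℂ := (Complex.Gamma w * Complex.Gamma v)⁻¹ * Complex.Gamma (w + v - 1) with ht
  have h3 : (negBinom w * negBinom v - t • negBinom (w + v - 1)) =o[atTop]
      fun n : ℕ => (n : ℝ) ^ s := by
    refine (h2.sub (h1.const_mul_left t)).congr_left fun n => ?_
    simp only [Pi.sub_apply, Pi.mul_apply, Pi.smul_apply, smul_eq_mul, ht]
    field_simp
    ring
  have h4 := isLittleO_splitSum hm hs0 h3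
  set θ : ℂ := m.factorial / risingProd m (w + v - 1) with hθ
  have h5 := h1.const_mul_left (θ * ((m : ℂ) - 1 + t))
  have h6 := h2.const_mul_left (m.factorial / risingProd m w * (m.factorial / risingProd m v) : ℂ)
  refine ((h4.add h5).sub h6).congr' ?_ (EventuallyEq.refl _ _)
  filter_upwards [eventually_ge_atTop (m - 1)] with n hn
  rw [splitCov, splitSum_sub, Pi.sub_apply, splitSum_smul, Pi.smul_apply, splitPair_negBinom hm,
    splitSum_negBinom (by omega) hn (risingProd_ne_zero hwv m),
    splitSum_negBinom (by omega) hn (risingProd_ne_zero hw m),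
    splitSum_negBinom (by omega) hn (risingProd_ne_zero hv m), splitCoeff, ← hθ, smul_eq_mul]
  have h7 : t * (Complex.Gamma (w + v - 1))⁻¹ = (Complex.Gamma w * Complex.Gamma v)⁻¹ := by
    rw [ht, mul_assoc, mul_inv_cancel₀ hΓ, mul_one]
  linear_combination (-(θ * (n : ℂ) ^ (w + v - 2))) * h7

theorem isBigO_splitCov (hm : 2 ≤ m) {a b : ℕ → ℂ} {s t r : ℝ} (hs : -1 < s) (ht : -1 < t)
    (hst : -1 < s + t) (ha : a =O[atTop] fun n : ℕ => (n : ℝ) ^ s)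
    (hb : b =O[atTop] fun n : ℕ => (n : ℝ) ^ t) (h : s + t ≤ r) :
    splitCov m a b =O[atTop] fun n : ℕ => (n : ℝ) ^ r := by
  have h1 := isBigO_splitPair hm hs ht hst ha hb h
  have h2 := isBigO_splitSum hm (s := r) (by linarith) (a := a * b) (isBigO_mul_rpow ha hb h)
  have h3 := isBigO_mul_rpow (isBigO_splitSum hm hs ha) (isBigO_splitSum hm ht hb) h
  exact (h1.add h2).sub h3

theorem ofReal_splitCov {n : ℕ} (hn : m - 1 ≤ n) (a b : ℕ → ℝ) :
    ((splitCov m a b n : ℝ) : ℂ) = splitCov m (fun k => (a k : ℂ)) (fun k => (b k : ℂ)) n := by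
  rw [splitCov, splitCov, Complex.ofReal_sub, Complex.ofReal_add, Complex.ofReal_mul,
    ofReal_splitSum hn, ofReal_splitSum hn, ofReal_splitSum hn, ofReal_splitPair hn]
  congr 3
  funext k
  simp

/-- Asymptotic inequalities along `β log n` hold everywhere, by density. -/
theorem nonneg_of_tendsto_log {g : ℝ → ℝ} (hc : Continuous g)
    (hper : Function.Periodic g (2 * Real.pi)) {β : ℝ} (hβ : 0 < β) {a : ℕ → ℝ}
    (h : ∀ᶠ n in atTop, 0 ≤ a n)
    (ht : Tendsto (fun n : ℕ => a n - g (β * Real.log n)) atTop (𝓝 0)) (z : ℝ) : 0 ≤ g z := by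
  -- With N_k the integer part of exp(y_k), the phase β log N_k equals z + 2πk up to o(1), so every
  -- phase is a limit along integers.
  set y : ℕ → ℝ := fun k => (z + k * (2 * Real.pi)) / β with hy
  have hy1 : Tendsto y atTop atTop := by
    refine Tendsto.atTop_div_const hβ (tendsto_atTop_add_const_left _ _ ?_)
    exact tendsto_natCast_atTop_atTop.atTop_mul_const (by positivity)
  have hexp : Tendsto (fun k => Real.exp (y k)) atTop atTop := Real.tendsto_exp_atTop.comp hy1
  set N : ℕ → ℕ := fun k => ⌊Real.exp (y k)⌋₊ with hN
  have hN1 : Tendsto N atTop atTop := tendsto_nat_floor_atTop.comp hexp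
  have h1 : Tendsto (fun k => Real.log (N k) - y k) atTop (𝓝 0) := by
    have h2 := (tendsto_nat_floor_div_atTop (R := ℝ)).comp hexp
    have h3 := (Real.continuousAt_log one_ne_zero).tendsto.comp h2
    rw [Real.log_one] at h3
    refine h3.congr' ?_
    filter_upwards [hN1.eventually_gt_atTop 0] with k hk
    have : (N k : ℝ) ≠ 0 := by exact_mod_cast hk.ne'
    rw [Function.comp, Function.comp, Real.log_div this (Real.exp_ne_zero _), Real.log_exp]
  have h4 : Tendsto (fun k => g (β * Real.log (N k))) atTop (𝓝 (g z)) := by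
    have h5 : Tendsto (fun k => β * (Real.log (N k) - y k) + z) atTop (𝓝 (β * 0 + z)) :=
      (h1.const_mul β).add_const z
    rw [mul_zero, zero_add] at h5
    refine ((hc.tendsto z).comp h5).congr fun k => ?_
    have : β * (Real.log (N k) - y k) + z = β * Real.log (N k) - k * (2 * Real.pi) := by
      simp only [hy]
      field_simp
      ring
    rw [Function.comp, this]
    exact hper.sub_nat_mul_eq k
  have h6 := (ht.comp hN1).add h4
  rw [zero_add] at h6
  refine ge_of_tendsto h6 ?_
  filter_upwards [hN1.eventually h] with k hk
  simpa using hk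

theorem Gamma_mul_splitCoeff {w v : ℂ} (hw : 0 < w.re) (hv : 1 < v.re)
    (h : indicial m w = 0) {p q r : ℂ}
    (hp : (m.factorial : ℂ) / risingProd m (w + v - 1) = p)
    (hq : (m.factorial : ℂ) / risingProd m v = q)
    (hr : Complex.Gamma (w + v - 1) = r * Complex.Gamma w) :
    Complex.Gamma w * splitCoeff m w v =
      p * ((m - 1) * r⁻¹ + (Complex.Gamma v)⁻¹) - q * (Complex.Gamma v)⁻¹ := by
  have hm0 : (m.factorial : ℂ) ≠ 0 := by exact_mod_cast m.factorial_ne_zero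
  have hP : risingProd m w = m.factorial := by rwa [indicial_eq, sub_eq_zero] at h
  have g1 := Complex.Gamma_ne_zero_of_re_pos hw
  have g2 := Complex.Gamma_ne_zero_of_re_pos (s := v) (by linarith)
  have g3 := Complex.Gamma_ne_zero_of_re_pos (s := w + v - 1) (by simp; linarith)
  have hr0 : r ≠ 0 := by rintro rfl; simp [hr] at g3
  rw [splitCoeff, hp, hq, hr, hP, div_self hm0]
  field_simp

theorem add_sub_one_ne_zero (hm : 1 ≤ m) {w : ℂ} (hw : 0 < w.re) : w + m - 1 ≠ 0 := by
  obtain ⟨k, rfl⟩ : ∃ k, m = k + 1 := ⟨m - 1, by omega⟩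
  have := add_natCast_ne_zero hw k
  push_cast
  rwa [add_sub_assoc, add_sub_cancel_right]

/-- For an integer test parameter all gamma and rising-product ratios at a zero of Λ are rational in
`w`. -/
theorem Gamma_mul_splitCoeff_three (hm : 1 ≤ m) {w : ℂ} (hw : 0 < w.re) (h : indicial m w = 0) :
    Complex.Gamma w * splitCoeff m w 3 = (m - 1) * (w - 1) * (w - 2) /
      (2 * (m + 1) * (w + m - 1) * (w + m)) := by
  have hm2 : (m : ℂ) + 1 ≠ 0 := by exact_mod_cast Nat.succ_ne_zero m
  have w0 : w ≠ 0 := by rintro rfl; simp at hw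
  have w1 : w + 1 ≠ 0 := by simpa using add_natCast_ne_zero hw 1
  have wm : w + m ≠ 0 := add_natCast_ne_zero hw m
  have wm1 := add_sub_one_ne_zero (m := m) (by omega) hw
  have hP : risingProd m w = m.factorial := by rwa [indicial_eq, sub_eq_zero] at h
  have hm0 : (m.factorial : ℂ) ≠ 0 := by exact_mod_cast m.factorial_ne_zero
  have r1 := risingProd_add_one (m := m) (by omega) w
  have r2 := risingProd_add_one (m := m) (by omega) (w + 1)
  have n2 := risingProd_ne_zero (w := w + 1 + 1) (by simp; linarith) m
  rw [hP] at r1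
  have hp : (m.factorial : ℂ) / risingProd m (w + 3 - 1) =
      w * (w + 1) / ((w + m - 1) * (w + m)) := by
    rw [show w + 3 - 1 = w + 1 + 1 by ring, div_eq_div_iff n2 (mul_ne_zero wm1 wm)]
    linear_combination (-(w + m)) * r1 - w * r2
  have hr : Complex.Gamma (w + 3 - 1) = w * (w + 1) * Complex.Gamma w := by
    rw [show w + 3 - 1 = w + 1 + 1 by ring, Complex.Gamma_add_one _ w1, Complex.Gamma_add_one _ w0]
    ring
  have hΓ : Complex.Gamma 3 = 2 := by
    rw [show (3 : ℂ) = (2 : ℕ) + 1 by norm_num, Complex.Gamma_nat_eq_factorial]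
    norm_num
  rw [Gamma_mul_splitCoeff hw (by simp) h hp (factorial_div_risingProd_three (by omega))
    hr, hΓ]
  field_simp
  ring

theorem Gamma_mul_splitCoeff_four (hm : 1 ≤ m) {w : ℂ} (hw : 0 < w.re) (h : indicial m w = 0) :
    Complex.Gamma w * splitCoeff m w 4 = (m - 1) * (w - 1) * (w - 2) *
      ((m + 4) * w + 6 * (m + 1)) /
      (6 * (m + 1) * (m + 2) * (w + m - 1) * (w + m) * (w + m + 1)) := by
  have hm2 : (m : ℂ) + 1 ≠ 0 := by exact_mod_cast Nat.succ_ne_zero m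
  have hm3 : (m : ℂ) + 2 ≠ 0 := by exact_mod_cast Nat.succ_ne_zero (m + 1)
  have w0 : w ≠ 0 := by rintro rfl; simp at hw
  have w1 : w + 1 ≠ 0 := by simpa using add_natCast_ne_zero hw 1
  have w2 : w + 2 ≠ 0 := by simpa using add_natCast_ne_zero hw 2
  have wm : w + m ≠ 0 := add_natCast_ne_zero hw m
  have wm1 := add_sub_one_ne_zero (m := m) (by omega) hw
  have wm2 : w + m + 1 ≠ 0 := by
    have := add_natCast_ne_zero hw (m + 1)
    push_cast at this
    rwa [← add_assoc] at this
  have hP : risingProd m w = m.factorial := by rwa [indicial_eq, sub_eq_zero] at h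
  have hm0 : (m.factorial : ℂ) ≠ 0 := by exact_mod_cast m.factorial_ne_zero
  have r1 := risingProd_add_one (m := m) (by omega) w
  have r2 := risingProd_add_one (m := m) (by omega) (w + 1)
  have r3 := risingProd_add_one (m := m) (by omega) (w + 1 + 1)
  have n2 := risingProd_ne_zero (w := w + 1 + 1 + 1) (by simp; linarith) m
  rw [hP] at r1
  have hp : (m.factorial : ℂ) / risingProd m (w + 4 - 1) =
      w * (w + 1) * (w + 2) / ((w + m - 1) * (w + m) * (w + m + 1)) := by
    rw [show w + 4 - 1 = w + 1 + 1 + 1 by ring,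
      div_eq_div_iff n2 (mul_ne_zero (mul_ne_zero wm1 wm) wm2)]
    linear_combination (-(w + m) * (w + m + 1)) * r1 - w * (w + m + 1) * r2 - w * (w + 1) * r3
  have hq : (m.factorial : ℂ) / risingProd m 4 = 6 / ((m + 1) * (m + 2)) := by
    have q1 := factorial_div_risingProd_three (m := m) (by omega)
    have q2 := risingProd_add_one (m := m) (by omega) 3
    rw [div_eq_div_iff (risingProd_ne_zero (by simp) m) hm2] at q1
    rw [show (3 : ℂ) + 1 = 4 by norm_num] at q2
    rw [div_eq_div_iff (risingProd_ne_zero (by simp) m) (mul_ne_zero hm2 hm3)]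
    linear_combination (m + 2 : ℂ) * q1 - 2 * q2
  have hr : Complex.Gamma (w + 4 - 1) = w * (w + 1) * (w + 2) * Complex.Gamma w := by
    rw [show w + 4 - 1 = w + 2 + 1 by ring, Complex.Gamma_add_one _ w2,
      show w + 2 = w + 1 + 1 by ring, Complex.Gamma_add_one _ w1, Complex.Gamma_add_one _ w0]
    ring
  have hΓ : Complex.Gamma 4 = 6 := by
    rw [show (4 : ℂ) = (3 : ℕ) + 1 by norm_num, Complex.Gamma_nat_eq_factorial]
    norm_num [Nat.factorial]
  rw [Gamma_mul_splitCoeff hw (by simp) h hp hq hr, hΓ]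
  field_simp
  ring

theorem coeffA_ne_zero (hm : 3 ≤ m) {w : ℂ} (h : indicial m w = 0) (h0 : w ≠ 0) (h1 : w ≠ 1) :
    coeffA m w ≠ 0 := by
  have h2 : ∑ j ∈ Finset.range (m - 1), 1 / ((j : ℂ) + w) = harmSum w (m - 1) :=
    Finset.sum_congr rfl fun j _ => by rw [add_comm]
  rw [coeffA, h2]
  exact one_div_ne_zero (mul_ne_zero (mul_ne_zero h0 (sub_ne_zero.2 h1))
    (harmSum_ne_zero_of_indicial hm h))

theorem splitCoeff_conj (w : ℂ) (x : ℝ) :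
    splitCoeff m (starRingEnd ℂ w) x = starRingEnd ℂ (splitCoeff m w x) := by
  have h : ∀ z : ℂ, risingProd m (starRingEnd ℂ z) = starRingEnd ℂ (risingProd m z) := fun z => by
    simp [risingProd]
  have e1 : starRingEnd ℂ w + x - 1 = starRingEnd ℂ (w + x - 1) := by simp
  have e2 : Complex.Gamma x = starRingEnd ℂ (Complex.Gamma x) := by
    rw [← Complex.Gamma_conj, Complex.conj_ofReal]
  have e3 : risingProd m (x : ℂ) = starRingEnd ℂ (risingProd m x) := by
    rw [← h, Complex.conj_ofReal]
  simp only [splitCoeff, map_mul, map_sub, map_add, map_div₀, map_inv₀, map_natCast, map_one]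
  rw [e1, h, h, Complex.Gamma_conj, Complex.Gamma_conj, ← e2, ← e3]

theorem tendsto_splitCov_sub (hm : 3 ≤ m) {u : ℕ → ℝ} {lam : ℂ} {s x : ℝ} {E : ℕ → ℂ}
    (hlam : 3 / 2 < lam.re) (hs : s < lam.re - 1) (hs0 : 0 ≤ s) (hx : 1 ≤ x)
    (hu : (fun n => (u n : ℂ)) = coeffA m lam • negBinom lam +
      coeffA m (starRingEnd ℂ lam) • negBinom (starRingEnd ℂ lam) + E)
    (hE : E =O[atTop] fun n : ℕ => (n : ℝ) ^ s) :
    Tendsto (fun n : ℕ => splitCov m u (negBinom x) n / (n : ℝ) ^ (lam.re + x - 2) -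
      2 * (coeffA m lam * splitCoeff m lam x *
        Complex.exp (Complex.I * ((lam.im * Real.log n : ℝ) : ℂ))).re) atTop (𝓝 0) := by
  have hxc : 0 < (x : ℂ).re := by rw [Complex.ofReal_re]; linarith
  have h1 := (isLittleO_splitCov (m := m) (by omega) (w := lam) (v := x) (by linarith) hxc
    (s := lam.re + x - 2) (by simp) (by linarith)).const_mul_left (coeffA m lam)
  have h2 := (isLittleO_splitCov (m := m) (by omega) (w := starRingEnd ℂ lam) (v := x)
    (by rw [Complex.conj_re]; linarith) hxc (s := lam.re + x - 2) (by simp)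
    (by linarith)).const_mul_left (coeffA m (starRingEnd ℂ lam))
  have h3 := isLittleO_of_isBigO_lt (isBigO_splitCov (m := m) (by omega) (by linarith)
    (by linarith) (by linarith) hE (isBigO_negBinom (μ := (x : ℂ)) (s := x - 1) (by simp)) le_rfl)
    (show s + (x - 1) < lam.re + x - 2 by linarith)
  have h := (Asymptotics.isLittleO_norm_norm.2 ((h1.add h2).add h3)).tendsto_div_nhds_zero
  rw [tendsto_zero_iff_norm_tendsto_zero]
  refine h.congr' ?_
  filter_upwards [eventually_gt_atTop 0, eventually_ge_atTop (m - 1)] with n hn hnm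
  have hn'' : (0 : ℝ) < n := by exact_mod_cast hn
  have hp : 0 < (n : ℝ) ^ (lam.re + x - 2) := by positivity
  have hn2 : ‖(n : ℝ) ^ (lam.re + x - 2)‖ = ‖(((n : ℝ) ^ (lam.re + x - 2) : ℝ) : ℂ)‖ :=
    (Complex.norm_real _).symm
  conv_rhs => rw [← Complex.norm_real]
  rw [hn2, ← norm_div]
  congr 1
  have hcov : ((splitCov m u (negBinom x) n : ℝ) : ℂ) =
      coeffA m lam * splitCov m (negBinom lam) (negBinom x) n +
      coeffA m (starRingEnd ℂ lam) * splitCov m (negBinom (starRingEnd ℂ lam)) (negBinom x) n +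
      splitCov m E (negBinom x) n := by
    rw [ofReal_splitCov hnm, hu, show (fun k => ((negBinom x k : ℝ) : ℂ)) = negBinom (x : ℂ) from
      funext fun k => ofReal_negBinom x k, splitCov_add_left, splitCov_add_left, splitCov_smul_left,
      splitCov_smul_left]
    rfl
  have e2 : starRingEnd ℂ (Complex.exp (Complex.I * ((lam.im * Real.log n : ℝ) : ℂ))) =
      Complex.exp (Complex.I * (((starRingEnd ℂ lam).im * Real.log n : ℝ) : ℂ)) := by
    rw [← Complex.exp_conj]
    congr 1
    simp only [map_mul, Complex.conj_I, Complex.conj_ofReal, Complex.conj_im]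
    push_cast
    ring
  have r1 : (lam + x - 2).re = lam.re + x - 2 := by simp
  have r2 : (lam + x - 2).im = lam.im := by simp
  have r3 : (starRingEnd ℂ lam + x - 2).re = lam.re + x - 2 := by simp
  have r4 : (starRingEnd ℂ lam + x - 2).im = (starRingEnd ℂ lam).im := by simp
  have hp' : (((n : ℝ) ^ (lam.re + x - 2) : ℝ) : ℂ) ≠ 0 := by exact_mod_cast hp.ne'
  rw [Complex.ofReal_sub, ← Complex.add_conj, Complex.ofReal_div, hcov, cpow_eq_rpow_mul_exp hn,
    cpow_eq_rpow_mul_exp hn (starRingEnd ℂ lam + x - 2), r1, r2, r3, r4, splitCoeff_conj,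
    coeffA_conj, map_mul, map_mul, e2]
  generalize (((n : ℝ) ^ (lam.re + x - 2) : ℝ) : ℂ) = P at hp' ⊢
  generalize Complex.exp (Complex.I * ((lam.im * Real.log n : ℝ) : ℂ)) = e₁
  generalize Complex.exp (Complex.I * (((starRingEnd ℂ lam).im * Real.log n : ℝ) : ℂ)) = e₂
  field_simp
  ring

theorem continuous_periodicF1 (m : ℕ) (lam : ℂ) : Continuous (periodicF1 m lam) := by
  unfold periodicF1
  simp only [div_eq_mul_inv]
  fun_prop

theorem periodic_periodicF1 (m : ℕ) (lam : ℂ) :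
    Function.Periodic (periodicF1 m lam) (2 * Real.pi) := by
  intro t
  have : Complex.exp (2 * Complex.I * ((t + 2 * Real.pi : ℝ) : ℂ)) =
      Complex.exp (2 * Complex.I * t) := by
    rw [← Complex.exp_periodic.nat_mul 2 (2 * Complex.I * t)]
    congr 1
    push_cast
    ring
  simp only [periodicF1, this]

/-- Cauchy-Schwarz between the sums of u and of `negBinom x` over the subtree sizes, together with
`splitCov m u u` ≤ Var S_n. Both sides are of order n^(2α-2) n^(2x-2), so the inequality passes to
the periodic limits, and by density to every phase. -/
theorem sq_le_periodicF1 (hm : 3 ≤ m) {u q k c r : ℕ → ℝ} {e : ℂ → ℂ}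
    (H : IsMomentSystem m u k q c r e) {lam : ℂ} {s x : ℝ} {E : ℕ → ℂ}
    (hlam : 3 / 2 < lam.re) (him : 0 < lam.im) (hs : s < lam.re - 1) (hs0 : 0 ≤ s) (hx : 2 ≤ x)
    (hu : (fun n => (u n : ℂ)) = coeffA m lam • negBinom lam +
      coeffA m (starRingEnd ℂ lam) • negBinom (starRingEnd ℂ lam) + E)
    (hE : E =O[atTop] fun n : ℕ => (n : ℝ) ^ s) :
    ∃ C > 0, ∀ t : ℝ, (2 * (coeffA m lam * splitCoeff m lam x *
      Complex.exp (Complex.I * t)).re) ^ 2 ≤ C * periodicF1 m lam t := by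
  have hv := tendsto_variance_space_sub hm H hlam hs hs0 hu hE
  have hcov := tendsto_splitCov_sub hm hlam hs hs0 (show 1 ≤ x by linarith) hu hE
  set f : ℝ → ℝ := fun t => 2 * (coeffA m lam * splitCoeff m lam x *
      Complex.exp (Complex.I * t)).re with hf
  change Tendsto (fun n : ℕ => splitCov m u (negBinom x) n / (n : ℝ) ^ (lam.re + x - 2) -
    f (lam.im * Real.log n)) atTop (𝓝 0) at hcov
  have hO := isBigO_splitCov (m := m) (by omega) (s := x - 1) (t := x - 1) (by linarith)
    (by linarith) (by linarith) (isBigO_negBinom (μ := (x : ℂ)) (by simp))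
    (isBigO_negBinom (μ := (x : ℂ)) (by simp)) le_rfl
  obtain ⟨C, hC, hCb⟩ := hO.exists_pos
  rw [Asymptotics.isBigOWith_iff] at hCb
  refine ⟨C, hC, fun t => ?_⟩
  have hfc : Continuous f := by fun_prop
  have hfp : Function.Periodic f (2 * Real.pi) := by
    intro t
    have : Complex.exp (Complex.I * ((t + 2 * Real.pi : ℝ) : ℂ)) = Complex.exp (Complex.I * t) := by
      rw [← Complex.exp_periodic (Complex.I * t)]
      congr 1
      push_cast
      ring
    simp only [hf, this]
  obtain ⟨B, hB⟩ : ∃ B, ∀ t, |f t| ≤ B := by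
    refine ⟨2 * ‖coeffA m lam * splitCoeff m lam x‖, fun t => ?_⟩
    rw [hf]
    beta_reduce
    rw [abs_mul, abs_two]
    refine mul_le_mul_of_nonneg_left ((Complex.abs_re_le_norm _).trans ?_) zero_le_two
    rw [norm_mul, Complex.norm_exp]
    simp
  have key := nonneg_of_tendsto_log (g := fun t => C * periodicF1 m lam t - f t ^ 2)
    (((continuous_periodicF1 m lam).const_mul C).sub (hfc.pow 2))
    (fun t => by simp only [periodic_periodicF1 m lam t, hfp t]) him
    (a := fun n => C * ((q n - u n * u n) / (n : ℝ) ^ (2 * lam.re - 2)) -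
      (splitCov m u (negBinom x) n / (n : ℝ) ^ (lam.re + x - 2)) ^ 2) ?_ ?_ t
  · linarith
  · filter_upwards [hCb, eventually_gt_atTop 0, eventually_ge_atTop (m - 1)] with n h1 hn hnm
    have hn'' : (0 : ℝ) < n := by exact_mod_cast hn
    have h2 := sq_splitCov_le (by omega) hnm u (negBinom x)
    have h3 := H.splitCov_le_variance hnm
    have h4 := splitCov_self_nonneg (by omega) hnm u
    have h5 := splitCov_self_nonneg (by omega) hnm (negBinom x)
    have h6 : splitCov m (negBinom x) (negBinom x) n ≤ C * (n : ℝ) ^ (x - 1 + (x - 1)) := by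
      rw [show negBinom (x : ℂ) = fun k => ((negBinom x k : ℝ) : ℂ) from
        funext fun k => (ofReal_negBinom x k).symm, ← ofReal_splitCov hnm, Complex.norm_real,
        Real.norm_of_nonneg h5, Real.norm_of_nonneg (by positivity)] at h1
      exact h1
    have h7 : splitCov m u (negBinom x) n ^ 2 ≤
        (q n - u n * u n) * (C * (n : ℝ) ^ (x - 1 + (x - 1))) :=
      h2.trans (mul_le_mul h3 h6 h5 (H.variance_nonneg n))
    have h8 : ((n : ℝ) ^ (lam.re + x - 2)) ^ 2 =
        (n : ℝ) ^ (2 * lam.re - 2) * (n : ℝ) ^ (x - 1 + (x - 1)) := by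
      rw [sq, ← Real.rpow_add hn'', ← Real.rpow_add hn'']
      congr 1
      ring
    have p1 : 0 < (n : ℝ) ^ (2 * lam.re - 2) := by positivity
    have p2 : 0 < (n : ℝ) ^ (x - 1 + (x - 1)) := by positivity
    rw [sub_nonneg, div_pow, h8, div_le_iff₀ (by positivity)]
    refine h7.trans (le_of_eq ?_)
    field_simp
  · have h1 := hv.const_mul C
    have h2 : Tendsto (fun n : ℕ => (splitCov m u (negBinom x) n / (n : ℝ) ^ (lam.re + x - 2)) ^ 2 -
        f (lam.im * Real.log n) ^ 2) atTop (𝓝 0) := by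
      have h3 : Tendsto (fun n : ℕ => (splitCov m u (negBinom x) n /
          (n : ℝ) ^ (lam.re + x - 2) - f (lam.im * Real.log n)) * f (lam.im * Real.log n))
          atTop (𝓝 0) := by
        refine Tendsto.zero_mul_isBoundedUnder_le hcov ?_
        exact isBoundedUnder_of ⟨B, fun n => hB _⟩
      have h4 := (hcov.pow 2).add (h3.const_mul 2)
      rw [zero_pow two_ne_zero, mul_zero, add_zero] at h4
      exact h4.congr fun n => by ring
    have h5 := h1.sub h2
    rw [mul_zero, sub_zero] at h5
    exact h5.congr fun n => by ring

/-- If F_1(t) = 0, the test parameters 3 and 4 give Re ζ = 0 and Re(ζR) = 0 with ζ ≠ 0, so the ratio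
R of the two coefficients is real. As R is a nondegenerate real Möbius function of λ, λ would be
real. -/
theorem periodicF1_pos (hm : 3 ≤ m) {u q k c r : ℕ → ℝ} {e : ℂ → ℂ}
    (H : IsMomentSystem m u k q c r e) {lam : ℂ} {s : ℝ} {E : ℕ → ℂ}
    (hroot : indicial m lam = 0) (hlam : 3 / 2 < lam.re) (him : 0 < lam.im)
    (hs : s < lam.re - 1) (hs0 : 0 ≤ s)
    (hu : (fun n => (u n : ℂ)) = coeffA m lam • negBinom lam +
      coeffA m (starRingEnd ℂ lam) • negBinom (starRingEnd ℂ lam) + E)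
    (hE : E =O[atTop] fun n : ℕ => (n : ℝ) ^ s) (t : ℝ) : 0 < periodicF1 m lam t := by
  obtain ⟨C, hC, h3⟩ := sq_le_periodicF1 hm H hlam him hs hs0 (x := 3) (by norm_num) hu hE
  obtain ⟨C', hC', h4⟩ := sq_le_periodicF1 hm H hlam him hs hs0 (x := 4) (by norm_num) hu hE
  have hnn : 0 ≤ periodicF1 m lam t := by
    by_contra hneg
    have := (sq_nonneg _).trans (h3 t)
    nlinarith [not_le.1 hneg]
  refine lt_of_le_of_ne hnn fun hzero => ?_
  have h3t := h3 t
  have h4t := h4 t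
  rw [← hzero, mul_zero, sq_nonpos_iff, mul_eq_zero, or_iff_right two_ne_zero] at h3t h4t
  have hw : 0 < lam.re := by linarith
  have hΓ := Complex.Gamma_ne_zero_of_re_pos hw
  have hm1 := natCast_sub_one_ne_zero (m := m) (by omega)
  have hm2 : (m : ℂ) + 1 ≠ 0 := by exact_mod_cast Nat.succ_ne_zero m
  have hm3 : (m : ℂ) + 2 ≠ 0 := by exact_mod_cast Nat.succ_ne_zero (m + 1)
  have ne0 : lam ≠ 0 := by rintro rfl; simp at hw
  have ne1 : lam ≠ 1 := by rintro rfl; simp at him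
  have ne2 : lam ≠ 2 := by rintro rfl; simp at him
  have wm : lam + m ≠ 0 := add_natCast_ne_zero hw m
  have wm1 := add_sub_one_ne_zero (m := m) (by omega) hw
  have wm2 : lam + m + 1 ≠ 0 := by
    have := add_natCast_ne_zero hw (m + 1)
    push_cast at this
    rwa [← add_assoc] at this
  have hA := coeffA_ne_zero hm hroot ne0 ne1
  have k3 := Gamma_mul_splitCoeff_three (m := m) (by omega) hw hroot
  have k4 := Gamma_mul_splitCoeff_four (m := m) (by omega) hw hroot
  push_cast at h3t h4t
  have hk3 : splitCoeff m lam 3 ≠ 0 := by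
    intro h0
    rw [h0, mul_zero, eq_comm, div_eq_zero_iff] at k3
    have s1 := sub_ne_zero.2 ne1
    have s2 := sub_ne_zero.2 ne2
    simp [hm1, s1, s2, hm2, wm, wm1] at k3
  set R : ℂ := ((m + 4) * lam + 6 * (m + 1)) / (3 * (m + 2) * (lam + m + 1)) with hR
  have hk4 : splitCoeff m lam 4 = splitCoeff m lam 3 * R := by
    refine mul_left_cancel₀ hΓ ?_
    rw [← mul_assoc, k3, k4, hR]
    field_simp
    ring
  set ζ : ℂ := coeffA m lam * splitCoeff m lam 3 * Complex.exp (Complex.I * t) with hζ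
  have hζ0 : ζ ≠ 0 := mul_ne_zero (mul_ne_zero hA hk3) (Complex.exp_ne_zero _)
  have h5 : coeffA m lam * splitCoeff m lam 4 * Complex.exp (Complex.I * t) = ζ * R := by
    rw [hk4, hζ]; ring
  rw [h5, Complex.mul_re, h3t, zero_mul, zero_sub, neg_eq_zero, mul_eq_zero] at h4t
  have hRim : R.im = 0 := h4t.resolve_left fun h => hζ0 (Complex.ext h3t h)
  have hRr : R = (R.re : ℂ) := Complex.ext rfl (by simpa using hRim)
  have h6 : ((m : ℂ) + 4) * lam + 6 * (m + 1) = R.re * (3 * (m + 2) * (lam + m + 1)) := by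
    rw [← hRr, hR]
    field_simp
  set T : ℝ := R.re * (3 * (m + 2)) with hT
  have h7 : (((m : ℝ) + 4 - T : ℝ) : ℂ) * lam = ((T * (m + 1) - 6 * (m + 1) : ℝ) : ℂ) := by
    rw [hT]
    push_cast
    linear_combination h6
  have h8 := congrArg Complex.im h7
  rw [Complex.im_ofReal_mul, Complex.ofReal_im, mul_eq_zero, or_iff_left him.ne'] at h8
  -- In the degenerate case T = m + 4 and T = 6, hence m = 2, which is excluded.
  rw [h8, Complex.ofReal_zero, zero_mul, eq_comm, Complex.ofReal_eq_zero] at h7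
  have hm' : (3 : ℝ) ≤ m := by exact_mod_cast hm
  nlinarith

end Positivity

end

/-! ### The second zero and the limit of the correlation -/

noncomputable section

section Main

variable {m : ℕ}

theorem exists_isSecondZero (hm : 27 ≤ m) :
    ∃ lam : ℂ, indicial m lam = 0 ∧ 0 < lam.im ∧ 3 / 2 < lam.re ∧
      (∀ w : ℂ, IsSecondZero m w ↔ w = lam) ∧
      ∀ w : ℂ, indicial m w = 0 → w ≠ 2 → w ≠ lam → w ≠ starRingEnd ℂ lam → w.re < lam.re := by
  have hm2 : 2 ≤ m := by omega
  obtain ⟨z, hz, hzre, hz2⟩ := exists_indicial_zero hm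
  obtain ⟨w, hw, hmax⟩ := Finset.exists_max_image ((indicialRoots m).erase 2) Complex.re
    ⟨z, Finset.mem_erase.2 ⟨hz2, (mem_indicialRoots hm2).2 hz⟩⟩
  have hle : ∀ v : ℂ, indicial m v = 0 → v ≠ 2 → v.re ≤ w.re := fun v hv hv2 =>
    hmax v (Finset.mem_erase.2 ⟨hv2, (mem_indicialRoots hm2).2 hv⟩)
  have hw0 := (mem_indicialRoots hm2).1 (Finset.mem_of_mem_erase hw)
  have hw2 := Finset.ne_of_mem_erase hw
  have hwre : 3 / 2 < w.re := hzre.trans_le (hle z hz hz2)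
  have him := im_ne_zero_of_indicial hm2 hw0 hw2 (by linarith)
  obtain ⟨lam, hlam0, hlamim, hlamre⟩ : ∃ lam : ℂ, indicial m lam = 0 ∧ 0 < lam.im ∧
      lam.re = w.re := by
    rcases lt_or_gt_of_ne him with h | h
    · exact ⟨starRingEnd ℂ w, by rw [indicial_conj, hw0, map_zero], by simpa using h, by simp⟩
    · exact ⟨w, hw0, h, rfl⟩
  have heq : ∀ v : ℂ, indicial m v = 0 → v.re = lam.re → v = lam ∨ v = starRingEnd ℂ lam := by
    intro v hv hre
    rcases abs_eq_abs.1 (abs_im_eq_of_indicial hm2 hv hlam0 (by linarith) hre) with h | h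
    · exact Or.inl (Complex.ext hre h)
    · exact Or.inr (Complex.ext (by simpa using hre) (by simpa using h))
  refine ⟨lam, hlam0, hlamim, by linarith, fun v => ⟨fun hv => ?_, ?_⟩, fun v hv hv2 h1 h2 => ?_⟩
  · obtain ⟨hv0, hvim, hvmax⟩ := hv
    have hv2 : v ≠ 2 := by rintro rfl; simp at hvim
    have hlam2 : lam ≠ 2 := by rintro rfl; simp at hlamim
    have hre : v.re = lam.re := le_antisymm (hlamre ▸ hle v hv0 hv2) (hvmax lam hlam0 hlam2)
    refine (heq v hv0 hre).resolve_right fun h => ?_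
    rw [h, Complex.conj_im] at hvim
    linarith
  · rintro rfl
    exact ⟨hlam0, hlamim, fun u hu hu2 => hlamre ▸ hle u hu hu2⟩
  · refine lt_of_le_of_ne (hlamre ▸ hle v hv hv2) fun h => ?_
    rcases heq v hv h with h | h
    · exact h1 h
    · exact h2 h

/-- Finitely many strict inequalities leave a gap, so that one exponent below `t` serves all
remaining zeros. -/
theorem exists_re_bound (S : Finset ℂ) {t b : ℝ} (hb : b < t) (h : ∀ z ∈ S, z.re - 1 < t) :
    ∃ s, s < t ∧ b ≤ s ∧ ∀ z ∈ S, z.re - 1 ≤ s := by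
  induction S using Finset.induction_on with
  | empty => exact ⟨b, hb, le_rfl, by simp⟩
  | insert z S _ ih =>
    obtain ⟨s, h1, h2, h3⟩ := ih fun w hw => h w (by simp [hw])
    refine ⟨max s (z.re - 1), max_lt h1 (h z (by simp)), h2.trans (le_max_left _ _), fun w hw => ?_⟩
    rcases Finset.mem_insert.1 hw with rfl | hw
    · exact le_max_right _ _
    · exact (h3 w hw).trans (le_max_left _ _)

theorem IsMomentSystem.exists_path_error (hm : 3 ≤ m) {u q k c r : ℕ → ℝ} {e : ℂ → ℂ}
    (H : IsMomentSystem m u k q c r e) :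
    ∃ (g : ℝ) (G : ℕ → ℂ), g < 1 ∧ 0 ≤ g ∧
      (fun n => (k n : ℂ)) = (2 * (occ m : ℂ)) • negBinomD 2 + G ∧
      G =O[atTop] fun n : ℕ => (n : ℝ) ^ g := by
  obtain ⟨g, h1, h2, h3⟩ := exists_re_bound ((indicialRoots m).erase 2) zero_lt_one fun z hz => by
    have := re_lt_two_of_indicial (by omega)
      ((mem_indicialRoots (by omega)).1 (Finset.mem_of_mem_erase hz)) (Finset.ne_of_mem_erase hz)
    linarith
  exact ⟨g, _, h1, h2, H.path_eq, isBigO_sum_negBinom e h3⟩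

theorem IsMomentSystem.exists_space_error (hm : 3 ≤ m) {u q k c r : ℕ → ℝ} {e : ℂ → ℂ}
    (H : IsMomentSystem m u k q c r e) {lam : ℂ} (hroot : indicial m lam = 0) (him : 0 < lam.im)
    (hlam : 3 / 2 < lam.re) (hmax : ∀ w : ℂ, indicial m w = 0 → w ≠ 2 → w ≠ lam →
      w ≠ starRingEnd ℂ lam → w.re < lam.re) :
    ∃ (s : ℝ) (E : ℕ → ℂ), s < lam.re - 1 ∧ 0 ≤ s ∧
      (fun n => (u n : ℂ)) = coeffA m lam • negBinom lam +
        coeffA m (starRingEnd ℂ lam) • negBinom (starRingEnd ℂ lam) + E ∧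
      E =O[atTop] fun n : ℕ => (n : ℝ) ^ s := by
  set S := (((indicialRoots m).erase 2).erase lam).erase (starRingEnd ℂ lam) with hS
  obtain ⟨s, h1, h2, h3⟩ := exists_re_bound S (t := lam.re - 1) (b := 0) (by linarith) fun z hz => by
    simp only [hS, Finset.mem_erase] at hz
    linarith [hmax z ((mem_indicialRoots (by omega)).1 hz.2.2.2) hz.2.2.1 hz.2.1 hz.1]
  refine ⟨s, ∑ z ∈ S, coeffA m z • negBinom z, h1, h2, ?_, isBigO_sum_negBinom _ h3⟩
  have l2 : lam ≠ 2 := by rintro rfl; simp at him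
  have c2 : starRingEnd ℂ lam ≠ 2 := fun h => by
    have := congrArg Complex.im h
    simp at this
    linarith
  have cl : starRingEnd ℂ lam ≠ lam := fun h => by
    have := congrArg Complex.im h
    simp at this
    linarith
  have m1 : lam ∈ (indicialRoots m).erase 2 :=
    Finset.mem_erase.2 ⟨l2, (mem_indicialRoots (by omega)).2 hroot⟩
  have m2 : starRingEnd ℂ lam ∈ ((indicialRoots m).erase 2).erase lam :=
    Finset.mem_erase.2 ⟨cl, Finset.mem_erase.2 ⟨c2, conj_mem_indicialRoots (by omega)
      (Finset.mem_of_mem_erase m1)⟩⟩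
  rw [H.space_eq, ← Finset.add_sum_erase _ _ m1, ← Finset.add_sum_erase _ _ m2, add_assoc]

theorem IsMomentSystem.rhoSK_eq {u q k c r : ℕ → ℝ} {e : ℂ → ℂ}
    (H : IsMomentSystem m u k q c r e) (n : ℕ) :
    rhoSK m n = (c n - u n * k n) / (√(q n - u n * u n) * √(r n - k n * k n)) := by
  rw [rhoSK, correlation, H.covariance, H.variance_space, H.variance_path]

/-- Only orders matter: the covariance is o(n^(3/2)), while the standard deviations are at least
constant multiples of √n and n. -/
theorem IsMomentSystem.tendsto_rhoSK_zero (hm : 3 ≤ m) (hm' : m ≤ 26) {u q k c r : ℕ → ℝ}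
    {e : ℂ → ℂ} (H : IsMomentSystem m u k q c r e) :
    Tendsto (fun n : ℕ => rhoSK m n) atTop (𝓝 0) := by
  obtain ⟨g, G, hg, hg0, hk, hG⟩ := H.exists_path_error hm
  obtain ⟨s, hs, hs0, hS⟩ := exists_re_bound ((indicialRoots m).erase 2) (t := 1 / 2) (b := 0)
    (by norm_num) fun z hz => by
      have := re_lt_of_indicial hm hm'
        ((mem_indicialRoots (by omega)).1 (Finset.mem_of_mem_erase hz)) (Finset.ne_of_mem_erase hz)
      linarith
  have hu : (fun n => (u n : ℂ)) =O[atTop] fun n : ℕ => (n : ℝ) ^ s := by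
    rw [H.space_eq]
    exact isBigO_sum_negBinom _ hS
  have hcov := (Asymptotics.isLittleO_norm_norm.2
    (isLittleO_covariance_of_lt hm H hs hs0 hg hu hk hG)).tendsto_div_nhds_zero
  have hvar := tendsto_variance_path hm H hg hg0 hk hG
  obtain ⟨C, hC, hv⟩ := H.exists_le_variance hm
  have hK := constK_pos hm
  have h1 := hcov.mul_const (1 / (√C * √(constK m / 2)))
  rw [zero_mul] at h1
  rw [tendsto_zero_iff_norm_tendsto_zero]
  refine squeeze_zero' (Eventually.of_forall fun n => norm_nonneg _) ?_ h1
  filter_upwards [hv, hvar.eventually (eventually_gt_nhds (show constK m / 2 < constK m by linarith)),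
    eventually_gt_atTop 0] with n h2 h3 hn
  have hn'' : (0 : ℝ) < n := by exact_mod_cast hn
  have hp : 0 < (n : ℝ) ^ (2 : ℝ) := by positivity
  rw [lt_div_iff₀ hp] at h3
  have h4 : √C * √(constK m / 2) * (n : ℝ) ^ (3 / 2 : ℝ) ≤
      √(q n - u n * u n) * √(r n - k n * k n) := by
    have e1 : √C * √(constK m / 2) * (n : ℝ) ^ (3 / 2 : ℝ) =
        √(C * n) * √(constK m / 2 * (n : ℝ) ^ (2 : ℝ)) := by
      rw [Real.sqrt_mul hC.le, Real.sqrt_mul (by positivity), Real.sqrt_eq_rpow (n : ℝ),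
        Real.sqrt_eq_rpow ((n : ℝ) ^ (2 : ℝ)), ← Real.rpow_mul hn''.le,
        show (3 / 2 : ℝ) = 1 / 2 + 2 * (1 / 2) by norm_num, Real.rpow_add hn'']
      ring
    rw [e1]
    exact mul_le_mul (Real.sqrt_le_sqrt h2) (Real.sqrt_le_sqrt h3.le) (Real.sqrt_nonneg _)
      (Real.sqrt_nonneg _)
  rw [H.rhoSK_eq, norm_div, Complex.norm_real, Real.norm_of_nonneg
    (mul_nonneg (Real.sqrt_nonneg _) (Real.sqrt_nonneg _)), mul_one_div, div_div,
    Real.norm_of_nonneg (show 0 ≤ (n : ℝ) ^ (3 / 2 : ℝ) by positivity)]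
  refine div_le_div_of_nonneg_left (norm_nonneg _) (by positivity) ?_
  rw [mul_comm]
  exact h4

theorem continuous_periodicF2 (m : ℕ) (lam : ℂ) : Continuous (periodicF2 m lam) := by
  unfold periodicF2
  simp only [div_eq_mul_inv]
  fun_prop

theorem periodic_periodicF2 (m : ℕ) (lam : ℂ) :
    Function.Periodic (periodicF2 m lam) (2 * Real.pi) := by
  intro t
  have : Complex.exp (Complex.I * ((t + 2 * Real.pi : ℝ) : ℂ)) = Complex.exp (Complex.I * t) := by
    rw [← Complex.exp_periodic (Complex.I * t)]
    congr 1
    push_cast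
    ring
  simp only [periodicF2, this]

theorem exists_bound_of_periodic {f : ℝ → ℝ} (hc : Continuous f)
    (hp : Function.Periodic f (2 * Real.pi)) : ∃ B, ∀ t, |f t| ≤ B := by
  obtain ⟨B, hB⟩ := (hp.compact_of_continuous Real.two_pi_pos.ne' hc).isBounded.exists_norm_le
  exact ⟨B, fun t => hB _ ⟨t, rfl⟩⟩

/-- A quotient `C / √(V W)` can be compared with its asymptotic form if the latter stays
bounded. -/
theorem tendsto_div_sqrt_sub {C V W F f : ℕ → ℝ} {K b B : ℝ} (hK : 0 < K) (hb : 0 < b)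
    (hfB : ∀ n, |f n| ≤ B) (hFB : ∀ n, |F n| ≤ B) (hFb : ∀ n, b ≤ F n)
    (hC : Tendsto (fun n => C n - f n) atTop (𝓝 0)) (hV : Tendsto (fun n => V n - F n) atTop (𝓝 0))
    (hW : Tendsto W atTop (𝓝 K)) :
    Tendsto (fun n => C n / (√(V n) * √(W n)) - f n / √(K * F n)) atTop (𝓝 0) := by
  have hX : Tendsto (fun n => V n * W n - K * F n) atTop (𝓝 0) := by
    have h1 := hV.mul hW
    have h2 : Tendsto (fun n => (W n - K) * F n) atTop (𝓝 0) :=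
      Tendsto.zero_mul_isBoundedUnder_le (tendsto_sub_nhds_zero_iff.2 hW)
        (isBoundedUnder_of ⟨B, fun n => hFB n⟩)
    have h3 := h1.add h2
    rw [zero_mul, zero_add] at h3
    exact h3.congr fun n => by ring
  have hKb : 0 < K * b := mul_pos hK hb
  set δ := √(K * b / 2) with hδ
  have hδ0 : 0 < δ := Real.sqrt_pos.2 (by linarith)
  have hlim := (hC.abs.div_const δ).add ((hX.abs.const_mul B).div_const (δ * (δ * δ)))
  rw [abs_zero, zero_div, mul_zero, zero_div, zero_add] at hlim
  refine squeeze_zero_norm' ?_ hlim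
  filter_upwards [hX.eventually (eventually_gt_nhds (show -(K * b / 2) < 0 by linarith)),
    hW.eventually (eventually_gt_nhds hK)] with n h1 h2
  have hY : K * b ≤ K * F n := mul_le_mul_of_nonneg_left (hFb n) hK.le
  have hX' : K * b / 2 ≤ V n * W n := by linarith
  rw [← Real.sqrt_mul' _ h2.le]
  set x := √(V n * W n) with hx
  set y := √(K * F n) with hy
  have x1 : δ ≤ x := Real.sqrt_le_sqrt hX'
  have y1 : δ ≤ y := Real.sqrt_le_sqrt (by linarith)
  have hx2 : x ^ 2 = V n * W n := Real.sq_sqrt (by linarith)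
  have hy2 : y ^ 2 = K * F n := Real.sq_sqrt (by linarith)
  have x0 : 0 < x := hδ0.trans_le x1
  have y0 : 0 < y := hδ0.trans_le y1
  -- Uses 1/x - 1/y = (y^2 - x^2)/(x y (x+y)), so only a positive lower bound for both roots is
  -- needed.
  have key : C n / x - f n / y =
      (C n - f n) / x - f n * (V n * W n - K * F n) / (x * (y * (x + y))) := by
    rw [← hx2, ← hy2]
    field_simp
    ring
  rw [key, Real.norm_eq_abs]
  refine (abs_sub _ _).trans (add_le_add ?_ ?_)
  · rw [abs_div, abs_of_pos x0]
    gcongr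
  · rw [abs_div, abs_mul, abs_of_pos (show 0 < x * (y * (x + y)) by positivity)]
    have hB0 : 0 ≤ B := (abs_nonneg _).trans (hfB n)
    have := hfB n
    have h5 : δ ≤ x + y := by linarith
    gcongr

end Main

theorem corollary2p2 (m : ℕ) (hm : 3 ≤ m) :
    (∀ᶠ n : ℕ in atTop,
      0 < Var[spaceReq m n; permMeasure n] ∧ 0 < Var[keyPath m n; permMeasure n]) ∧
    0 < constK m ∧
    (m ≤ 26 → Tendsto (fun n : ℕ => rhoSK m n) atTop (𝓝 0)) ∧
    (27 ≤ m → ∃ lam : ℂ, (∀ w : ℂ, IsSecondZero m w ↔ w = lam) ∧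
      (∀ t : ℝ, 0 < periodicF1 m lam t) ∧
      Tendsto (fun n : ℕ => rhoSK m n -
          periodicF2 m lam (lam.im * Real.log n) /
            √(constK m * periodicF1 m lam (lam.im * Real.log n)))
        atTop (𝓝 0)) := by
  obtain ⟨u, k, q, c, r, e, H⟩ := exists_isMomentSystem hm
  obtain ⟨g, G, hg, hg0, hk, hG⟩ := H.exists_path_error hm
  have hvar := tendsto_variance_path hm H hg hg0 hk hG
  have hK := constK_pos hm
  refine ⟨?_, hK, fun hm' => H.tendsto_rhoSK_zero hm hm', fun hm' => ?_⟩
  · obtain ⟨C, hC, hv⟩ := H.exists_le_variance hm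
    filter_upwards [hv, hvar.eventually (eventually_gt_nhds hK), eventually_gt_atTop 0]
      with n h1 h2 hn
    have hn'' : (0 : ℝ) < n := by exact_mod_cast hn
    rw [H.variance_space, H.variance_path]
    exact ⟨(mul_pos hC hn'').trans_le h1, (div_pos_iff_of_pos_right (by positivity)).1 h2⟩
  · obtain ⟨lam, hroot, him, hlam, hiff, hmax⟩ := exists_isSecondZero hm'
    obtain ⟨s, E, hs, hs0, hu, hE⟩ := H.exists_space_error hm hroot him hlam hmax
    have hF1 := periodicF1_pos hm H hroot hlam him hs hs0 hu hE
    refine ⟨lam, hiff, hF1, ?_⟩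
    have hcov := tendsto_covariance_sub hm H hroot hlam hs hs0 hg hg0 hu hE hk hG
    have hspace := tendsto_variance_space_sub hm H hlam hs hs0 hu hE
    obtain ⟨B1, hB1⟩ := exists_bound_of_periodic (continuous_periodicF1 m lam)
      (periodic_periodicF1 m lam)
    obtain ⟨B2, hB2⟩ := exists_bound_of_periodic (continuous_periodicF2 m lam)
      (periodic_periodicF2 m lam)
    -- Boundedness of the continuous periodic function 1/F_1 turns pointwise positivity into a
    -- uniform lower bound.
    obtain ⟨B3, hB3⟩ := exists_bound_of_periodic (f := fun t => (periodicF1 m lam t)⁻¹)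
      ((continuous_periodicF1 m lam).inv₀ fun t => (hF1 t).ne')
      (fun t => by simp only [periodic_periodicF1 m lam t])
    have hB3' : 0 < B3 := (abs_pos.2 (inv_ne_zero (hF1 0).ne')).trans_le (hB3 0)
    have hmin : ∀ t, B3⁻¹ ≤ periodicF1 m lam t := fun t => by
      have := hB3 t
      rw [abs_of_pos (inv_pos.2 (hF1 t))] at this
      exact (inv_le_comm₀ hB3' (hF1 t)).2 this
    have main := tendsto_div_sqrt_sub hK (inv_pos.2 hB3') (B := max B2 B1)
      (fun n : ℕ => (hB2 (lam.im * Real.log n)).trans (le_max_left _ _))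
      (fun n : ℕ => (hB1 (lam.im * Real.log n)).trans (le_max_right _ _))
      (fun n : ℕ => hmin (lam.im * Real.log n)) hcov hspace hvar
    refine main.congr' ?_
    filter_upwards [eventually_gt_atTop 0] with n hn
    have hn'' : (0 : ℝ) < n := by exact_mod_cast hn
    congr 1
    -- The normalisation n^α of the covariance is the product of those of the standard deviations,
    -- n^(α-1) and n, so it drops out of the quotient.
    have p1 : 0 < (n : ℝ) ^ (lam.re - 1) := by positivity
    have p2 : 0 < (n : ℝ) ^ (1 : ℝ) := by positivity
    have e1 : (n : ℝ) ^ (2 * lam.re - 2) = ((n : ℝ) ^ (lam.re - 1)) ^ 2 := by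
      rw [sq, ← Real.rpow_add hn'']
      congr 1
      ring
    have e2 : (n : ℝ) ^ (2 : ℝ) = ((n : ℝ) ^ (1 : ℝ)) ^ 2 := by
      rw [sq, ← Real.rpow_add hn'']
      norm_num
    have e3 : (n : ℝ) ^ lam.re = (n : ℝ) ^ (lam.re - 1) * (n : ℝ) ^ (1 : ℝ) := by
      rw [← Real.rpow_add hn'']
      congr 1
      ring
    rw [H.rhoSK_eq, e1, e2, e3, Real.sqrt_div' _ (by positivity), Real.sqrt_div' _ (by positivity),
      Real.sqrt_sq p1.le, Real.sqrt_sq p2.le, div_mul_div_comm, div_div_div_cancel_right₀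
      (by positivity)]

end
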